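/- Let $n\in\{2,3\}$, $k>0$, and let $D\subset\Omega\subset\mathbb{R}^n$ be bounded open sets with Lipschitz boundary (connectedness is not required); let $\nu$ be the outward unit normal to $\partial\Omega$, which exists at almost every point of $\partial\Omega$. Let $\eta\in L^\infty(\mathbb{R}^n;\mathbb{C})$ with $\eta=0$ almost everywhere in $\mathbb{R}^n\setminus\overline D$. For each $d\in\mathbb{S}^{n-1}$ let $u_{\rm sc}(\cdot,d)\in H^1_{\rm loc}(\mathbb{R}^n)$ be such that $u(x,d)=u_{\rm sc}(x,d)+e^{ikx\cdot d}$ is a weak solution of $$\Delta u+k^2(1+\eta)u=0\quad\text{in }\mathbb{R}^n,$$ and $u_{\rm sc}$ satisfies the Sommerfeld radiation condition $\lim_{r\to\infty}r^{(n-1)/2}(\partial u_{\rm sc}/\partial r-iku_{\rm sc})=0$, $r=|x|$, uniformly in $x/|x|$. Let $$\Phi(x,y)=\begin{cases}\frac{i}{4}H^{(1)}_0(k|x-y|), & n=2,\\[2pt] \frac{e^{ik|x-y|}}{4\pi|x-y|}, & n=3,\end{cases}\qquad x\neq y,$$ and for $z\in\mathbb{R}^n$ define $$I_2(z)=\int_{\mathbb{S}^{n-1}}\left|\int_{\partial\Omega}\left(\frac{\partial\,\mathrm{Im}\,\Phi(x,z)}{\partial\nu(x)}u_{\rm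 sc}(x,d)-\mathrm{Im}\,\Phi(x,z)\frac{\partial u_{\rm sc}(x,d)}{\partial\nu(x)}\right)ds(x)\right|^2ds(d).$$ Then each $u_{\rm sc}(\cdot,d)$ has a $C^1$ representative (whose Cauchy data on $\partial\Omega$ are used in $I_2$), the integral over $\partial\Omega$ above and the integral over $D$ below exist, and for every $z\in\mathbb{R}^n$ $$I_2(z)=\int_{\mathbb{S}^{n-1}}\left|k^2\int_D\mathrm{Im}\,\Phi(y,z)\,\eta(y)\,u(y,d)\,dy\right|^2ds(d),$$ where the two outer integrals are integrals of nonnegative functions with values in $[0,\infty]$. Moreover, for $y\ne z$, $$\mathrm{Im}\,\Phi(y,z)=\begin{cases}\frac14J_0(k|z-y|), & n=2,\\[2pt] \frac{k}{4\pi}j_0(k|z-y|), & n=3,\end{cases}$$ where $j_0(t)=\sin t/t$. -/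

import Mathlib

open MeasureTheory Filter Topology
open scoped ContDiff

noncomputable section

namespace Scattering

/-! ### Special functions of order zero -/

/-- Bessel function of the first kind `J₀(t) = ∑ (-1)^m (t/2)^(2m) / (m!)²`. -/
def besselJ0 (t : ℝ) : ℝ :=
  ∑' m : ℕ, (-1 : ℝ) ^ m * (t / 2) ^ (2 * m) / (m.factorial : ℝ) ^ 2

/-- Bessel function of the second kind, for `t > 0`:
`Y₀(t) = (2/π) (log(t/2) + γ) J₀(t) - (2/π) ∑ (-1)^m H_m (t/2)^(2m) / (m!)²`,
with `γ` Euler's constant and `H_m` the harmonic numbers. -/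
def besselY0 (t : ℝ) : ℝ :=
  2 / Real.pi * (Real.log (t / 2) + Real.eulerMascheroniConstant) * besselJ0 t
    - 2 / Real.pi *
      ∑' m : ℕ, (-1 : ℝ) ^ m * (harmonic m : ℝ) * (t / 2) ^ (2 * m) / (m.factorial : ℝ) ^ 2

/-- Hankel function of the first kind `H₀⁽¹⁾ = J₀ + i Y₀`. -/
def hankel0 (t : ℝ) : ℂ := (besselJ0 t : ℂ) + Complex.I * (besselY0 t : ℂ)

/-- Radiating fundamental solution of the Helmholtz equation `Δ + k²` in dimensions 2 and 3,
meaningful for `x ≠ y` (other dimensions get the dummy value `0`). -/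
def green {n : ℕ} (k : ℝ) (x y : EuclideanSpace ℝ (Fin n)) : ℂ :=
  if n = 2 then Complex.I / 4 * hankel0 (k * ‖x - y‖)
  else if n = 3 then
    Complex.exp (Complex.I * (k : ℂ) * (‖x - y‖ : ℂ)) / (4 * (Real.pi : ℂ) * (‖x - y‖ : ℂ))
  else 0

/-! ### Domains, surface measure, normal vector -/

/-- `D` is a bounded open set with Lipschitz boundary: near each boundary point, and in suitable
orthonormal coordinates with last axis `e`, `D` is the region below the graph of a Lipschitz
function (of the component `x - ⟪e, x⟫ e` of `x` orthogonal to `e`). -/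
structure IsBoundedLipschitz {n : ℕ} (D : Set (EuclideanSpace ℝ (Fin n))) : Prop where
  isOpen : IsOpen D
  isBounded : Bornology.IsBounded D
  graph : ∀ p ∈ frontier D, ∃ (e : EuclideanSpace ℝ (Fin n)) (r : ℝ) (K : NNReal)
    (γ : EuclideanSpace ℝ (Fin n) → ℝ), ‖e‖ = 1 ∧ 0 < r ∧ LipschitzWith K γ ∧
      ∀ x ∈ Metric.ball p r, (x ∈ D ↔ inner ℝ e x < γ (x - inner ℝ e x • e))

/-- Surface measure on `∂Ω`: the `(n-1)`-dimensional Hausdorff measure, normalized to agree with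
`(n-1)`-dimensional Lebesgue measure on hyperplanes. -/
def surfaceMeasure {n : ℕ} (Ω : Set (EuclideanSpace ℝ (Fin n))) :
    Measure (EuclideanSpace ℝ (Fin n)) :=
  (Measure.euclideanHausdorffMeasure (n - 1)).restrict (frontier Ω)

/-- The unit vector `ν` is the outward normal to `∂Ω` at `x`: near `x`, every cone around `-ν` of
opening less than a right angle lies in `Ω`, and every such cone around `ν` lies outside `Ω`. -/
def IsOutwardNormal {n : ℕ} (Ω : Set (EuclideanSpace ℝ (Fin n)))
    (x ν : EuclideanSpace ℝ (Fin n)) : Prop :=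
  ‖ν‖ = 1 ∧ ∀ ε : ℝ, 0 < ε → ∀ᶠ y in 𝓝 x,
    (inner ℝ ν (y - x) < -ε * ‖y - x‖ → y ∈ Ω) ∧ (ε * ‖y - x‖ < inner ℝ ν (y - x) → y ∉ Ω)

open Classical in
/-- The outward unit normal at `x`. It exists at almost every boundary point of a Lipschitz
domain; where there is none the value is `0`. -/
def outwardNormal {n : ℕ} (Ω : Set (EuclideanSpace ℝ (Fin n)))
    (x : EuclideanSpace ℝ (Fin n)) : EuclideanSpace ℝ (Fin n) :=
  if h : ∃ ν, IsOutwardNormal Ω x ν then h.choose else 0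

/-- The normal derivative `∂f/∂ν` at a point `x` of `∂Ω`. -/
def normalDeriv {n : ℕ} {F : Type*} [NormedAddCommGroup F] [NormedSpace ℝ F]
    (Ω : Set (EuclideanSpace ℝ (Fin n))) (f : EuclideanSpace ℝ (Fin n) → F)
    (x : EuclideanSpace ℝ (Fin n)) : F :=
  fderiv ℝ f x (outwardNormal Ω x)

/-! ### The scattering problem -/

/-- `f ∈ L²_loc(ℝⁿ)`. -/
def MemL2Loc {n : ℕ} (f : EuclideanSpace ℝ (Fin n) → ℂ) : Prop :=
  ∀ K : Set (EuclideanSpace ℝ (Fin n)), IsCompact K → MemLp f 2 (volume.restrict K)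

/-- The partial derivative `∂φ/∂xᵢ` at `x`. -/
def partialDeriv {n : ℕ} (i : Fin n) (φ : EuclideanSpace ℝ (Fin n) → ℝ)
    (x : EuclideanSpace ℝ (Fin n)) : ℝ :=
  fderiv ℝ φ x (EuclideanSpace.single i 1)

/-- `G i` is the weak partial derivative `∂ᵢ u` for every `i`. -/
def IsWeakGradient {n : ℕ} (u : EuclideanSpace ℝ (Fin n) → ℂ)
    (G : Fin n → EuclideanSpace ℝ (Fin n) → ℂ) : Prop :=
  ∀ (i : Fin n) (φ : EuclideanSpace ℝ (Fin n) → ℝ), ContDiff ℝ ∞ φ → HasCompactSupport φ →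
    ∫ x, (partialDeriv i φ x : ℂ) * u x = -∫ x, (φ x : ℂ) * G i x

/-- `u ∈ H¹_loc(ℝⁿ)` is a weak solution of `Δu + k²(1+η)u = 0` in `ℝⁿ`. -/
def IsWeakHelmholtzSolution {n : ℕ} (k : ℝ) (η u : EuclideanSpace ℝ (Fin n) → ℂ) : Prop :=
  MemL2Loc u ∧ ∃ G : Fin n → EuclideanSpace ℝ (Fin n) → ℂ,
    (∀ i, MemL2Loc (G i)) ∧ IsWeakGradient u G ∧
    ∀ φ : EuclideanSpace ℝ (Fin n) → ℝ, ContDiff ℝ ∞ φ → HasCompactSupport φ →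
      ∫ x, ∑ i, G i x * (partialDeriv i φ x : ℂ)
        = ∫ x, (k : ℂ) ^ 2 * (1 + η x) * u x * (φ x : ℂ)

/-- The representative of a locally integrable function given by the limits of its averages over
shrinking balls. If `f` agrees almost everywhere with a continuous function, then this is that
continuous function. -/
def rep {n : ℕ} (f : EuclideanSpace ℝ (Fin n) → ℂ) (x : EuclideanSpace ℝ (Fin n)) : ℂ :=
  limUnder (𝓝[>] (0 : ℝ)) fun r => ⨍ y in Metric.ball x r, f y

/-- The Sommerfeld radiation condition `r^((n-1)/2) (∂v/∂r - ikv) → 0` as `r = |x| → ∞`,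
uniformly in `x/|x|`. -/
def IsRadiating {n : ℕ} (k : ℝ) (v : EuclideanSpace ℝ (Fin n) → ℂ) : Prop :=
  Tendsto (fun x => ((‖x‖ ^ (((n : ℝ) - 1) / 2) : ℝ) : ℂ) *
    (fderiv ℝ v x (‖x‖⁻¹ • x) - Complex.I * (k : ℂ) * v x))
    (Bornology.cobounded (EuclideanSpace ℝ (Fin n))) (𝓝 0)

/-- The plane wave `e^{ik x·d}`. -/
def planeWave {n : ℕ} (k : ℝ) (d x : EuclideanSpace ℝ (Fin n)) : ℂ :=
  Complex.exp (Complex.I * (k : ℂ) * (inner ℝ x d : ℝ))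

/-- The total field `u = u_sc + u_in`, with incident plane wave of direction `d`. -/
def totalField {n : ℕ} (k : ℝ) (d : EuclideanSpace ℝ (Fin n))
    (usc : EuclideanSpace ℝ (Fin n) → ℂ) (x : EuclideanSpace ℝ (Fin n)) : ℂ :=
  usc x + planeWave k d x

/-- `usc` is a scattered field for the plane wave of direction `d`: the total field is a weak
solution of class `H¹_loc` (equivalently `usc` is of this class, since plane waves are smooth), and
`usc` is radiating. -/
structure IsScatteredField {n : ℕ} (k : ℝ) (η : EuclideanSpace ℝ (Fin n) → ℂ)
    (d : EuclideanSpace ℝ (Fin n)) (usc : EuclideanSpace ℝ (Fin n) → ℂ) : Prop where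
  weakSolution : IsWeakHelmholtzSolution k η (totalField k d usc)
  radiating : IsRadiating k (rep usc)

/-! ### The imaging functional -/

/-- The integrand over `∂Ω` of the imaging functional, for one incident direction:
`∂ν Im Φ(x,z) v(x) - Im Φ(x,z) ∂ν v(x)`, with Cauchy data `v`, `∂ν v` on `∂Ω`. -/
def boundaryIntegrand {n : ℕ} (k : ℝ) (Ω : Set (EuclideanSpace ℝ (Fin n)))
    (v : EuclideanSpace ℝ (Fin n) → ℂ) (z x : EuclideanSpace ℝ (Fin n)) : ℂ :=
  (normalDeriv Ω (fun x' => (green k x' z).im) x : ℂ) * v x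
    - ((green k x z).im : ℂ) * normalDeriv Ω v x

/-- The imaging functional `I₂(z)`, as the integral of a nonnegative function with respect to the
surface measure of the unit sphere of incident directions. The Cauchy data on `∂Ω` are those of the
continuous representative of the scattered field. -/
def imagingI2 {n : ℕ} (k : ℝ) (Ω : Set (EuclideanSpace ℝ (Fin n)))
    (usc : Metric.sphere (0 : EuclideanSpace ℝ (Fin n)) 1 → EuclideanSpace ℝ (Fin n) → ℂ)
    (z : EuclideanSpace ℝ (Fin n)) : ENNReal :=
  ∫⁻ d, ‖∫ x, boundaryIntegrand k Ω (rep (usc d)) z x ∂(surfaceMeasure Ω)‖ₑ ^ 2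
    ∂(volume : Measure (EuclideanSpace ℝ (Fin n))).toSphere

end Scattering

end

open Scattering

noncomputable section

open MeasureTheory Filter Topology Module
open scoped ContDiff NNReal ENNReal

set_option linter.unusedSectionVars false

namespace Scattering

/-! ### Area formula for expanding injective maps -/

section AreaFormula

variable {X Y Z : Type*} [MetricSpace Y] [MeasurableSpace Y] [BorelSpace Y]
  [MetricSpace Z] [MeasurableSpace Z] [BorelSpace Z]

/-! The singular part of Φ(·, z) is real, so Im Φ(·, z) agrees off z with a smooth radial function w
solving Δw + k²w = 0 on the whole space: a multiple of J₀ or sinc, given by an entire series in ‖x −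
z‖² (`radialWave`). The scattered field v satisfies Δv + k²v = −k²ηu. Green's second identity on Ω
therefore turns the boundary integral of v ∂w/∂ν − w ∂v/∂ν into the integral of v Δw − w Δv = k²wηu.
This integrand vanishes almost everywhere off D, because ∂D is Lebesgue-null. The inner integrals
thus agree for each d and z, and so do the outer ones.

The work lies in justifying Green's identity when Ω is only Lipschitz, η only bounded, and u only a
weak solution.

Geometry: an area formula shows that Hausdorff measure on a Lipschitz graph has density
`areaElement`, and Rademacher's theorem produces the normal almost everywhere. Fubini in sheared
coordinates gives Gauss–Green below a graph (`setIntegral_subgraph_fderiv`), and a partition of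
unity gives it on Ω. Since Δv need not be continuous, the field v∇w − w∇v is mollified and a limit
is taken (`integral_boundary_eq_of_weakDivergence`).

Regularity: mollification uses a kernel whose derivative in the scale is a Laplacian, so the
equation expresses the change of the mollified u between scales through f = Δu alone. In dimension
at most three, f in L²_loc makes u continuous. The right-hand side is then locally bounded, and a
second pass makes u a C¹ function (`IsWeakHelmholtzSolution.exists_contDiff`). -/

lemma euclideanHausdorffMeasure_image_le_of_dist_le {f : X → Y} {g : X → Z} {A : Set X} {K : ℝ≥0}
    (m : ℕ) (h : ∀ x ∈ A, ∀ y ∈ A, dist (f x) (f y) ≤ K * dist (g x) (g y)) :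
    (Measure.euclideanHausdorffMeasure m : Measure Y) (f '' A) ≤
      (K : ℝ≥0∞) ^ m * (Measure.euclideanHausdorffMeasure m : Measure Z) (g '' A) := by
  rcases A.eq_empty_or_nonempty with rfl | ⟨a, ha⟩
  · simp
  have : Nonempty X := ⟨a⟩
  -- A branch of the inverse of g. Injectivity of g is not needed: points with equal g-value also
  -- have equal f-value, so `f ∘ q` covers all of f '' A.
  let q : Z → X := Function.invFunOn g A
  have hq : ∀ z ∈ g '' A, q z ∈ A ∧ g (q z) = z := fun z hz =>
    ⟨Function.invFunOn_mem hz, Function.invFunOn_eq hz⟩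
  have hL : LipschitzOnWith K (f ∘ q) (g '' A) := by
    refine LipschitzOnWith.of_dist_le_mul fun z hz w hw => ?_
    have := h _ (hq z hz).1 _ (hq w hw).1
    rwa [(hq z hz).2, (hq w hw).2] at this
  have himg : f '' A ⊆ (f ∘ q) '' (g '' A) := by
    rintro _ ⟨x, hx, rfl⟩
    refine ⟨g x, ⟨x, hx, rfl⟩, ?_⟩
    have h1 := hq (g x) ⟨x, hx, rfl⟩
    have := h _ h1.1 _ hx
    rw [h1.2, dist_self, mul_zero] at this
    exact dist_le_zero.1 this
  have h2 := hL.hausdorffMeasure_image_le (d := m) (by positivity)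
  rw [Measure.euclideanHausdorffMeasure_def, Measure.euclideanHausdorffMeasure_def,
    Measure.smul_apply, Measure.smul_apply, ENNReal.smul_def, ENNReal.smul_def, smul_eq_mul,
    smul_eq_mul, mul_left_comm]
  gcongr
  refine (measure_mono himg).trans (h2.trans ?_)
  rw [ENNReal.rpow_natCast]

variable {U V : Type*} [NormedAddCommGroup U] [InnerProductSpace ℝ U] [FiniteDimensional ℝ U]
  [MeasurableSpace U] [BorelSpace U] [NormedAddCommGroup V] [InnerProductSpace ℝ V]
  [FiniteDimensional ℝ V] [MeasurableSpace V] [BorelSpace V]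

/-- `normDet` is the factor by which the image of the unit ball scales in measure, so a comparison
of norms passes to determinants with one factor K per dimension. -/
lemma normDet_le_of_norm_le {L L' : U →ₗ[ℝ] V} {K : ℝ≥0} (h : ∀ v, ‖L v‖ ≤ K * ‖L' v‖) :
    ENNReal.ofReal L.normDet ≤ (K : ℝ≥0∞) ^ finrank ℝ U * ENNReal.ofReal L'.normDet := by
  have h1 := euclideanHausdorffMeasure_image_le_of_dist_le (f := L) (g := L')
    (A := Metric.ball (0 : U) 1) (K := K) (finrank ℝ U) (by
      intro x _ y _
      simpa only [dist_eq_norm, ← map_sub] using h (x - y))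
  rw [LinearMap.euclideanHausdorffMeasure_image_eq_normDet_mul_volume,
    LinearMap.euclideanHausdorffMeasure_image_eq_normDet_mul_volume, ← mul_assoc] at h1
  exact (ENNReal.mul_le_mul_iff_left (Metric.measure_ball_pos volume _ one_pos).ne'
    measure_ball_lt_top.ne).1 h1

/-- Since L does not shrink vectors, an error relative to ‖v‖ is also one relative to ‖L v‖. The
tolerance 1 − K⁻¹ serves both bounds: 1 − (1 − K⁻¹) = K⁻¹, and 1 + (1 − K⁻¹) ≤ K because (K − 1)² ≥
0. -/
lemma norm_le_of_norm_sub_le {L : U →L[ℝ] V} {K : ℝ≥0} (hK : 1 ≤ K)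
    (hL : ∀ v, ‖v‖ ≤ ‖L v‖) {a : V} {v : U} (ha : ‖a - L v‖ ≤ (1 - (K : ℝ)⁻¹) * ‖v‖) :
    ‖a‖ ≤ K * ‖L v‖ ∧ ‖L v‖ ≤ K * ‖a‖ := by
  have hK0 : (1 : ℝ) ≤ K := by exact_mod_cast hK
  have hKi : (K : ℝ)⁻¹ ≤ 1 := inv_le_one_of_one_le₀ hK0
  have hKK : (K : ℝ) * (K : ℝ)⁻¹ = 1 := mul_inv_cancel₀ (by positivity)
  have h1 : ‖a - L v‖ ≤ (1 - (K : ℝ)⁻¹) * ‖L v‖ :=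
    ha.trans (mul_le_mul_of_nonneg_left (hL v) (by linarith))
  have h2 := norm_sub_norm_le a (L v)
  have h3 := norm_sub_norm_le (L v) a
  rw [norm_sub_rev] at h3
  have hp := norm_nonneg (L v)
  constructor
  · have : 2 - (K : ℝ)⁻¹ ≤ K := by nlinarith [sq_nonneg ((K : ℝ) - 1), inv_nonneg.2 (zero_le_one.trans hK0)]
    nlinarith
  · have h4 : (K : ℝ)⁻¹ * ‖L v‖ ≤ ‖a‖ := by nlinarith
    calc ‖L v‖ = K * ((K : ℝ)⁻¹ * ‖L v‖) := by rw [← mul_assoc, hKK, one_mul]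
      _ ≤ K * ‖a‖ := by gcongr

/-- On a set on which the derivative oscillates little, the measure of the image and the integral
of the Jacobian agree up to a factor close to one. -/
lemma measure_image_comparison_of_small_oscillation {G : U → V} {G' : U → U →L[ℝ] V} {s : Set U} (hs : MeasurableSet s)
    (hG : ∀ y ∈ s, HasFDerivAt G (G' y) y) (hinj : Set.InjOn G s)
    (hexp : ∀ y ∈ s, ∀ v, ‖v‖ ≤ ‖G' y v‖) {K : ℝ≥0} (hK : 1 < K)
    (hosc : ∀ y ∈ s, ∀ y' ∈ s, ‖G' y - G' y'‖ ≤ 1 - (K : ℝ)⁻¹) :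
    (Measure.euclideanHausdorffMeasure (finrank ℝ U) : Measure V) (G '' s) ≤
        (K : ℝ≥0∞) ^ (2 * finrank ℝ U) * ∫⁻ y in s, ENNReal.ofReal (G' y).normDet ∧
      ∫⁻ y in s, ENNReal.ofReal (G' y).normDet ≤ (K : ℝ≥0∞) ^ (2 * finrank ℝ U) *
        (Measure.euclideanHausdorffMeasure (finrank ℝ U) : Measure V) (G '' s) := by
  rcases s.eq_empty_or_nonempty with rfl | hne
  · simp
  have hK0 : (1 : ℝ) < K := by exact_mod_cast hK
  have hKi : (K : ℝ)⁻¹ < 1 := inv_lt_one_of_one_lt₀ hK0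
  obtain ⟨δ, hδ⟩ : ∃ δ : ℝ≥0, (δ : ℝ) = 1 - (K : ℝ)⁻¹ := ⟨⟨1 - (K : ℝ)⁻¹, by linarith⟩, rfl⟩
  obtain ⟨t, A, tdisj, tmeas, tcov, tapp, tA⟩ :=
    exists_partition_approximatesLinearOn_of_hasFDerivWithinAt G s G'
      (fun y hy => (hG y hy).hasFDerivWithinAt) (fun _ => δ)
      (fun _ h => by rw [h, NNReal.coe_zero] at hδ; linarith)
  have tA := tA hne
  have hcont : ContinuousOn G s := fun y hy => (hG y hy).continuousAt.continuousWithinAt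
  have hsm : ∀ n, MeasurableSet (s ∩ t n) := fun n => hs.inter (tmeas n)
  have hsU : s = ⋃ n, s ∩ t n := by
    rw [← Set.inter_iUnion, Set.inter_eq_left.2 tcov]
  have hdisj : Pairwise (Function.onFun Disjoint fun n => s ∩ t n) := fun i j hij =>
    (tdisj hij).mono Set.inter_subset_right Set.inter_subset_right
  set m := finrank ℝ U
  -- One factor K^m comes from comparing G with its linear approximation `A n` on the piece, the
  -- other from comparing the Jacobians of `G' y` and `A n`.
  have hpiece : ∀ n, (Measure.euclideanHausdorffMeasure m : Measure V) (G '' (s ∩ t n)) ≤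
        (K : ℝ≥0∞) ^ (2 * m) * ∫⁻ y in s ∩ t n, ENNReal.ofReal (G' y).normDet ∧
      ∫⁻ y in s ∩ t n, ENNReal.ofReal (G' y).normDet ≤ (K : ℝ≥0∞) ^ (2 * m) *
        (Measure.euclideanHausdorffMeasure m : Measure V) (G '' (s ∩ t n)) := by
    intro n
    obtain ⟨y₀, hy₀, hAn⟩ := tA n
    have hAexp : ∀ v, ‖v‖ ≤ ‖A n v‖ := hAn ▸ hexp y₀ hy₀
    have hd : ∀ x ∈ s ∩ t n, ∀ y ∈ s ∩ t n, ‖G x - G y - A n (x - y)‖ ≤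
        (1 - (K : ℝ)⁻¹) * ‖x - y‖ := fun x hx y hy => by
      rw [← hδ]; exact tapp n x hx y hy
    have e1 := euclideanHausdorffMeasure_image_le_of_dist_le (f := G) (g := A n)
      (A := s ∩ t n) (K := K) m (fun x hx y hy => by
        rw [dist_eq_norm, dist_eq_norm, ← (A n).map_sub]
        exact (norm_le_of_norm_sub_le hK.le hAexp (hd x hx y hy)).1)
    have e2 := euclideanHausdorffMeasure_image_le_of_dist_le (f := A n) (g := G)
      (A := s ∩ t n) (K := K) m (fun x hx y hy => by
        rw [dist_eq_norm, dist_eq_norm, ← (A n).map_sub]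
        exact (norm_le_of_norm_sub_le hK.le hAexp (hd x hx y hy)).2)
    have e3 := LinearMap.euclideanHausdorffMeasure_image_eq_normDet_mul_volume
      (A n : U →ₗ[ℝ] V) (s ∩ t n)
    have e3' : (Measure.euclideanHausdorffMeasure m : Measure V) (A n '' (s ∩ t n)) =
      ENNReal.ofReal (A n).normDet * volume (s ∩ t n) := e3
    have hclose : ∀ y ∈ s ∩ t n, ∀ v, ‖G' y v‖ ≤ K * ‖A n v‖ ∧ ‖A n v‖ ≤ K * ‖G' y v‖ := by
      intro y hy v
      refine norm_le_of_norm_sub_le hK.le hAexp ?_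
      rw [← sub_apply]
      refine (ContinuousLinearMap.le_opNorm _ _).trans ?_
      gcongr
      rw [hAn]
      exact hosc y hy.1 y₀ hy₀
    have hJ1 : ∀ y ∈ s ∩ t n, ENNReal.ofReal (G' y).normDet ≤
        (K : ℝ≥0∞) ^ m * ENNReal.ofReal (A n).normDet := fun y hy =>
      normDet_le_of_norm_le fun v => (hclose y hy v).1
    have hJ2 : ∀ y ∈ s ∩ t n, ENNReal.ofReal (A n).normDet ≤
        (K : ℝ≥0∞) ^ m * ENNReal.ofReal (G' y).normDet := fun y hy =>
      normDet_le_of_norm_le fun v => (hclose y hy v).2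
    have hKm : (K : ℝ≥0∞) ^ m ≠ ⊤ := by simp
    constructor
    · refine e1.trans ?_
      rw [e3', two_mul, pow_add, mul_assoc]
      refine mul_le_mul_right ?_ _
      rw [← lintegral_const_mul' _ _ hKm, ← setLIntegral_const]
      exact setLIntegral_mono' (hsm n) hJ2
    · calc ∫⁻ y in s ∩ t n, ENNReal.ofReal (G' y).normDet
          ≤ ∫⁻ y in s ∩ t n, (K : ℝ≥0∞) ^ m * ENNReal.ofReal (A n).normDet :=
            setLIntegral_mono' (hsm n) hJ1
        _ = (K : ℝ≥0∞) ^ m * (ENNReal.ofReal (A n).normDet * volume (s ∩ t n)) := by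
            rw [setLIntegral_const, mul_assoc]
        _ ≤ _ := by
            rw [← e3', two_mul, pow_add, mul_assoc]
            gcongr
  have hsumI : ∫⁻ y in s, ENNReal.ofReal (G' y).normDet =
      ∑' n, ∫⁻ y in s ∩ t n, ENNReal.ofReal (G' y).normDet := by
    conv_lhs => rw [hsU]
    exact lintegral_iUnion hsm hdisj _
  have hsumM : (Measure.euclideanHausdorffMeasure m : Measure V) (G '' s) =
      ∑' n, (Measure.euclideanHausdorffMeasure m : Measure V) (G '' (s ∩ t n)) := by
    conv_lhs => rw [hsU, Set.image_iUnion]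
    refine measure_iUnion (fun i j hij => ?_) (fun n => ?_)
    · exact (hdisj hij).image hinj Set.inter_subset_left Set.inter_subset_left
    · exact (hsm n).image_of_continuousOn_injOn (hcont.mono Set.inter_subset_left)
        (hinj.mono Set.inter_subset_left)
  rw [hsumI, hsumM, ← ENNReal.tsum_mul_left, ← ENNReal.tsum_mul_left]
  exact ⟨ENNReal.tsum_le_tsum fun n => (hpiece n).1, ENNReal.tsum_le_tsum fun n => (hpiece n).2⟩

/-- **Area formula** for an injective differentiable map whose derivatives do not decrease norms. -/
theorem euclideanHausdorffMeasure_image_eq_lintegral_normDet {G : U → V} {G' : U → U →L[ℝ] V}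
    {s : Set U} (hs : MeasurableSet s) (hG : ∀ y ∈ s, HasFDerivAt G (G' y) y)
    (hinj : Set.InjOn G s) (hexp : ∀ y ∈ s, ∀ v, ‖v‖ ≤ ‖G' y v‖) (hmeas : Measurable G') :
    (Measure.euclideanHausdorffMeasure (finrank ℝ U) : Measure V) (G '' s) =
      ∫⁻ y in s, ENNReal.ofReal (G' y).normDet := by
  set m := finrank ℝ U
  have hcont : ContinuousOn G s := fun y hy => (hG y hy).continuousAt.continuousWithinAt
  have key : ∀ K : ℝ≥0, 1 < K →
      (Measure.euclideanHausdorffMeasure m : Measure V) (G '' s) ≤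
        (K : ℝ≥0∞) ^ (2 * m) * ∫⁻ y in s, ENNReal.ofReal (G' y).normDet ∧
      ∫⁻ y in s, ENNReal.ofReal (G' y).normDet ≤ (K : ℝ≥0∞) ^ (2 * m) *
        (Measure.euclideanHausdorffMeasure m : Measure V) (G '' s) := by
    intro K hK
    have hK0 : (1 : ℝ) < K := by exact_mod_cast hK
    have hKi : (K : ℝ)⁻¹ < 1 := inv_lt_one_of_one_lt₀ hK0
    -- The derivative is only measurable, so the domain is cut along the values of G': balls around
    -- a countable dense set of linear maps give pieces of small oscillation.
    let B : ℕ → U →L[ℝ] V := TopologicalSpace.denseSeq _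
    let c : ℕ → Set U := fun j => G' ⁻¹' Metric.ball (B j) ((1 - (K : ℝ)⁻¹) / 2)
    have hcm : ∀ j, MeasurableSet (c j) := fun j => hmeas Metric.isOpen_ball.measurableSet
    have hcov : ⋃ j, c j = Set.univ := by
      refine Set.eq_univ_of_forall fun y => ?_
      obtain ⟨j, hj⟩ := (TopologicalSpace.denseRange_denseSeq (U →L[ℝ] V)).exists_dist_lt (G' y)
        (show 0 < (1 - (K : ℝ)⁻¹) / 2 by linarith)
      exact Set.mem_iUnion.2 ⟨j, hj⟩
    let t := disjointed c
    have tmeas : ∀ j, MeasurableSet (t j) := MeasurableSet.disjointed hcm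
    have tsub : ∀ j, t j ⊆ c j := disjointed_subset c
    have hsm : ∀ n, MeasurableSet (s ∩ t n) := fun n => hs.inter (tmeas n)
    have hsU : s = ⋃ n, s ∩ t n := by
      rw [← Set.inter_iUnion, iUnion_disjointed, hcov, Set.inter_univ]
    have hdisj : Pairwise (Function.onFun Disjoint fun n => s ∩ t n) := fun i j hij =>
      (disjoint_disjointed c hij).mono Set.inter_subset_right Set.inter_subset_right
    have hpiece := fun n => measure_image_comparison_of_small_oscillation (hsm n)
      (fun y hy => hG y hy.1) (hinj.mono Set.inter_subset_left) (fun y hy => hexp y hy.1) hK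
      (fun y hy y' hy' => by
        have h1 : dist (G' y) (B n) < _ := tsub n hy.2
        have h2 : dist (G' y') (B n) < _ := tsub n hy'.2
        rw [← dist_eq_norm]
        linarith [dist_triangle_right (G' y) (G' y') (B n)])
    have hsumI : ∫⁻ y in s, ENNReal.ofReal (G' y).normDet =
        ∑' n, ∫⁻ y in s ∩ t n, ENNReal.ofReal (G' y).normDet := by
      conv_lhs => rw [hsU]
      exact lintegral_iUnion hsm hdisj _
    have hsumM : (Measure.euclideanHausdorffMeasure m : Measure V) (G '' s) =
        ∑' n, (Measure.euclideanHausdorffMeasure m : Measure V) (G '' (s ∩ t n)) := by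
      conv_lhs => rw [hsU, Set.image_iUnion]
      refine measure_iUnion (fun i j hij => ?_) (fun n => ?_)
      · exact (hdisj hij).image hinj Set.inter_subset_left Set.inter_subset_left
      · exact (hsm n).image_of_continuousOn_injOn (hcont.mono Set.inter_subset_left)
          (hinj.mono Set.inter_subset_left)
    rw [hsumI, hsumM, ← ENNReal.tsum_mul_left, ← ENNReal.tsum_mul_left]
    exact ⟨ENNReal.tsum_le_tsum fun n => (hpiece n).1, ENNReal.tsum_le_tsum fun n => (hpiece n).2⟩
  -- The distortion factor tends to 1 as K decreases to 1, which closes both inequalities.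
  have hlim : ∀ a : ℝ≥0∞, Tendsto (fun K : ℝ≥0 => (K : ℝ≥0∞) ^ (2 * m) * a) (𝓝[>] 1) (𝓝 a) := by
    intro a
    have h1 : Tendsto (fun K : ℝ≥0 => (K : ℝ≥0∞) ^ (2 * m)) (𝓝[>] 1) (𝓝 1) := by
      have : Continuous fun K : ℝ≥0 => (K : ℝ≥0∞) ^ (2 * m) :=
        (ENNReal.continuous_pow _).comp ENNReal.continuous_coe
      simpa using (this.tendsto 1).mono_left nhdsWithin_le_nhds
    simpa using ENNReal.Tendsto.mul_const h1 (Or.inl one_ne_zero)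
  have hne : (𝓝[>] (1 : ℝ≥0)).NeBot := inferInstance
  refine le_antisymm (ge_of_tendsto (hlim _) ?_) (ge_of_tendsto (hlim _) ?_)
  · filter_upwards [self_mem_nhdsWithin] with K hK using (key K hK).1
  · filter_upwards [self_mem_nhdsWithin] with K hK using (key K hK).2

end AreaFormula

/-! ### Lipschitz graphs over a hyperplane -/

section Graph

variable {E : Type*} [NormedAddCommGroup E] [InnerProductSpace ℝ E] [FiniteDimensional ℝ E]
  [MeasurableSpace E] [BorelSpace E]

/-- The hyperplane orthogonal to `e`. -/
abbrev hyperplane (e : E) : Submodule ℝ E := (ℝ ∙ e)ᗮ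

/-- The orthogonal projection onto the hyperplane orthogonal to the unit vector `e`. -/
def toHyperplane (e : E) : E →L[ℝ] hyperplane e := (hyperplane e).orthogonalProjectionOnto

/-- The parametrization of the graph of `γ` over the hyperplane orthogonal to `e`. -/
def graphMap (e : E) (γ : E → ℝ) (y : hyperplane e) : E := (y : E) + γ y • e

/-- The linear map with graph `ℓ` over the hyperplane orthogonal to `e`. -/
def graphDeriv (e : E) (ℓ : hyperplane e →L[ℝ] ℝ) : hyperplane e →L[ℝ] E :=
  (hyperplane e).subtypeL + ℓ.smulRight e

/-- The derivative of `γ` along the hyperplane orthogonal to `e`. -/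
def hyperplaneDeriv (e : E) (γ : E → ℝ) (y : hyperplane e) : hyperplane e →L[ℝ] ℝ :=
  fderiv ℝ (fun y : hyperplane e => γ y) y

variable {e : E} {γ : E → ℝ}

lemma inner_hyperplane (y : hyperplane e) : inner ℝ e (y : E) = 0 :=
  Submodule.mem_orthogonal_singleton_iff_inner_right.1 y.2

lemma coe_toHyperplane (he : ‖e‖ = 1) (x : E) :
    (toHyperplane e x : E) = x - inner ℝ e x • e := by
  have h := Submodule.starProjection_orthogonal_val (K := ℝ ∙ e) x
  rw [Submodule.starProjection_unit_singleton ℝ he] at h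
  exact h

lemma toHyperplane_add_smul (y : hyperplane e) (t : ℝ) :
    toHyperplane e ((y : E) + t • e) = y := by
  unfold toHyperplane
  rw [map_add, map_smul, Submodule.orthogonalProjectionOnto_orthogonalComplement_singleton_eq_zero]
  simp

lemma inner_add_smul (he : ‖e‖ = 1) (y : hyperplane e) (t : ℝ) :
    inner ℝ e ((y : E) + t • e) = t := by
  rw [inner_add_right, inner_hyperplane, inner_smul_right, real_inner_self_eq_norm_sq, he]
  simp

lemma norm_add_smul_sq (he : ‖e‖ = 1) (y : hyperplane e) (t : ℝ) :
    ‖(y : E) + t • e‖ ^ 2 = ‖y‖ ^ 2 + t ^ 2 := by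
  rw [norm_add_sq_real, inner_smul_right, real_inner_comm, inner_hyperplane, norm_smul, he]
  simp

lemma norm_le_norm_add_smul (he : ‖e‖ = 1) (y : hyperplane e) (t : ℝ) :
    ‖y‖ ≤ ‖(y : E) + t • e‖ := by
  refine le_of_sq_le_sq ?_ (norm_nonneg _)
  rw [norm_add_smul_sq he]
  nlinarith [sq_nonneg t]

lemma norm_le_norm_graphDeriv (he : ‖e‖ = 1) (ℓ : hyperplane e →L[ℝ] ℝ) (v : hyperplane e) :
    ‖v‖ ≤ ‖graphDeriv e ℓ v‖ :=
  norm_le_norm_add_smul he v (ℓ v)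

lemma graphMap_injective : Function.Injective (graphMap e γ) := by
  intro y z h
  have := congrArg (toHyperplane e) h
  simpa only [graphMap, toHyperplane_add_smul] using this

lemma finrank_hyperplane (he : ‖e‖ = 1) : finrank ℝ (hyperplane e) = finrank ℝ E - 1 := by
  have h1 := (ℝ ∙ e).finrank_add_finrank_orthogonal
  have h2 : finrank ℝ (ℝ ∙ e) = 1 := finrank_span_singleton (by rintro rfl; simp at he)
  exact Nat.eq_sub_of_add_eq' (h2 ▸ h1)

/-- With a the Riesz vector of ℓ, the Gram operator is v ↦ v + ℓ(v) a, a transvection of determinant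
1 + ℓ(a) = 1 + ‖ℓ‖². -/
lemma normDet_graphDeriv (he : ‖e‖ = 1) (ℓ : hyperplane e →L[ℝ] ℝ) :
    (graphDeriv e ℓ).normDet = √(1 + ‖ℓ‖ ^ 2) := by
  set a := (InnerProductSpace.toDual ℝ (hyperplane e)).symm ℓ with ha
  have hinner : ∀ v, inner ℝ a v = ℓ v := fun v => by
    rw [ha, InnerProductSpace.toDual_symm_apply]
  have hna : ‖a‖ = ‖ℓ‖ := by rw [ha, LinearIsometryEquiv.norm_map]
  have hsq := (graphDeriv e ℓ).normDet_sq
  have hadj : ((graphDeriv e ℓ).adjoint ∘L graphDeriv e ℓ : hyperplane e →ₗ[ℝ] hyperplane e) =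
      LinearMap.transvection (ℓ : hyperplane e →ₗ[ℝ] ℝ) a := by
    ext1 v
    refine ext_inner_right ℝ fun w => ?_
    have : inner ℝ ((graphDeriv e ℓ).adjoint (graphDeriv e ℓ v)) w =
        inner ℝ (graphDeriv e ℓ v) (graphDeriv e ℓ w) :=
      ContinuousLinearMap.adjoint_inner_left _ _ _
    simp only [ContinuousLinearMap.coe_coe, ContinuousLinearMap.comp_apply]
    rw [this, LinearMap.transvection.apply]
    simp only [graphDeriv, add_apply, Submodule.subtypeL_apply,
      ContinuousLinearMap.smulRight_apply, inner_add_left, inner_add_right, inner_smul_left,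
      inner_smul_right, inner_hyperplane, real_inner_self_eq_norm_sq, he, hinner]
    rw [real_inner_comm e (v : E), inner_hyperplane]
    simp [mul_comm]
  have hdet : ((graphDeriv e ℓ).adjoint ∘L graphDeriv e ℓ).det = 1 + ‖ℓ‖ ^ 2 := by
    rw [ContinuousLinearMap.det, hadj, LinearMap.transvection.det]
    simp only [ContinuousLinearMap.coe_coe]
    rw [← hinner, real_inner_self_eq_norm_sq, hna]
  rw [hdet] at hsq
  have h0 := LinearMap.normDet_nonneg (graphDeriv e ℓ : hyperplane e →ₗ[ℝ] E)
  rw [← hsq]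
  simp only [RCLike.ofReal_real_eq_id, id]
  rw [Real.sqrt_sq h0]

lemma hasFDerivAt_graphMap {y : hyperplane e}
    (h : DifferentiableAt ℝ (fun y : hyperplane e => γ y) y) :
    HasFDerivAt (graphMap e γ) (graphDeriv e (hyperplaneDeriv e γ y)) y :=
  (hyperplane e).subtypeL.hasFDerivAt.add (h.hasFDerivAt.smul_const e)

variable {K : ℝ≥0}

lemma lipschitzWith_hyperplane (hγ : LipschitzWith K γ) :
    LipschitzWith K (fun y : hyperplane e => γ y) := by
  have h := hγ.comp (LipschitzWith.subtype_val (hyperplane e : Set E))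
  rw [mul_one] at h
  exact h

lemma lipschitzWith_graphMap (he : ‖e‖ = 1) (hγ : LipschitzWith K γ) :
    LipschitzWith (1 + K) (graphMap e γ) := by
  refine (LipschitzWith.subtype_val (hyperplane e : Set E)).add ?_
  refine LipschitzWith.of_dist_le_mul fun y z => ?_
  rw [dist_eq_norm, ← sub_smul, norm_smul, he, mul_one, ← dist_eq_norm]
  exact (lipschitzWith_hyperplane hγ).dist_le_mul y z

lemma measurable_hyperplaneDeriv : Measurable (hyperplaneDeriv e γ) := measurable_fderiv ℝ _

lemma norm_hyperplaneDeriv_le (hγ : LipschitzWith K γ) (y : hyperplane e) :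
    ‖hyperplaneDeriv e γ y‖ ≤ K :=
  norm_fderiv_le_of_lipschitz ℝ (lipschitzWith_hyperplane hγ)

/-- The area element of the graph of `γ`. -/
def areaElement (e : E) (γ : E → ℝ) (y : hyperplane e) : ℝ :=
  √(1 + ‖hyperplaneDeriv e γ y‖ ^ 2)

lemma measurable_areaElement : Measurable (areaElement e γ) := by
  have := (measurable_hyperplaneDeriv (e := e) (γ := γ)).norm
  unfold areaElement
  fun_prop

lemma one_le_areaElement (y : hyperplane e) : 1 ≤ areaElement e γ y := by
  unfold areaElement
  rw [Real.one_le_sqrt]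
  nlinarith [sq_nonneg ‖hyperplaneDeriv e γ y‖]

lemma euclideanHausdorffMeasure_graphMap_image (he : ‖e‖ = 1) (hγ : LipschitzWith K γ)
    {A : Set (hyperplane e)} (hA : MeasurableSet A) :
    (Measure.euclideanHausdorffMeasure (finrank ℝ E - 1) : Measure E) (graphMap e γ '' A) =
      ∫⁻ y in A, ENNReal.ofReal (areaElement e γ y) := by
  rw [← finrank_hyperplane he]
  set m := finrank ℝ (hyperplane e)
  -- The area formula applies on the differentiability set T. The rest is null by Rademacher's
  -- theorem, and the Lipschitz map `graphMap` sends null sets to null sets.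
  let T : Set (hyperplane e) := {y | DifferentiableAt ℝ (fun y : hyperplane e => γ y) y}
  have hTm : MeasurableSet T := measurableSet_of_differentiableAt ℝ _
  have hT : volume Tᶜ = 0 := (lipschitzWith_hyperplane hγ).ae_differentiableAt
  have h1 := euclideanHausdorffMeasure_image_eq_lintegral_normDet (G := graphMap e γ)
    (G' := fun y => graphDeriv e (hyperplaneDeriv e γ y)) (s := A ∩ T) (hA.inter hTm)
    (fun y hy => hasFDerivAt_graphMap hy.2) graphMap_injective.injOn
    (fun y _ => norm_le_norm_graphDeriv he _) (by
      have : Continuous fun ℓ : hyperplane e →L[ℝ] ℝ => graphDeriv e ℓ := by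
        unfold graphDeriv
        exact continuous_const.add
          (ContinuousLinearMap.smulRightL ℝ (hyperplane e) E |>.flip e).continuous
      exact this.measurable.comp measurable_hyperplaneDeriv)
  simp_rw [normDet_graphDeriv he] at h1
  have h2 : (Measure.euclideanHausdorffMeasure m : Measure E) (graphMap e γ '' (A ∩ Tᶜ)) = 0 := by
    have h3 := euclideanHausdorffMeasure_image_le_of_dist_le (f := graphMap e γ) (g := id)
      (A := A ∩ Tᶜ) (K := 1 + K) m
      (fun x _ y _ => (lipschitzWith_graphMap he hγ).dist_le_mul x y)
    rw [Set.image_id, InnerProductSpace.euclideanHausdorffMeasure_eq_volume,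
      measure_mono_null Set.inter_subset_right hT, mul_zero] at h3
    exact le_antisymm h3 zero_le
  have h4 : graphMap e γ '' A = graphMap e γ '' (A ∩ T) ∪ graphMap e γ '' (A ∩ Tᶜ) := by
    rw [← Set.image_union, Set.inter_union_compl]
  have h5 : (A ∩ T : Set (hyperplane e)) =ᵐ[volume] A := by
    have : T =ᵐ[volume] (Set.univ : Set (hyperplane e)) := ae_eq_univ.2 hT
    simpa using (ae_eq_refl A).inter this
  rw [h4, le_antisymm ((measure_union_le _ _).trans_eq (by rw [h2, add_zero]))
    (measure_mono Set.subset_union_left), h1, setLIntegral_congr h5]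
  rfl

/-- Surface measure on a Lipschitz graph, in graph coordinates. -/
lemma restrict_range_graphMap (he : ‖e‖ = 1) (hγ : LipschitzWith K γ) :
    (Measure.euclideanHausdorffMeasure (finrank ℝ E - 1) : Measure E).restrict
        (Set.range (graphMap e γ)) =
      (volume.withDensity fun y => ENNReal.ofReal (areaElement e γ y)).map (graphMap e γ) := by
  have hm := (lipschitzWith_graphMap he hγ).continuous.measurable
  ext B hB
  rw [Measure.map_apply hm hB, withDensity_apply _ (hm hB), Measure.restrict_apply hB,
    ← euclideanHausdorffMeasure_graphMap_image he hγ (hm hB), Set.image_preimage_eq_inter_range]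

end Graph

/-! ### Shear coordinates and the Gauss–Green formula below a graph -/

section Graph

variable {E : Type*} [NormedAddCommGroup E] [InnerProductSpace ℝ E] [FiniteDimensional ℝ E]
  [MeasurableSpace E] [BorelSpace E] {e : E} {γ : E → ℝ} {K : ℝ≥0}

lemma measurePreserving_hyperplane_prod (he : ‖e‖ = 1) :
    MeasurePreserving (fun p : hyperplane e × ℝ => (p.1 : E) + p.2 • e) := by
  have h1 := ((ℝ ∙ e).measurePreserving_measurableEquivProd (0 : E)).symm
  rw [InnerProductSpace.euclideanHausdorffMeasure_eq_volume] at h1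
  have h2 := (LinearIsometryEquiv.toSpanUnitSingleton (𝕜 := ℝ) e he).measurePreserving
  have h3 : MeasurePreserving (Prod.swap : hyperplane e × ℝ → ℝ × hyperplane e) :=
    Measure.measurePreserving_swap
  have h4 := (h1.comp (h2.prod (MeasurePreserving.id (volume : Measure (hyperplane e))))).comp h3
  convert! h4 using 1
  ext p
  simp [add_comm]

/-- The shear `(y, s) ↦ y + (γ y + s) e`. -/
def graphShear (e : E) (γ : E → ℝ) (p : hyperplane e × ℝ) : E := graphMap e γ p.1 + p.2 • e

lemma graphShear_eq (p : hyperplane e × ℝ) :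
    graphShear e γ p = (p.1 : E) + (γ p.1 + p.2) • e := by
  rw [graphShear, graphMap, add_smul, add_assoc]

lemma continuous_graphShear (he : ‖e‖ = 1) (hγ : LipschitzWith K γ) :
    Continuous (graphShear e γ) := by
  have := (lipschitzWith_graphMap he hγ).continuous
  unfold graphShear
  fun_prop

/-- On each vertical line the shear is a translation, so volume is preserved without any
differentiability of γ. -/
lemma measurePreserving_graphShear (he : ‖e‖ = 1) (hγ : LipschitzWith K γ) :
    MeasurePreserving (graphShear e γ) := by
  have hc := (lipschitzWith_hyperplane (e := e) hγ).continuous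
  have h1 : MeasurePreserving (fun p : hyperplane e × ℝ => (p.1, γ p.1 + p.2)) :=
    (MeasurePreserving.id (volume : Measure (hyperplane e))).skew_product
      (g := fun y s => γ y + s) (by
        have : Continuous fun p : hyperplane e × ℝ => γ p.1 + p.2 :=
          (hc.comp continuous_fst).add continuous_snd
        exact this.measurable)
      (Eventually.of_forall fun y => map_add_left_eq_self _ _)
  convert! (measurePreserving_hyperplane_prod he).comp h1 using 1
  ext p
  exact graphShear_eq p

lemma graphShear_injective (he : ‖e‖ = 1) : Function.Injective (graphShear e γ) := by
  intro p q h
  rw [graphShear_eq, graphShear_eq] at h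
  have h1 := congrArg (toHyperplane e) h
  have h2 := congrArg (inner ℝ e) h
  rw [toHyperplane_add_smul, toHyperplane_add_smul] at h1
  rw [inner_add_smul he, inner_add_smul he, h1] at h2
  exact Prod.ext h1 (by linarith)

lemma measurableEmbedding_graphShear (he : ‖e‖ = 1) (hγ : LipschitzWith K γ) :
    MeasurableEmbedding (graphShear e γ) :=
  (continuous_graphShear he hγ).measurableEmbedding (graphShear_injective he)

/-- The region below the graph of `γ`. -/
def subgraph (e : E) (γ : E → ℝ) : Set E := {x | inner ℝ e x < γ (x - inner ℝ e x • e)}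

lemma graphShear_mem_subgraph (he : ‖e‖ = 1) (p : hyperplane e × ℝ) :
    graphShear e γ p ∈ subgraph e γ ↔ p.2 < 0 := by
  rw [subgraph, Set.mem_ofPred_eq, ← coe_toHyperplane he, graphShear_eq, inner_add_smul he,
    toHyperplane_add_smul]
  constructor <;> intro h <;> linarith

lemma setIntegral_subgraph (he : ‖e‖ = 1) (hγ : LipschitzWith K γ) (f : E → ℝ) :
    ∫ x in subgraph e γ, f x =
      ∫ p in (Set.univ : Set (hyperplane e)) ×ˢ Set.Iic (0 : ℝ), f (graphShear e γ p) := by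
  rw [← (measurePreserving_graphShear he hγ).setIntegral_preimage_emb
    (measurableEmbedding_graphShear he hγ)]
  have : graphShear e γ ⁻¹' subgraph e γ = Set.univ ×ˢ Set.Iio (0 : ℝ) := by
    ext p
    rw [Set.mem_preimage, graphShear_mem_subgraph he]
    simp
  rw [this]
  -- The slice s = 0 is null; the closed half-line is the form used later by the fundamental theorem
  -- of calculus in s.
  refine setIntegral_congr_set ?_
  rw [Measure.volume_eq_prod]
  exact Measure.set_prod_ae_eq (ae_eq_refl _) Iio_ae_eq_Iic

/-- The Lebesgue measure of a Lipschitz graph vanishes. -/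
lemma volume_range_graphMap (he : ‖e‖ = 1) (hγ : LipschitzWith K γ) :
    volume (Set.range (graphMap e γ)) = 0 := by
  have hcl : MeasurableSet (Set.range (graphMap e γ)) := by
    rw [← Set.image_univ]
    exact MeasurableSet.univ.image_of_continuousOn_injOn
      (lipschitzWith_graphMap he hγ).continuous.continuousOn graphMap_injective.injOn
  rw [← (measurePreserving_graphShear he hγ).measure_preimage hcl.nullMeasurableSet]
  have : graphShear e γ ⁻¹' Set.range (graphMap e γ) = Set.univ ×ˢ {(0 : ℝ)} := by
    ext p
    constructor
    · rintro ⟨y, hy⟩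
      have h1 : graphShear e γ (y, 0) = graphShear e γ p := by
        rw [← hy, graphShear]; simp
      rw [← graphShear_injective he h1]
      simp
    · rintro ⟨-, hp⟩
      exact ⟨p.1, by rw [graphShear, Set.mem_singleton_iff.1 hp]; simp⟩
  rw [this, Measure.volume_eq_prod, Measure.prod_prod]
  simp

lemma hasCompactSupport_comp_graphMap (he : ‖e‖ = 1) {φ : E → ℝ}
    (hφ : HasCompactSupport φ) (s : ℝ) :
    HasCompactSupport fun y => φ (graphMap e γ y + s • e) := by
  obtain ⟨R, hR⟩ := hφ.isCompact.isBounded.exists_norm_le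
  refine HasCompactSupport.of_support_subset_isCompact (isCompact_closedBall (0 : hyperplane e) R)
    fun y hy => ?_
  have h1 := hR _ (subset_tsupport φ hy)
  have h2 : graphMap e γ y + s • e = _ := graphShear_eq (y, s)
  rw [h2] at h1
  rw [mem_closedBall_zero_iff]
  exact (norm_le_norm_add_smul he _ _).trans h1

/-- Slicing in the horizontal direction: derivatives along the translated graph integrate to
zero. -/
lemma integral_fderiv_graphMap (he : ‖e‖ = 1) (hγ : LipschitzWith K γ) {φ : E → ℝ}
    (hφ : ContDiff ℝ 1 φ) (hc : HasCompactSupport φ) (s : ℝ) (v : hyperplane e) :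
    ∫ y, fderiv ℝ φ (graphMap e γ y + s • e) (graphDeriv e (hyperplaneDeriv e γ y) v) = 0 := by
  obtain ⟨C, hC⟩ := hφ.lipschitzWith_of_hasCompactSupport hc one_ne_zero
  have hL : LipschitzWith (C * (1 + K)) fun y : hyperplane e => φ (graphMap e γ y + s • e) := by
    refine hC.comp ?_
    simpa using (lipschitzWith_graphMap he hγ).add (LipschitzWith.const (s • e))
  -- Lipschitz integration by parts against the constant 1; the direction −v offsets the sign change
  -- in that formula.
  have h1 := LipschitzWith.integral_lineDeriv_mul_eq (μ := (volume : Measure (hyperplane e)))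
    (LipschitzWith.const (1 : ℝ)) hL (hasCompactSupport_comp_graphMap he hc s) (-v)
  have h2 : ∀ x : hyperplane e, lineDeriv ℝ (fun _ : hyperplane e => (1 : ℝ)) x (-v) = 0 :=
    fun x => by simp [lineDeriv]
  simp only [h2, neg_neg, zero_mul, integral_zero, mul_one] at h1
  rw [h1]
  refine integral_congr_ae ?_
  filter_upwards [(lipschitzWith_hyperplane (e := e) hγ).ae_differentiableAt (μ := volume)]
    with y hy
  have h3 : HasFDerivAt (fun y => φ (graphMap e γ y + s • e)) _ y :=
    HasFDerivAt.comp y (hφ.differentiable one_ne_zero _).hasFDerivAt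
      ((hasFDerivAt_graphMap hy).add_const (s • e))
  rw [(h3.hasLineDerivAt v).lineDeriv]
  rfl

/-- **Gauss–Green formula below a Lipschitz graph**, in graph coordinates. -/
theorem setIntegral_subgraph_fderiv (he : ‖e‖ = 1) (hγ : LipschitzWith K γ) {φ : E → ℝ}
    (hφ : ContDiff ℝ 1 φ) (hc : HasCompactSupport φ) (h : E) :
    ∫ x in subgraph e γ, fderiv ℝ φ x h =
      ∫ y, φ (graphMap e γ y) * (inner ℝ e h - hyperplaneDeriv e γ y (toHyperplane e h)) := by
  set c : hyperplane e → ℝ := fun y => inner ℝ e h - hyperplaneDeriv e γ y (toHyperplane e h)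
    with hcdef
  have hcm : Measurable c :=
    measurable_const.sub (measurable_hyperplaneDeriv.apply_continuousLinearMap _)
  have hcb : ∀ y, ‖c y‖ ≤ ‖inner ℝ e h‖ + K * ‖toHyperplane e h‖ := fun y =>
    (norm_sub_le _ _).trans (add_le_add le_rfl ((ContinuousLinearMap.le_opNorm _ _).trans
      (mul_le_mul_of_nonneg_right (norm_hyperplaneDeriv_le hγ y) (norm_nonneg _))))
  have hD : ∀ w : E, Integrable (fun p : hyperplane e × ℝ => fderiv ℝ φ (graphShear e γ p) w) := by
    intro w
    have h1 : Integrable fun x => fderiv ℝ φ x w :=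
      ((hφ.continuous_fderiv one_ne_zero).clm_apply continuous_const).integrable_of_hasCompactSupport
        (hc.fderiv_apply ℝ w)
    exact (measurePreserving_graphShear he hγ).integrable_comp_of_integrable h1
  have hcD : Integrable (fun p : hyperplane e × ℝ => c p.1 * fderiv ℝ φ (graphShear e γ p) e) := by
    refine (hD e).bdd_mul (c := ‖inner ℝ e h‖ + K * ‖toHyperplane e h‖)
      (hcm.comp measurable_fst).aestronglyMeasurable
      (Eventually.of_forall fun p => hcb p.1)
  -- The vector h is the tangent vector to the translated graph over `toHyperplane e h` plus c(y) e,
  -- and the tangential part integrates to zero by `integral_fderiv_graphMap`.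
  have hslice : ∀ s : ℝ, ∫ y, fderiv ℝ φ (graphShear e γ (y, s)) h =
      ∫ y, c y * fderiv ℝ φ (graphShear e γ (y, s)) e := by
    intro s
    have hi : ∀ w : E, Integrable fun y => fderiv ℝ φ (graphShear e γ (y, s)) w := by
      intro w
      refine Continuous.integrable_of_hasCompactSupport ?_
        (hasCompactSupport_comp_graphMap he (hc.fderiv_apply ℝ w) s)
      exact ((hφ.continuous_fderiv one_ne_zero).comp ((continuous_graphShear he hγ).comp
        (by fun_prop))).clm_apply continuous_const
    have hi2 : Integrable fun y => c y * fderiv ℝ φ (graphShear e γ (y, s)) e :=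
      (hi e).bdd_mul hcm.aestronglyMeasurable (Eventually.of_forall hcb)
    have h0 := integral_fderiv_graphMap he hγ hφ hc s (toHyperplane e h)
    rw [← sub_eq_zero, ← integral_sub (hi h) hi2, ← h0]
    refine integral_congr_ae (Eventually.of_forall fun y => ?_)
    have hh : h = (toHyperplane e h : E) + inner ℝ e h • e := by
      rw [coe_toHyperplane he]; abel
    have e1 : fderiv ℝ φ (graphShear e γ (y, s)) h =
        fderiv ℝ φ (graphShear e γ (y, s)) (toHyperplane e h : E) +
          inner ℝ e h * fderiv ℝ φ (graphShear e γ (y, s)) e := by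
      conv_lhs => rw [hh]
      rw [map_add, map_smul, smul_eq_mul]
    have e2 : graphDeriv e (hyperplaneDeriv e γ y) (toHyperplane e h) =
        (toHyperplane e h : E) + hyperplaneDeriv e γ y (toHyperplane e h) • e := rfl
    simp only [hcdef]
    rw [e1, e2, map_add, map_smul, smul_eq_mul]
    simp only [graphShear]
    ring
  have hres : (volume : Measure (hyperplane e × ℝ)).restrict (Set.univ ×ˢ Set.Iic (0 : ℝ)) =
      (volume : Measure (hyperplane e)).prod (volume.restrict (Set.Iic (0 : ℝ))) := by
    rw [Measure.volume_eq_prod, ← Measure.prod_restrict, Measure.restrict_univ]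
  have hD' := (hD h).integrableOn (s := (Set.univ : Set (hyperplane e)) ×ˢ Set.Iic (0 : ℝ))
  have hcD' := hcD.integrableOn (s := (Set.univ : Set (hyperplane e)) ×ˢ Set.Iic (0 : ℝ))
  rw [IntegrableOn, hres] at hD' hcD'
  rw [setIntegral_subgraph he hγ, hres, integral_prod_symm _ hD']
  simp_rw [hslice]
  -- Only ∂φ/∂e remains and c does not depend on s, so integrating in s first leaves the value of φ
  -- on the graph.
  rw [← integral_prod_symm _ hcD', integral_prod _ hcD']
  refine integral_congr_ae (Eventually.of_forall fun y => ?_)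
  simp only
  rw [integral_const_mul, mul_comm]
  congr 1
  have hl : ∀ s : ℝ, HasDerivAt (fun s : ℝ => φ (graphShear e γ (y, s)))
      (fderiv ℝ φ (graphShear e γ (y, s)) e) s := by
    intro s
    have h1 : HasDerivAt (fun s : ℝ => graphShear e γ (y, s)) e s := by
      simpa [graphShear] using ((hasDerivAt_id s).smul_const e).const_add (graphMap e γ y)
    exact (hφ.differentiable one_ne_zero _).hasFDerivAt.comp_hasDerivAt s h1
  have hsm : ContDiff ℝ 1 fun s : ℝ => φ (graphShear e γ (y, s)) := by
    have : ContDiff ℝ 1 fun s : ℝ => graphMap e γ y + s • e := by fun_prop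
    exact hφ.comp this
  have hcs : HasCompactSupport fun s : ℝ => φ (graphShear e γ (y, s)) := by
    obtain ⟨R, hR⟩ := hc.isCompact.isBounded.exists_norm_le
    refine HasCompactSupport.of_support_subset_isCompact
      (isCompact_closedBall (-γ y) R) fun s hs => ?_
    have h1 := hR _ (subset_tsupport φ hs)
    have h2 := abs_real_inner_le_norm e (graphShear e γ (y, s))
    rw [graphShear_eq, inner_add_smul he, he, one_mul, ← graphShear_eq (y, s)] at h2
    rw [mem_closedBall_iff_norm, Real.norm_eq_abs, sub_neg_eq_add, add_comm]
    exact h2.trans h1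
  have h3 := hcs.integral_Iic_deriv_eq hsm 0
  simp_rw [fun s => (hl s).deriv] at h3
  rw [h3, graphShear]
  simp

end Graph

/-! ### Surface measure and outward normal of a Lipschitz domain -/

section GraphNormal

variable {E : Type*} [NormedAddCommGroup E] [InnerProductSpace ℝ E] [FiniteDimensional ℝ E]
  [MeasurableSpace E] [BorelSpace E] {e : E} {γ : E → ℝ} {K : ℝ≥0}

/-- The gradient of `γ` along the hyperplane orthogonal to `e`. -/
def hyperplaneGradient (e : E) (γ : E → ℝ) (y : hyperplane e) : hyperplane e :=
  (InnerProductSpace.toDual ℝ (hyperplane e)).symm (hyperplaneDeriv e γ y)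

/-- The unit normal of the graph of `γ` pointing out of the subgraph. -/
def graphNormal (e : E) (γ : E → ℝ) (y : hyperplane e) : E :=
  (areaElement e γ y)⁻¹ • (e - (hyperplaneGradient e γ y : E))

lemma areaElement_pos (y : hyperplane e) : 0 < areaElement e γ y :=
  one_pos.trans_le (one_le_areaElement y)

/-- Identifies the coefficient in `setIntegral_subgraph_fderiv`: it is the normal component times
the area density, so the density is absorbed by the surface measure. -/
lemma inner_graphNormal (he : ‖e‖ = 1) (y : hyperplane e) (h : E) :
    areaElement e γ y * inner ℝ (graphNormal e γ y) h =
      inner ℝ e h - hyperplaneDeriv e γ y (toHyperplane e h) := by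
  rw [graphNormal, inner_smul_left, RCLike.conj_to_real, ← mul_assoc,
    mul_inv_cancel₀ (areaElement_pos y).ne', one_mul, inner_sub_left]
  congr 1
  have h1 : (h : E) = (toHyperplane e h : E) + inner ℝ e h • e := by
    rw [coe_toHyperplane he]; abel
  conv_lhs => rw [h1]
  rw [inner_add_right, inner_smul_right, real_inner_comm e (hyperplaneGradient e γ y : E),
    inner_hyperplane, mul_zero, add_zero, ← Submodule.coe_inner, hyperplaneGradient,
    InnerProductSpace.toDual_symm_apply]

lemma norm_graphNormal (he : ‖e‖ = 1) (y : hyperplane e) : ‖graphNormal e γ y‖ = 1 := by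
  rw [graphNormal, norm_smul, norm_inv, Real.norm_of_nonneg (areaElement_pos y).le]
  have h1 : ‖e - (hyperplaneGradient e γ y : E)‖ = areaElement e γ y := by
    have := norm_add_smul_sq he (-hyperplaneGradient e γ y) 1
    rw [one_smul, norm_neg, hyperplaneGradient, LinearIsometryEquiv.norm_map] at this
    rw [areaElement, eq_comm, Real.sqrt_eq_iff_eq_sq (by positivity) (norm_nonneg _)]
    rw [hyperplaneGradient, sub_eq_add_neg, add_comm e]
    push_cast at this
    rw [this]; ring
  rw [h1, inv_mul_cancel₀ (areaElement_pos y).ne']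

lemma measurable_graphNormal : Measurable (graphNormal e γ) := by
  have h1 : Measurable (hyperplaneGradient e γ) :=
    (InnerProductSpace.toDual ℝ (hyperplane e)).symm.continuous.measurable.comp
      measurable_hyperplaneDeriv
  exact measurable_areaElement.inv.smul (measurable_const.sub h1.subtype_val)

lemma isOpen_subgraph (hγ : Continuous γ) : IsOpen (subgraph e γ) := by
  unfold subgraph
  exact isOpen_lt (by fun_prop) (by fun_prop)

end GraphNormal

/-! ### Outward normal and surface measure of Ω in local graph coordinates -/

section Domain

variable {n : ℕ} {Ω : Set (EuclideanSpace ℝ (Fin n))}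

/-- Moving from x along ν' − ν goes strictly inward for ν and strictly outward for ν', so nearby
points would lie both in Ω and outside it. -/
lemma IsOutwardNormal.unique {x ν ν' : EuclideanSpace ℝ (Fin n)}
    (h : IsOutwardNormal Ω x ν) (h' : IsOutwardNormal Ω x ν') : ν = ν' := by
  by_contra hne
  set d := ν' - ν with hd
  have hd0 : 0 < ‖d‖ := norm_pos_iff.2 (sub_ne_zero.2 (Ne.symm hne))
  have hsq : ‖d‖ ^ 2 = 2 - 2 * inner ℝ ν ν' := by
    rw [hd, norm_sub_sq_real, h.1, h'.1, real_inner_comm]; ring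
  have e1 : inner ℝ ν d = -(‖d‖ ^ 2 / 2) := by
    rw [hsq, hd, inner_sub_right, real_inner_self_eq_norm_sq, h.1]; ring
  have e2 : inner ℝ ν' d = ‖d‖ ^ 2 / 2 := by
    rw [hsq, hd, inner_sub_right, real_inner_self_eq_norm_sq, h'.1, real_inner_comm]; ring
  -- The inner products of d with ν and ν' are ∓‖d‖²/2, so the cones with ε = ‖d‖/4 contain d
  -- strictly.
  have hε : 0 < ‖d‖ / 4 := by positivity
  have hten : Tendsto (fun t : ℝ => x + t • d) (𝓝[>] 0) (𝓝 x) := by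
    have : Continuous fun t : ℝ => x + t • d := by fun_prop
    simpa using (this.tendsto 0).mono_left nhdsWithin_le_nhds
  obtain ⟨t, ht1, ht2, ht⟩ := ((hten.eventually (h.2 _ hε)).and
    ((hten.eventually (h'.2 _ hε)).and self_mem_nhdsWithin)).exists
  have ht : 0 < t := ht
  simp only [add_sub_cancel_left, inner_smul_right, norm_smul, Real.norm_of_nonneg ht.le, e1, e2]
    at ht1 ht2
  refine ht2.2 ?_ (ht1.1 ?_)
  · have : 0 < t * ‖d‖ ^ 2 := by positivity
    nlinarith
  · have : 0 < t * ‖d‖ ^ 2 := by positivity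
    nlinarith

lemma IsOutwardNormal.outwardNormal_eq {x ν : EuclideanSpace ℝ (Fin n)}
    (h : IsOutwardNormal Ω x ν) : outwardNormal Ω x = ν := by
  have hex : ∃ ν, IsOutwardNormal Ω x ν := ⟨ν, h⟩
  rw [outwardNormal, dif_pos hex]
  exact hex.choose_spec.unique h

lemma norm_outwardNormal_le (x : EuclideanSpace ℝ (Fin n)) : ‖outwardNormal Ω x‖ ≤ 1 := by
  unfold outwardNormal
  split_ifs with h
  · exact h.choose_spec.1.le
  · simp

variable {e p : EuclideanSpace ℝ (Fin n)} {γ : EuclideanSpace ℝ (Fin n) → ℝ} {K : ℝ≥0} {r : ℝ}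

/-- By differentiability of γ, the height of x above the graph is `areaElement` times the normal
component of x − x₀, up to an error (ε/2)‖x − x₀‖. As `areaElement` is at least 1, the cone
condition with ε beats this error and fixes the sign of the height. -/
lemma isOutwardNormal_graphNormal (he : ‖e‖ = 1) {y : hyperplane e}
    (hd : DifferentiableAt ℝ (fun y : hyperplane e => γ y) y)
    (hloc : ∀ᶠ x in 𝓝 (graphMap e γ y), x ∈ Ω ↔ x ∈ subgraph e γ) :
    IsOutwardNormal Ω (graphMap e γ y) (graphNormal e γ y) := by
  refine ⟨norm_graphNormal he y, fun ε hε => ?_⟩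
  set x₀ := graphMap e γ y with hx₀
  have hPx₀ : toHyperplane e x₀ = y := toHyperplane_add_smul y _
  have hcont : Tendsto (toHyperplane e) (𝓝 x₀) (𝓝 y) := by
    have := (toHyperplane e).continuous.tendsto x₀
    rwa [hPx₀] at this
  have hlittle := hcont.eventually (hd.hasFDerivAt.isLittleO.def (half_pos hε))
  filter_upwards [hloc, hlittle] with x hx hl
  have hnorm : ‖toHyperplane e x - y‖ ≤ ‖x - x₀‖ := by
    rw [← hPx₀, ← map_sub]
    exact Submodule.norm_orthogonalProjectionOnto_apply_le _ _
  have hl' : |γ (toHyperplane e x) - γ y - hyperplaneDeriv e γ y (toHyperplane e x - y)| ≤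
      ε / 2 * ‖x - x₀‖ := hl.trans (by gcongr)
  have hN := inner_graphNormal (γ := γ) he y (x - x₀)
  have hex₀ : inner ℝ e x₀ = γ y := inner_add_smul he y _
  rw [map_sub, hPx₀, inner_sub_right e, hex₀] at hN
  have hmem : x ∈ subgraph e γ ↔ inner ℝ e x < γ (toHyperplane e x) := by
    rw [coe_toHyperplane he]; rfl
  have hJ := one_le_areaElement (γ := γ) y
  have habs := abs_le.1 hl'
  have hnn := norm_nonneg (x - x₀)
  constructor
  · intro h
    rw [hx, hmem]
    have hpos : 0 < ‖x - x₀‖ := by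
      rcases hnn.eq_or_lt with h0 | h0
      · rw [norm_eq_zero.1 h0.symm] at h; simp at h
      · exact h0
    have h3 : areaElement e γ y * inner ℝ (graphNormal e γ y) (x - x₀) < -ε * ‖x - x₀‖ := by
      nlinarith [mul_pos hε hpos]
    nlinarith [mul_pos hε hpos]
  · intro h
    rw [hx, hmem, not_lt]
    have hpos : 0 ≤ ε * ‖x - x₀‖ := by positivity
    have h3 : ε * ‖x - x₀‖ ≤ areaElement e γ y * inner ℝ (graphNormal e γ y) (x - x₀) := by
      nlinarith
    nlinarith

lemma frontier_inter_ball (he : ‖e‖ = 1) (hγ : Continuous γ) (hΩ : IsOpen Ω)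
    (hloc : ∀ x ∈ Metric.ball p r, (x ∈ Ω ↔ x ∈ subgraph e γ)) :
    frontier Ω ∩ Metric.ball p r = Set.range (graphMap e γ) ∩ Metric.ball p r := by
  ext x
  refine and_congr_left fun hxb => ?_
  have hball := Metric.isOpen_ball.mem_nhds hxb
  rw [hΩ.frontier_eq]
  constructor
  · rintro ⟨hcl, hnot⟩
    rw [hloc x hxb] at hnot
    have h1 : γ (x - inner ℝ e x • e) ≤ inner ℝ e x := not_lt.1 hnot
    rcases h1.lt_or_eq with h1 | h1
    -- A point strictly above the graph has a whole neighbourhood above it, hence is not in the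
    -- closure.
    · exfalso
      have hopen : IsOpen {x | γ (x - inner ℝ e x • e) < inner ℝ e x} :=
        isOpen_lt (by fun_prop) (by fun_prop)
      obtain ⟨y, ⟨hy1, hy2⟩, hyΩ⟩ := mem_closure_iff_nhds.1 hcl _
        (inter_mem (hopen.mem_nhds h1) hball)
      have h3 : inner ℝ e y < γ (y - inner ℝ e y • e) := (hloc y hy2).1 hyΩ
      exact lt_asymm h3 hy1
    · refine ⟨toHyperplane e x, ?_⟩
      rw [graphMap, coe_toHyperplane he, h1]; abel
  · rintro ⟨y, rfl⟩
    have hS : ∀ s : ℝ, graphMap e γ y + s • e ∈ subgraph e γ ↔ s < 0 := fun s =>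
      graphShear_mem_subgraph he (y, s)
    refine ⟨?_, fun h => ?_⟩
    · have hten : Tendsto (fun s : ℝ => graphMap e γ y + s • e) (𝓝[<] 0) (𝓝 (graphMap e γ y)) := by
        have : Continuous fun s : ℝ => graphMap e γ y + s • e := by fun_prop
        simpa using (this.tendsto 0).mono_left nhdsWithin_le_nhds
      refine mem_closure_of_tendsto hten ?_
      filter_upwards [hten.eventually hball, self_mem_nhdsWithin] with s hs hs0
      rw [hloc _ hs, hS]
      exact hs0
    · rw [hloc _ hxb] at h
      have := hS 0
      simp at this
      exact this h

lemma surfaceMeasure_restrict_ball (he : ‖e‖ = 1) (hγ : LipschitzWith K γ) (hΩ : IsOpen Ω)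
    (hloc : ∀ x ∈ Metric.ball p r, (x ∈ Ω ↔ x ∈ subgraph e γ)) :
    (surfaceMeasure Ω).restrict (Metric.ball p r) =
      ((volume.withDensity fun y => ENNReal.ofReal (areaElement e γ y)).map
        (graphMap e γ)).restrict (Metric.ball p r) := by
  have h1 := restrict_range_graphMap he hγ
  rw [finrank_euclideanSpace_fin] at h1
  rw [← h1, surfaceMeasure, Measure.restrict_restrict Metric.isOpen_ball.measurableSet,
    Measure.restrict_restrict Metric.isOpen_ball.measurableSet, Set.inter_comm,
    frontier_inter_ball he hγ.continuous hΩ hloc, Set.inter_comm]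

lemma ae_outwardNormal_eq (he : ‖e‖ = 1) (hγ : LipschitzWith K γ) (hΩ : IsOpen Ω)
    (hloc : ∀ x ∈ Metric.ball p r, (x ∈ Ω ↔ x ∈ subgraph e γ)) :
    ∀ᵐ x ∂(surfaceMeasure Ω).restrict (Metric.ball p r),
      outwardNormal Ω x = graphNormal e γ (toHyperplane e x) := by
  rw [surfaceMeasure_restrict_ball he hγ hΩ hloc,
    ae_restrict_iff' Metric.isOpen_ball.measurableSet]
  have hgm := (lipschitzWith_graphMap he hγ).continuous.measurable
  have hemb : MeasurableEmbedding (graphMap e γ) :=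
    (lipschitzWith_graphMap he hγ).continuous.measurableEmbedding graphMap_injective
  rw [hemb.ae_map_iff]
  have hac : (volume.withDensity fun y => ENNReal.ofReal (areaElement e γ y)) ≪
      (volume : Measure (hyperplane e)) := withDensity_absolutelyContinuous _ _
  refine hac.ae_le ?_
  filter_upwards [(lipschitzWith_hyperplane (e := e) hγ).ae_differentiableAt (μ := volume)]
    with y hy hb
  have h1 := isOutwardNormal_graphNormal (Ω := Ω) he hy (by
    filter_upwards [Metric.isOpen_ball.mem_nhds hb] with x hx using hloc x hx)
  rw [h1.outwardNormal_eq, graphMap, toHyperplane_add_smul]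

lemma surfaceMeasure_ball_lt_top (he : ‖e‖ = 1) (hγ : LipschitzWith K γ) (hΩ : IsOpen Ω)
    (hloc : ∀ x ∈ Metric.ball p r, (x ∈ Ω ↔ x ∈ subgraph e γ)) :
    surfaceMeasure Ω (Metric.ball p r) < ⊤ := by
  have hgm := (lipschitzWith_graphMap he hγ).continuous.measurable
  have h1 := congrArg (fun μ => μ (Metric.ball p r)) (surfaceMeasure_restrict_ball he hγ hΩ hloc)
  simp only [Measure.restrict_apply_self] at h1
  rw [h1, Measure.map_apply hgm Metric.isOpen_ball.measurableSet,
    withDensity_apply _ (hgm Metric.isOpen_ball.measurableSet)]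
  have hsub : graphMap e γ ⁻¹' Metric.ball p r ⊆ Metric.closedBall 0 (‖p‖ + r) := by
    intro y hy
    rw [mem_closedBall_zero_iff]
    refine (norm_le_norm_add_smul he y (γ y)).trans ?_
    have h2 : ‖graphMap e γ y - p‖ < r := mem_ball_iff_norm.1 hy
    have h3 := norm_sub_norm_le (graphMap e γ y) p
    rw [graphMap] at h2 h3
    linarith
  calc ∫⁻ y in graphMap e γ ⁻¹' Metric.ball p r, ENNReal.ofReal (areaElement e γ y)
      ≤ ∫⁻ y in graphMap e γ ⁻¹' Metric.ball p r, ENNReal.ofReal √(1 + K ^ 2) := by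
        refine lintegral_mono fun y => ENNReal.ofReal_le_ofReal (Real.sqrt_le_sqrt ?_)
        gcongr
        exact norm_hyperplaneDeriv_le hγ y
    _ ≤ ENNReal.ofReal √(1 + K ^ 2) * volume (Metric.closedBall (0 : hyperplane e) (‖p‖ + r)) := by
        rw [setLIntegral_const]
        gcongr
    _ < ⊤ := ENNReal.mul_lt_top ENNReal.ofReal_lt_top measure_closedBall_lt_top

/-- Gauss–Green formula for functions supported in a ball in which the domain is a subgraph. -/
lemma setIntegral_fderiv_of_tsupport_subset_ball (he : ‖e‖ = 1) (hγ : LipschitzWith K γ)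
    (hΩ : IsOpen Ω) (hloc : ∀ x ∈ Metric.ball p r, (x ∈ Ω ↔ x ∈ subgraph e γ))
    {φ : EuclideanSpace ℝ (Fin n) → ℝ} (hφ : ContDiff ℝ 1 φ) (hc : HasCompactSupport φ)
    (hs : tsupport φ ⊆ Metric.ball p r) (h : EuclideanSpace ℝ (Fin n)) :
    ∫ x in Ω, fderiv ℝ φ x h = ∫ x, φ x * inner ℝ (outwardNormal Ω x) h ∂surfaceMeasure Ω := by
  have hgm := (lipschitzWith_graphMap he hγ).continuous.measurable
  have hlhs : ∫ x in Ω, fderiv ℝ φ x h = ∫ x in subgraph e γ, fderiv ℝ φ x h := by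
    rw [← integral_indicator hΩ.measurableSet,
      ← integral_indicator (isOpen_subgraph hγ.continuous).measurableSet]
    congr 1
    ext x
    by_cases hx : x ∈ Metric.ball p r
    · by_cases hxΩ : x ∈ Ω
      · rw [Set.indicator_of_mem hxΩ, Set.indicator_of_mem ((hloc x hx).1 hxΩ)]
      · rw [Set.indicator_of_notMem hxΩ, Set.indicator_of_notMem (mt (hloc x hx).2 hxΩ)]
    · have h0 : fderiv ℝ φ x = 0 := by
        by_contra h1
        exact hx (hs (support_fderiv_subset ℝ h1))
      simp [Set.indicator, h0]
  rw [hlhs, setIntegral_subgraph_fderiv he hγ hφ hc]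
  have hzero : ∀ x, x ∉ Metric.ball p r → φ x = 0 := fun x hx =>
    image_eq_zero_of_notMem_tsupport fun h1 => hx (hs h1)
  have hr1 : ∫ x, φ x * inner ℝ (outwardNormal Ω x) h ∂surfaceMeasure Ω =
      ∫ x in Metric.ball p r, φ x * inner ℝ (graphNormal e γ (toHyperplane e x)) h
        ∂surfaceMeasure Ω := by
    rw [← setIntegral_eq_integral_of_forall_compl_eq_zero (s := Metric.ball p r)
      (fun x hx => by rw [hzero x hx, zero_mul])]
    refine integral_congr_ae ?_
    filter_upwards [ae_outwardNormal_eq he hγ hΩ hloc] with x hx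
    rw [hx]
  have hm : Measurable fun x => φ x * inner ℝ (graphNormal e γ (toHyperplane e x)) h := by
    have h1 := (measurable_graphNormal (e := e) (γ := γ)).comp
      (toHyperplane e).continuous.measurable
    exact hφ.continuous.measurable.mul (h1.inner measurable_const)
  rw [hr1, surfaceMeasure_restrict_ball he hγ hΩ hloc,
    setIntegral_eq_integral_of_forall_compl_eq_zero (fun x hx => by rw [hzero x hx, zero_mul]),
    integral_map hgm.aemeasurable hm.aestronglyMeasurable,
    integral_withDensity_eq_integral_toReal_smul
      (measurable_areaElement.ennreal_ofReal) (Eventually.of_forall fun _ => ENNReal.ofReal_lt_top)]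
  refine integral_congr_ae (Eventually.of_forall fun y => ?_)
  simp only
  rw [← inner_graphNormal he, ENNReal.toReal_ofReal (areaElement_pos y).le, smul_eq_mul]
  have : toHyperplane e (graphMap e γ y) = y := toHyperplane_add_smul y _
  rw [this]
  ring

end Domain

/-! ### The Gauss–Green formula on bounded Lipschitz domains -/

section GaussGreen

variable {n : ℕ} {Ω : Set (EuclideanSpace ℝ (Fin n))}

lemma IsBoundedLipschitz.isCompact_frontier (hΩ : IsBoundedLipschitz Ω) :
    IsCompact (frontier Ω) :=
  hΩ.isBounded.isCompact_closure.of_isClosed_subset isClosed_frontier frontier_subset_closure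

/-- The frontier of a bounded Lipschitz domain is covered by finitely many balls in which the domain
is a Lipschitz subgraph. -/
lemma IsBoundedLipschitz.exists_finite_cover (hΩ : IsBoundedLipschitz Ω) :
    ∃ (t : Finset (EuclideanSpace ℝ (Fin n))) (r : EuclideanSpace ℝ (Fin n) → ℝ),
      frontier Ω ⊆ ⋃ p ∈ t, Metric.ball p (r p) ∧ ∀ p ∈ t,
        ∃ (e : EuclideanSpace ℝ (Fin n)) (K : ℝ≥0) (γ : EuclideanSpace ℝ (Fin n) → ℝ),
          ‖e‖ = 1 ∧ LipschitzWith K γ ∧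
            ∀ x ∈ Metric.ball p (r p), (x ∈ Ω ↔ x ∈ subgraph e γ) := by
  have h : ∀ p, ∃ r : ℝ, p ∈ frontier Ω → 0 < r ∧
      ∃ (e : EuclideanSpace ℝ (Fin n)) (K : ℝ≥0) (γ : EuclideanSpace ℝ (Fin n) → ℝ),
          ‖e‖ = 1 ∧ LipschitzWith K γ ∧ ∀ x ∈ Metric.ball p r, (x ∈ Ω ↔ x ∈ subgraph e γ) := by
    intro p
    by_cases hp : p ∈ frontier Ω
    · obtain ⟨e, r, K, γ, he, hr, hγ, hl⟩ := hΩ.graph p hp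
      exact ⟨r, fun _ => ⟨hr, e, K, γ, he, hγ, hl⟩⟩
    · exact ⟨1, fun h => absurd h hp⟩
  choose r hr using h
  obtain ⟨t, ht, hcov⟩ := hΩ.isCompact_frontier.elim_nhds_subcover
    (fun p => Metric.ball p (r p)) (fun p hp => Metric.ball_mem_nhds p (hr p hp).1)
  exact ⟨t, r, hcov, fun p hp => (hr p (ht p hp)).2⟩

lemma surfaceMeasure_restrict_of_frontier_subset (s : Set (EuclideanSpace ℝ (Fin n)))
    (hs : frontier Ω ⊆ s) : (surfaceMeasure Ω).restrict s = surfaceMeasure Ω := by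
  refine Measure.restrict_eq_self_of_ae_mem ?_
  exact (ae_restrict_mem isClosed_frontier.measurableSet).mono fun x hx => hs hx

lemma IsBoundedLipschitz.isFiniteMeasure (hΩ : IsBoundedLipschitz Ω) :
    IsFiniteMeasure (surfaceMeasure Ω) := by
  obtain ⟨t, r, hcov, ht⟩ := hΩ.exists_finite_cover
  refine ⟨?_⟩
  rw [← surfaceMeasure_restrict_of_frontier_subset _ hcov, Measure.restrict_apply_univ]
  refine (measure_biUnion_finset_le t _).trans_lt (ENNReal.sum_lt_top.2 fun p hp => ?_)
  obtain ⟨e, K, γ, he, hγ, hl⟩ := ht p hp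
  exact surfaceMeasure_ball_lt_top he hγ hΩ.isOpen hl

/-- `outwardNormal` is defined by choice, so its measurability is borrowed from `graphNormal`, with
which it agrees almost everywhere in each chart. -/
lemma IsBoundedLipschitz.aestronglyMeasurable_outwardNormal (hΩ : IsBoundedLipschitz Ω) :
    AEStronglyMeasurable (outwardNormal Ω) (surfaceMeasure Ω) := by
  obtain ⟨t, r, hcov, ht⟩ := hΩ.exists_finite_cover
  rw [← Set.iUnion_subtype (fun p => p ∈ t) fun p =>
    Metric.ball (p : EuclideanSpace ℝ (Fin n)) (r p)] at hcov
  rw [← surfaceMeasure_restrict_of_frontier_subset _ hcov, aestronglyMeasurable_iUnion_iff]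
  rintro ⟨p, hp⟩
  obtain ⟨e, K, γ, he, hγ, hl⟩ := ht p hp
  have hm : Measurable fun x => graphNormal e γ (toHyperplane e x) :=
    (measurable_graphNormal (e := e) (γ := γ)).comp (toHyperplane e).continuous.measurable
  exact hm.aestronglyMeasurable.congr ((ae_outwardNormal_eq he hγ hΩ.isOpen hl).mono fun x hx => hx.symm)

/-- Needed for D: it allows the support condition on closure D to be used for integrals over D. -/
lemma IsBoundedLipschitz.volume_frontier (hΩ : IsBoundedLipschitz Ω) :
    volume (frontier Ω) = 0 := by
  obtain ⟨t, r, hcov, ht⟩ := hΩ.exists_finite_cover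
  have h1 : frontier Ω ⊆ ⋃ p ∈ t, (frontier Ω ∩ Metric.ball p (r p)) := by
    rw [← Set.inter_iUnion₂]
    exact Set.subset_inter Set.Subset.rfl hcov
  refine measure_mono_null h1 ((measure_biUnion_null_iff t.countable_toSet).2 fun p hp => ?_)
  obtain ⟨e, K, γ, he, hγ, hl⟩ := ht p hp
  rw [frontier_inter_ball he hγ.continuous hΩ.isOpen hl]
  exact measure_mono_null Set.inter_subset_left (volume_range_graphMap he hγ)

/-- A function with bounded values is integrable against a component of the normal. -/
lemma IsBoundedLipschitz.integrable_mul_inner (hΩ : IsBoundedLipschitz Ω)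
    {f : EuclideanSpace ℝ (Fin n) → ℝ} (hf : Continuous f) (h : EuclideanSpace ℝ (Fin n)) :
    Integrable (fun x => f x * inner ℝ (outwardNormal Ω x) h) (surfaceMeasure Ω) := by
  have := hΩ.isFiniteMeasure
  obtain ⟨C, hC⟩ := hΩ.isCompact_frontier.exists_bound_of_continuousOn hf.continuousOn
  refine Integrable.of_bound (hf.aestronglyMeasurable.mul
    (hΩ.aestronglyMeasurable_outwardNormal.inner aestronglyMeasurable_const)) (C * ‖h‖) ?_
  refine (ae_restrict_mem isClosed_frontier.measurableSet).mono fun x hx => ?_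
  rw [norm_mul]
  refine mul_le_mul (hC x hx) ?_ (norm_nonneg _) ((norm_nonneg _).trans (hC x hx))
  refine (norm_inner_le_norm _ _).trans ?_
  exact mul_le_of_le_one_left (norm_nonneg _) (norm_outwardNormal_le x)

/-- The local statement to be glued. Graph coordinates matter only at boundary points; in the
interior and in the exterior both sides vanish. -/
lemma exists_nhd_setIntegral_fderiv (hΩ : IsBoundedLipschitz Ω) (x : EuclideanSpace ℝ (Fin n)) :
    ∃ U, IsOpen U ∧ x ∈ U ∧ ∀ φ : EuclideanSpace ℝ (Fin n) → ℝ, ContDiff ℝ 1 φ →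
      HasCompactSupport φ → tsupport φ ⊆ U → ∀ h, ∫ x in Ω, fderiv ℝ φ x h =
        ∫ x, φ x * inner ℝ (outwardNormal Ω x) h ∂surfaceMeasure Ω := by
  have hbdry : ∀ φ : EuclideanSpace ℝ (Fin n) → ℝ, (∀ x ∈ frontier Ω, φ x = 0) → ∀ h,
      ∫ x, φ x * inner ℝ (outwardNormal Ω x) h ∂surfaceMeasure Ω = 0 := by
    intro φ hφ h
    refine integral_eq_zero_of_ae ?_
    refine (ae_restrict_mem isClosed_frontier.measurableSet).mono fun x hx => ?_
    simp [hφ x hx]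
  by_cases hx : x ∈ frontier Ω
  · obtain ⟨e, r, K, γ, he, hr, hγ, hl⟩ := hΩ.graph x hx
    exact ⟨Metric.ball x r, Metric.isOpen_ball, Metric.mem_ball_self hr, fun φ h1 h2 h3 h =>
      setIntegral_fderiv_of_tsupport_subset_ball he hγ hΩ.isOpen hl h1 h2 h3 h⟩
  by_cases hxΩ : x ∈ Ω
  · refine ⟨Ω, hΩ.isOpen, hxΩ, fun φ h1 h2 h3 h => ?_⟩
    rw [hbdry φ fun x hx => image_eq_zero_of_notMem_tsupport fun hx' => ?_]
    · rw [setIntegral_eq_integral_of_forall_compl_eq_zero]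
      · have hi : Integrable fun x => fderiv ℝ φ x h :=
          ((h1.continuous_fderiv one_ne_zero).clm_apply
            continuous_const).integrable_of_hasCompactSupport (h2.fderiv_apply ℝ h)
        -- Integration by parts against the constant 1: a derivative of a compactly supported
        -- function has integral zero.
        have := integral_mul_fderiv_eq_neg_fderiv_mul_of_integrable (μ := volume)
          (f := fun _ : EuclideanSpace ℝ (Fin n) => (1 : ℝ)) (g := φ) (v := h) (by simp)
          (by simpa using hi) (by simpa using h1.continuous.integrable_of_hasCompactSupport h2)
          (fun x _ => differentiableAt_const _)
          (fun x _ => h1.differentiable one_ne_zero x)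
        simpa using this
      · intro x hx
        by_contra h0
        exact hx (h3 (support_fderiv_subset ℝ fun h4 => h0 (by rw [h4]; rfl)))
    · rw [hΩ.isOpen.frontier_eq] at hx
      exact hx.2 (h3 hx')
  · have hxc : x ∉ closure Ω := fun h => hx (by rw [hΩ.isOpen.frontier_eq]; exact ⟨h, hxΩ⟩)
    refine ⟨(closure Ω)ᶜ, isClosed_closure.isOpen_compl, hxc, fun φ h1 h2 h3 h => ?_⟩
    rw [hbdry φ fun x hx => image_eq_zero_of_notMem_tsupport fun hx' =>
      h3 hx' (frontier_subset_closure hx)]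
    refine setIntegral_eq_zero_of_forall_eq_zero fun x hx => ?_
    by_contra h0
    exact h3 (support_fderiv_subset ℝ fun h4 => h0 (by rw [h4]; rfl)) (subset_closure hx)

open scoped Manifold in
/-- **Gauss–Green formula** on a bounded Lipschitz domain, for compactly supported functions. -/
theorem setIntegral_fderiv_of_hasCompactSupport (hΩ : IsBoundedLipschitz Ω)
    {φ : EuclideanSpace ℝ (Fin n) → ℝ} (hφ : ContDiff ℝ 1 φ) (hc : HasCompactSupport φ)
    (h : EuclideanSpace ℝ (Fin n)) :
    ∫ x in Ω, fderiv ℝ φ x h =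
      ∫ x, φ x * inner ℝ (outwardNormal Ω x) h ∂surfaceMeasure Ω := by
  choose U hUo hxU hU using exists_nhd_setIntegral_fderiv hΩ
  obtain ⟨t, -, hcov⟩ := hc.isCompact.elim_nhds_subcover U
    (fun x _ => (hUo x).mem_nhds (hxU x))
  rw [← Set.iUnion_subtype (fun x => x ∈ t) fun x => U x] at hcov
  obtain ⟨f, hf⟩ := SmoothPartitionOfUnity.exists_isSubordinate
    𝓘(ℝ, EuclideanSpace ℝ (Fin n)) (isClosed_tsupport φ) (fun i : t => U i)
    (fun i => hUo i) hcov
  have hsum : ∀ x, φ x = ∑ i : t, f i x * φ x := by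
    intro x
    by_cases hx : x ∈ tsupport φ
    · have h1 := f.sum_eq_one hx
      rw [finsum_eq_sum_of_fintype] at h1
      rw [← Finset.sum_mul, h1, one_mul]
    · simp [image_eq_zero_of_notMem_tsupport hx]
  have hfs : ∀ i : t, ContDiff ℝ 1 fun x => f i x * φ x := fun i =>
    ((f i).contMDiff.contDiff.of_le (by exact_mod_cast le_top)).mul hφ
  have hfc : ∀ i : t, HasCompactSupport fun x => f i x * φ x := fun i => hc.mul_left
  have hfd : ∀ i : t, Integrable fun x => fderiv ℝ (fun x => f i x * φ x) x h := fun i =>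
    (((hfs i).continuous_fderiv one_ne_zero).clm_apply
      continuous_const).integrable_of_hasCompactSupport ((hfc i).fderiv_apply ℝ h)
  have hder : ∀ x, fderiv ℝ φ x h = ∑ i : t, fderiv ℝ (fun x => f i x * φ x) x h := by
    intro x
    have : φ = fun x => ∑ i : t, f i x * φ x := funext hsum
    conv_lhs => rw [this]
    rw [fderiv_fun_sum fun i _ => (hfs i).differentiable one_ne_zero x]
    simp
  simp_rw [hder]
  rw [integral_finsetSum _ fun i _ => (hfd i).integrableOn]
  have hR : ∀ x, φ x * inner ℝ (outwardNormal Ω x) h =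
      ∑ i : t, f i x * φ x * inner ℝ (outwardNormal Ω x) h := fun x => by
    rw [← Finset.sum_mul, ← hsum]
  simp_rw [hR]
  rw [integral_finsetSum _ fun i _ => hΩ.integrable_mul_inner (hfs i).continuous h]
  refine Finset.sum_congr rfl fun i _ => hU i _ (hfs i) (hfc i) ?_ h
  exact (tsupport_mul_subset_left).trans (hf i)

/-- **Gauss–Green formula** on a bounded Lipschitz domain. -/
theorem setIntegral_fderiv_real (hΩ : IsBoundedLipschitz Ω)
    {φ : EuclideanSpace ℝ (Fin n) → ℝ} (hφ : ContDiff ℝ 1 φ) (h : EuclideanSpace ℝ (Fin n)) :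
    ∫ x in Ω, fderiv ℝ φ x h =
      ∫ x, φ x * inner ℝ (outwardNormal Ω x) h ∂surfaceMeasure Ω := by
  obtain ⟨R, hR⟩ := hΩ.isBounded.closure.exists_norm_le
  have hR0 : 0 < |R| + 1 := by positivity
  -- A cutoff equal to 1 near closure Ω makes the support compact and alters neither side.
  let χ : ContDiffBump (0 : EuclideanSpace ℝ (Fin n)) := ⟨|R| + 1, |R| + 2, hR0, by linarith⟩
  have hχ : ∀ x ∈ closure Ω, (fun x => χ x * φ x) =ᶠ[𝓝 x] φ := by
    intro x hx
    have h1 : Metric.ball (0 : EuclideanSpace ℝ (Fin n)) (|R| + 1) ∈ 𝓝 x :=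
      Metric.isOpen_ball.mem_nhds (by
        rw [mem_ball_zero_iff]
        linarith [hR x hx, le_abs_self R])
    filter_upwards [h1] with y hy
    rw [χ.one_of_mem_closedBall (Metric.ball_subset_closedBall hy), one_mul]
  have h1 := setIntegral_fderiv_of_hasCompactSupport hΩ (φ := fun x => χ x * φ x)
    (χ.contDiff.mul hφ) χ.hasCompactSupport.mul_right h
  rw [setIntegral_congr_fun hΩ.isOpen.measurableSet (fun x hx => by
    rw [(hχ x (subset_closure hx)).fderiv_eq])] at h1
  rw [h1]
  refine integral_congr_ae ?_
  refine (ae_restrict_mem isClosed_frontier.measurableSet).mono fun x hx => ?_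
  exact congrArg (· * _) (hχ x (frontier_subset_closure hx)).eq_of_nhds

lemma IsBoundedLipschitz.integrable_mul_inner_complex (hΩ : IsBoundedLipschitz Ω)
    {f : EuclideanSpace ℝ (Fin n) → ℂ} (hf : Continuous f) (h : EuclideanSpace ℝ (Fin n)) :
    Integrable (fun x => f x * (inner ℝ (outwardNormal Ω x) h : ℝ)) (surfaceMeasure Ω) := by
  have h1 := hΩ.integrable_mul_inner (Complex.continuous_re.comp hf) h
  have h2 := hΩ.integrable_mul_inner (Complex.continuous_im.comp hf) h
  refine ((h1.ofReal (𝕜 := ℂ)).add ((h2.ofReal (𝕜 := ℂ)).mul_const Complex.I)).congr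
    (Eventually.of_forall fun x => ?_)
  apply Complex.ext <;> simp

/-- **Gauss–Green formula** on a bounded Lipschitz domain, for complex-valued functions. -/
theorem setIntegral_fderiv_complex (hΩ : IsBoundedLipschitz Ω)
    {φ : EuclideanSpace ℝ (Fin n) → ℂ} (hφ : ContDiff ℝ 1 φ) (h : EuclideanSpace ℝ (Fin n)) :
    ∫ x in Ω, fderiv ℝ φ x h =
      ∫ x, φ x * (inner ℝ (outwardNormal Ω x) h : ℝ) ∂surfaceMeasure Ω := by
  have hi1 : IntegrableOn (fun x => fderiv ℝ φ x h) Ω :=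
    (((hφ.continuous_fderiv one_ne_zero).clm_apply
      continuous_const).continuousOn.integrableOn_compact
        hΩ.isBounded.isCompact_closure).mono_set subset_closure
  have hi2 := hΩ.integrable_mul_inner_complex hφ.continuous h
  have hre := setIntegral_fderiv_real hΩ (Complex.reCLM.contDiff.comp hφ) h
  have him := setIntegral_fderiv_real hΩ (Complex.imCLM.contDiff.comp hφ) h
  have hd : ∀ (L : ℂ →L[ℝ] ℝ) x, fderiv ℝ (L ∘ φ) x h = L (fderiv ℝ φ x h) := fun L x => by
    rw [fderiv_comp x L.differentiableAt (hφ.differentiable one_ne_zero x), L.fderiv]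
    rfl
  simp_rw [hd] at hre him
  rw [ContinuousLinearMap.integral_comp_comm _ hi1] at hre him
  apply Complex.ext
  · refine hre.trans ?_
    rw [← Complex.reCLM_apply, ← Complex.reCLM.integral_comp_comm hi2]
    simp
  · refine him.trans ?_
    rw [← Complex.imCLM_apply, ← Complex.imCLM.integral_comp_comm hi2]
    simp

end GaussGreen

open scoped Convolution

/-! ### Gauss–Green formula for continuous fields with bounded weak divergence -/

section WeakDivergence

variable {n : ℕ} {Ω : Set (EuclideanSpace ℝ (Fin n))}

/-- Essential boundedness on bounded sets. -/
def LocallyEssBounded (g : EuclideanSpace ℝ (Fin n) → ℂ) : Prop :=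
  ∀ R : ℝ, ∃ C : ℝ, 0 ≤ C ∧ ∀ᵐ x, ‖x‖ ≤ R → ‖g x‖ ≤ C

lemma _root_.Continuous.locallyEssBounded {g : EuclideanSpace ℝ (Fin n) → ℂ} (hg : Continuous g) :
    LocallyEssBounded g := by
  intro R
  obtain ⟨C, hC⟩ := (isCompact_closedBall (0 : EuclideanSpace ℝ (Fin n))
    R).exists_bound_of_continuousOn hg.continuousOn
  refine ⟨|C|, abs_nonneg C, Eventually.of_forall fun x hx => (hC x ?_).trans (le_abs_self C)⟩
  rwa [mem_closedBall_zero_iff]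

lemma LocallyEssBounded.locallyIntegrable {g : EuclideanSpace ℝ (Fin n) → ℂ}
    (hg : LocallyEssBounded g) (hm : AEStronglyMeasurable g volume) : LocallyIntegrable g := by
  refine locallyIntegrable_iff.2 fun k hk => ?_
  obtain ⟨R, hR⟩ := hk.isBounded.exists_norm_le
  obtain ⟨C, -, hC⟩ := hg R
  refine IntegrableOn.of_bound hk.measure_lt_top hm.restrict C ?_
  rw [ae_restrict_iff' hk.measurableSet]
  exact hC.mono fun x hx hxk => hx (hR x hxk)

/-- Averaging against a probability density preserves bounds; a kernel of radius at most 1 looks no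
further than R + 1. -/
lemma norm_convolution_bump_le {g : EuclideanSpace ℝ (Fin n) → ℂ} {R C : ℝ}
    (hC : ∀ᵐ x, ‖x‖ ≤ R + 1 → ‖g x‖ ≤ C) (ρ : ContDiffBump (0 : EuclideanSpace ℝ (Fin n)))
    (hρ : ρ.rOut ≤ 1) {x : EuclideanSpace ℝ (Fin n)} (hx : ‖x‖ ≤ R) :
    ‖(ρ.normed volume ⋆[ContinuousLinearMap.lsmul ℝ ℝ, volume] g) x‖ ≤ C := by
  rw [convolution_eq_swap]
  have hint : Integrable fun y => ρ.normed volume (x - y) * C :=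
    (ρ.integrable_normed.comp_sub_left x).mul_const C
  refine (norm_integral_le_of_norm_le hint ?_).trans_eq ?_
  · filter_upwards [hC] with y hy
    rw [ContinuousLinearMap.lsmul_apply, norm_smul, Real.norm_of_nonneg (ρ.nonneg_normed _)]
    by_cases h0 : ρ.normed volume (x - y) = 0
    · rw [h0]; simp
    · gcongr
      · exact ρ.nonneg_normed _
      refine hy ?_
      have h1 : x - y ∈ Function.support (ρ.normed volume) := h0
      rw [ρ.support_normed_eq, mem_ball_zero_iff] at h1
      have h2 := norm_sub_norm_le y x
      rw [norm_sub_rev] at h2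
      linarith
  · rw [integral_mul_const, integral_sub_left_eq_self (fun y => ρ.normed volume y), ρ.integral_normed,
      one_mul]

/-- A bump function of radius `1 / (j + 1)`. -/
def shrinkingBump (n j : ℕ) : ContDiffBump (0 : EuclideanSpace ℝ (Fin n)) :=
  ⟨1 / (2 * ((j : ℝ) + 1)), 1 / ((j : ℝ) + 1), by positivity, by
    apply one_div_lt_one_div_of_lt <;> nlinarith [(Nat.cast_nonneg j : (0 : ℝ) ≤ j)]⟩

lemma shrinkingBump_rOut_le (n j : ℕ) : (shrinkingBump n j).rOut ≤ 1 := by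
  have : (0 : ℝ) ≤ j := Nat.cast_nonneg j
  exact div_le_one_of_le₀ (by linarith) (by linarith)

lemma tendsto_shrinkingBump_rOut (n : ℕ) :
    Tendsto (fun j => (shrinkingBump n j).rOut) atTop (𝓝 0) :=
  tendsto_one_div_add_atTop_nhds_zero_nat

/-- The mollification of a field with weak divergence `g` has divergence the mollification of
`g`. -/
lemma sum_fderiv_convolution_bump {F : Fin n → EuclideanSpace ℝ (Fin n) → ℂ}
    (hF : ∀ i, Continuous (F i)) {g : EuclideanSpace ℝ (Fin n) → ℂ}
    (hw : ∀ φ : EuclideanSpace ℝ (Fin n) → ℝ, ContDiff ℝ ∞ φ → HasCompactSupport φ →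
      ∫ x, ∑ i, F i x * (partialDeriv i φ x : ℂ) = -∫ x, g x * (φ x : ℂ))
    (ρ : ContDiffBump (0 : EuclideanSpace ℝ (Fin n))) (x : EuclideanSpace ℝ (Fin n)) :
    ∑ i, fderiv ℝ (ρ.normed volume ⋆[ContinuousLinearMap.lsmul ℝ ℝ, volume] F i) x
        (EuclideanSpace.single i 1) =
      (ρ.normed volume ⋆[ContinuousLinearMap.lsmul ℝ ℝ, volume] g) x := by
  set ψ := ρ.normed volume with hψ
  have hψs : ContDiff ℝ ∞ ψ := ρ.contDiff_normed
  have hψ1 : ContDiff ℝ 1 ψ := ρ.contDiff_normed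
  have hψc : HasCompactSupport ψ := ρ.hasCompactSupport_normed
  -- The weak identity is tested with the reflected kernel y ↦ ψ(x − y). Its derivative in y is
  -- minus the one in x, which cancels the sign in `hw`.
  have hφs : ContDiff ℝ ∞ fun y => ψ (x - y) := hψs.comp (contDiff_const.sub contDiff_id)
  have hφc : HasCompactSupport fun y => ψ (x - y) :=
    hψc.comp_homeomorph (Homeomorph.subLeft x)
  have hpd : ∀ i y, partialDeriv i (fun y => ψ (x - y)) y =
      -fderiv ℝ ψ (x - y) (EuclideanSpace.single i 1) := by
    intro i y
    have h1 : HasFDerivAt (fun y => ψ (x - y)) _ y :=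
      (hψ1.differentiable one_ne_zero (x - y)).hasFDerivAt.comp y ((hasFDerivAt_id y).const_sub x)
    rw [partialDeriv, h1.fderiv]
    simp
  have hd : ∀ i, fderiv ℝ (ψ ⋆[ContinuousLinearMap.lsmul ℝ ℝ, volume] F i) x
      (EuclideanSpace.single i 1) = -∫ y, F i y * (partialDeriv i (fun y => ψ (x - y)) y : ℂ) := by
    intro i
    have h1 := hψc.hasFDerivAt_convolution_left (ContinuousLinearMap.lsmul ℝ ℝ) hψ1
      (hF i).locallyIntegrable (μ := volume) x
    have h2 : ConvolutionExistsAt (fderiv ℝ ψ) (F i) x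
        ((ContinuousLinearMap.lsmul ℝ ℝ).precompL (EuclideanSpace ℝ (Fin n))) volume :=
      (hψc.fderiv ℝ).convolutionExists_left _ (hψ1.continuous_fderiv one_ne_zero)
        (hF i).locallyIntegrable x
    rw [h1.fderiv, convolution_eq_swap, ContinuousLinearMap.integral_apply h2.integrable_swap,
      ← integral_neg]
    refine integral_congr_ae (Eventually.of_forall fun y => ?_)
    simp only [ContinuousLinearMap.precompL_apply, ContinuousLinearMap.lsmul_apply, hpd]
    rw [Complex.real_smul]
    push_cast
    ring
  simp_rw [hd]
  rw [Finset.sum_neg_distrib, ← integral_finsetSum, hw _ hφs hφc, neg_neg, convolution_eq_swap]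
  · refine integral_congr_ae (Eventually.of_forall fun y => ?_)
    simp [mul_comm]
  · intro i _
    have h1 : Continuous fun y => partialDeriv i (fun y => ψ (x - y)) y :=
      (hφs.continuous_fderiv (by simp)).clm_apply continuous_const
    refine ((hF i).mul (Complex.continuous_ofReal.comp h1)).integrable_of_hasCompactSupport ?_
    exact ((hφc.fderiv_apply ℝ (EuclideanSpace.single i 1)).comp_left
      (g := Complex.ofReal) Complex.ofReal_zero).mul_left

/-- **Gauss–Green formula** for a continuous field with locally bounded weak divergence. -/
theorem integral_boundary_eq_of_weakDivergence (hΩ : IsBoundedLipschitz Ω)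
    {F : Fin n → EuclideanSpace ℝ (Fin n) → ℂ} (hF : ∀ i, Continuous (F i))
    {g : EuclideanSpace ℝ (Fin n) → ℂ} (hgm : AEStronglyMeasurable g volume)
    (hg : LocallyEssBounded g)
    (hw : ∀ φ : EuclideanSpace ℝ (Fin n) → ℝ, ContDiff ℝ ∞ φ → HasCompactSupport φ →
      ∫ x, ∑ i, F i x * (partialDeriv i φ x : ℂ) = -∫ x, g x * (φ x : ℂ)) :
    ∫ x, ∑ i, F i x * (outwardNormal Ω x i : ℂ) ∂surfaceMeasure Ω = ∫ x in Ω, g x := by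
  have hfin := hΩ.isFiniteMeasure
  obtain ⟨R, hR⟩ := hΩ.isBounded.closure.exists_norm_le
  have hgl := hg.locallyIntegrable hgm
  let Fj : ℕ → Fin n → EuclideanSpace ℝ (Fin n) → ℂ := fun j i =>
    (shrinkingBump n j).normed volume ⋆[ContinuousLinearMap.lsmul ℝ ℝ, volume] F i
  let gj : ℕ → EuclideanSpace ℝ (Fin n) → ℂ := fun j =>
    (shrinkingBump n j).normed volume ⋆[ContinuousLinearMap.lsmul ℝ ℝ, volume] g
  have hFj : ∀ j i, ContDiff ℝ 1 (Fj j i) := fun j i =>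
    (shrinkingBump n j).hasCompactSupport_normed.contDiff_convolution_left _
      (shrinkingBump n j).contDiff_normed (hF i).locallyIntegrable
  have hν : ∀ x i, inner ℝ (outwardNormal Ω x) (EuclideanSpace.single i (1 : ℝ)) =
      outwardNormal Ω x i := fun x i => by
    rw [EuclideanSpace.inner_single_right]; simp
  have hnu : ∀ x i, ‖(outwardNormal Ω x i : ℂ)‖ ≤ 1 := fun x i => by
    rw [Complex.norm_real]
    exact (PiLp.norm_apply_le _ _).trans (norm_outwardNormal_le x)
  have hGG : ∀ j, ∫ x, ∑ i, Fj j i x * (outwardNormal Ω x i : ℂ) ∂surfaceMeasure Ω =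
      ∫ x in Ω, gj j x := by
    intro j
    have h1 : ∀ i, IntegrableOn (fun x => fderiv ℝ (Fj j i) x (EuclideanSpace.single i 1)) Ω :=
      fun i => ((((hFj j i).continuous_fderiv one_ne_zero).clm_apply
        continuous_const).continuousOn.integrableOn_compact
          hΩ.isBounded.isCompact_closure).mono_set subset_closure
    have h2 : ∀ i, Integrable (fun x => Fj j i x * (outwardNormal Ω x i : ℂ))
        (surfaceMeasure Ω) := fun i => by
      simpa only [hν] using
        hΩ.integrable_mul_inner_complex (hFj j i).continuous (EuclideanSpace.single i 1)
    rw [integral_finsetSum _ fun i _ => h2 i]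
    simp only [gj, ← sum_fderiv_convolution_bump hF hw]
    rw [integral_finsetSum _ fun i _ => h1 i]
    refine Finset.sum_congr rfl fun i _ => ?_
    have := setIntegral_fderiv_complex hΩ (hFj j i) (EuclideanSpace.single i 1)
    simp only [hν] at this
    exact this.symm
  -- In the volume term g is merely bounded: almost everywhere convergence and domination suffice.
  have hlim1 : Tendsto (fun j => ∫ x in Ω, gj j x) atTop (𝓝 (∫ x in Ω, g x)) := by
    obtain ⟨C, hC0, hC⟩ := hg (R + 1)
    refine tendsto_integral_of_dominated_convergence (fun _ => C) (fun j => ?_) ?_ (fun j => ?_) ?_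
    · exact ((shrinkingBump n j).hasCompactSupport_normed.continuous_convolution_left _
        (shrinkingBump n j).continuous_normed hgl).aestronglyMeasurable
    · exact integrableOn_const hΩ.isBounded.measure_lt_top.ne
    · refine (ae_restrict_mem hΩ.isOpen.measurableSet).mono fun x hx => ?_
      exact norm_convolution_bump_le hC _ (shrinkingBump_rOut_le n j)
        (hR x (subset_closure hx))
    · refine ae_restrict_of_ae ?_
      refine ContDiffBump.ae_convolution_tendsto_right_of_locallyIntegrable (K := 2)
        (tendsto_shrinkingBump_rOut n) (Eventually.of_forall fun j => ?_) hgl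
      simp only [shrinkingBump]
      rw [le_iff_eq_or_lt]; left
      field_simp
  -- Convergence Lebesgue-almost everywhere says nothing on the null set ∂Ω; continuity of F gives
  -- convergence at every point.
  have hlim2 : Tendsto (fun j => ∫ x, ∑ i, Fj j i x * (outwardNormal Ω x i : ℂ) ∂surfaceMeasure Ω)
      atTop (𝓝 (∫ x, ∑ i, F i x * (outwardNormal Ω x i : ℂ) ∂surfaceMeasure Ω)) := by
    choose C hC0 hC using fun i => (hF i).locallyEssBounded (R + 1)
    refine tendsto_integral_of_dominated_convergence (fun _ => ∑ i, C i) (fun j => ?_) ?_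
      (fun j => ?_) ?_
    · refine Finset.aestronglyMeasurable_fun_sum _ fun i _ => ?_
      have := (hΩ.integrable_mul_inner_complex (hFj j i).continuous
        (EuclideanSpace.single i 1)).aestronglyMeasurable
      simpa only [hν] using this
    · exact integrable_const _
    · refine (ae_restrict_mem isClosed_frontier.measurableSet).mono fun x hx => ?_
      refine (norm_sum_le _ _).trans (Finset.sum_le_sum fun i _ => ?_)
      rw [norm_mul]
      refine (mul_le_of_le_one_right (norm_nonneg _) (hnu x i)).trans ?_
      exact norm_convolution_bump_le (hC i) _ (shrinkingBump_rOut_le n j)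
        (hR x (frontier_subset_closure hx))
    · refine Eventually.of_forall fun x => tendsto_finsetSum _ fun i _ => ?_
      exact (ContDiffBump.convolution_tendsto_right_of_continuous
        (tendsto_shrinkingBump_rOut n) (hF i) x).mul_const _
  simp_rw [hGG] at hlim2
  exact tendsto_nhds_unique hlim2 hlim1

end WeakDivergence

/-! ### The imaginary part of the fundamental solution -/

section PowerSeries

/-- The coefficients of an everywhere convergent power series. -/
def IsEntireCoeff (a : ℕ → ℝ) : Prop := ∀ R : ℝ, 0 ≤ R → Summable fun m => |a m| * R ^ m

/-- The sum of a power series. -/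
def powSeries (a : ℕ → ℝ) (s : ℝ) : ℝ := ∑' m, a m * s ^ m

/-- The coefficients of the derivative of a power series. -/
def derivCoeff (a : ℕ → ℝ) (m : ℕ) : ℝ := (m + 1) * a (m + 1)

variable {a : ℕ → ℝ}

lemma IsEntireCoeff.summable (ha : IsEntireCoeff a) (s : ℝ) : Summable fun m => a m * s ^ m := by
  refine Summable.of_norm ?_
  simpa [abs_mul, abs_pow] using ha |s| (abs_nonneg s)

lemma IsEntireCoeff.hasSum (ha : IsEntireCoeff a) (s : ℝ) :
    HasSum (fun m => a m * s ^ m) (powSeries a s) := (ha.summable s).hasSum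

lemma IsEntireCoeff.derivCoeff (ha : IsEntireCoeff a) : IsEntireCoeff (derivCoeff a) := by
  intro R hR
  -- Doubling the radius absorbs the factor m + 1, which is at most 2^(m+1).
  have h1 := (summable_nat_add_iff 1).2 (ha (2 * (R + 1)) (by positivity))
  refine Summable.of_nonneg_of_le (fun m => by positivity) (fun m => ?_) h1
  have h2 : ((m : ℝ) + 1) ≤ 2 ^ (m + 1) := by
    exact_mod_cast (Nat.lt_two_pow_self (n := m + 1)).le
  have h3 : R ^ m ≤ (R + 1) ^ (m + 1) := by
    calc R ^ m ≤ (R + 1) ^ m := by gcongr; linarith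
      _ ≤ (R + 1) ^ (m + 1) := pow_le_pow_right₀ (by linarith) (by omega)
  rw [Scattering.derivCoeff, abs_mul, abs_of_nonneg (by positivity : (0 : ℝ) ≤ m + 1), mul_pow]
  calc ((m : ℝ) + 1) * |a (m + 1)| * R ^ m ≤ 2 ^ (m + 1) * |a (m + 1)| * (R + 1) ^ (m + 1) := by
        gcongr
    _ = _ := by ring

lemma IsEntireCoeff.hasDerivAt (ha : IsEntireCoeff a) (s : ℝ) :
    HasDerivAt (powSeries a) (powSeries (Scattering.derivCoeff a) s) s := by
  set R := |s| + 1
  have hR : 0 ≤ R := by positivity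
  have hsum : Summable fun m : ℕ => |a m| * (m * R ^ (m - 1)) := by
    rw [← summable_nat_add_iff 1]
    refine (ha.derivCoeff R hR).congr fun m => ?_
    rw [Scattering.derivCoeff, abs_mul, abs_of_nonneg (by positivity : (0 : ℝ) ≤ m + 1)]
    push_cast
    ring
  have hs : s ∈ Metric.ball (0 : ℝ) R := by
    rw [mem_ball_zero_iff, Real.norm_eq_abs]; simp [R]
  have h1 := hasDerivAt_tsum_of_isPreconnected (g := fun m x => a m * x ^ m)
    (g' := fun m x => a m * (m * x ^ (m - 1))) hsum (t := Metric.ball (0 : ℝ) R) Metric.isOpen_ball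
    (convex_ball (0 : ℝ) R).isPreconnected
    (fun m x _ => (hasDerivAt_pow m x).const_mul (a m))
    (fun m x hx => by
      rw [mem_ball_zero_iff, Real.norm_eq_abs] at hx
      rw [Real.norm_eq_abs, abs_mul, abs_mul, abs_pow, Nat.abs_cast]
      gcongr)
    hs (ha.summable s) hs
  convert! h1 using 1
  have h2 : Summable fun m : ℕ => a m * (m * s ^ (m - 1)) := by
    rw [← summable_nat_add_iff 1]
    refine (ha.derivCoeff.summable s).congr fun m => ?_
    rw [Scattering.derivCoeff]
    push_cast
    ring
  rw [h2.tsum_eq_zero_add]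
  simp only [CharP.cast_eq_zero, zero_mul, mul_zero, zero_add, powSeries, Scattering.derivCoeff]
  refine tsum_congr fun m => ?_
  push_cast
  ring

lemma IsEntireCoeff.contDiff (ha : IsEntireCoeff a) : ContDiff ℝ ∞ (powSeries a) := by
  refine contDiff_infty.2 fun N => ?_
  induction N generalizing a with
  | zero =>
    exact contDiff_zero.2 (continuous_iff_continuousAt.2 fun s => (ha.hasDerivAt s).continuousAt)
  | succ N ih =>
    have hd : deriv (powSeries a) = powSeries (Scattering.derivCoeff a) :=
      funext fun s => (ha.hasDerivAt s).deriv
    push_cast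
    rw [contDiff_succ_iff_deriv]
    refine ⟨fun s => (ha.hasDerivAt s).differentiableAt, by simp, ?_⟩
    rw [hd]
    exact ih ha.derivCoeff

/-- The coefficients of the entire radial solution of `Δw + k²w = 0` in dimension `n`, in powers of
the square of the distance to the origin. -/
def waveCoeff (n : ℕ) (k c : ℝ) (m : ℕ) : ℝ :=
  c * (-k ^ 2) ^ m / ∏ j ∈ Finset.range m, (((j : ℝ) + 1) * (4 * j + 2 * n))

variable {n : ℕ} {k c : ℝ}

/-- In s = ‖x − z‖² the Laplacian of h(s) is 4s h'' + 2n h'. The coefficient of s^m in it is (m +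
1)(4m + 2n) a_{m+1}, so this recursion is the Helmholtz equation read coefficientwise. -/
lemma waveCoeff_succ (hn : 0 < n) (m : ℕ) :
    ((m : ℝ) + 1) * (4 * m + 2 * n) * waveCoeff n k c (m + 1) = -k ^ 2 * waveCoeff n k c m := by
  have hn' : (0 : ℝ) < n := by exact_mod_cast hn
  have hpos : ∀ m : ℕ, (0 : ℝ) < ∏ j ∈ Finset.range m, (((j : ℝ) + 1) * (4 * j + 2 * n)) :=
    fun m => Finset.prod_pos fun j _ => by positivity
  have h1 := (hpos m).ne'
  have h2 : ((m : ℝ) + 1) * (4 * m + 2 * n) ≠ 0 := by positivity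
  rw [waveCoeff, waveCoeff, Finset.prod_range_succ, pow_succ]
  field_simp

lemma isEntireCoeff_waveCoeff (hn : 0 < n) : IsEntireCoeff (waveCoeff n k c) := by
  intro R hR
  refine Summable.of_nonneg_of_le (fun m => by positivity) (fun m => ?_)
    ((Real.summable_pow_div_factorial (k ^ 2 * R)).mul_left |c|)
  have hn' : (1 : ℝ) ≤ n := by exact_mod_cast hn
  have hfac : (m.factorial : ℝ) ≤ ∏ j ∈ Finset.range m, (((j : ℝ) + 1) * (4 * j + 2 * n)) := by
    rw [← Finset.prod_range_add_one_eq_factorial]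
    push_cast
    refine Finset.prod_le_prod (fun j _ => by positivity) fun j _ => ?_
    have : (0 : ℝ) ≤ j := Nat.cast_nonneg j
    nlinarith
  have hf0 : (0 : ℝ) < m.factorial := by positivity
  rw [waveCoeff, abs_div, abs_mul, abs_pow, abs_neg, abs_of_nonneg (sq_nonneg k),
    abs_of_pos (hf0.trans_le hfac), mul_pow]
  calc |c| * (k ^ 2) ^ m / (∏ j ∈ Finset.range m, (((j : ℝ) + 1) * (4 * j + 2 * n))) * R ^ m
      ≤ |c| * (k ^ 2) ^ m / m.factorial * R ^ m := by gcongr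
    _ = _ := by ring

/-- The radial form of the Helmholtz equation. -/
lemma wave_ode (hn : 0 < n) (s : ℝ) :
    4 * s * powSeries (derivCoeff (derivCoeff (waveCoeff n k c))) s +
      2 * n * powSeries (derivCoeff (waveCoeff n k c)) s = -k ^ 2 * powSeries (waveCoeff n k c) s := by
  set a := waveCoeff n k c
  have ha : IsEntireCoeff a := isEntireCoeff_waveCoeff hn
  have h1 : HasSum (fun m : ℕ => (m : ℝ) * derivCoeff a m * s ^ m)
      (s * powSeries (derivCoeff (derivCoeff a)) s) := by
    rw [← hasSum_nat_add_iff' 1]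
    have h2 := (ha.derivCoeff.derivCoeff.hasSum s).mul_left s
    simp only [Finset.range_one, Finset.sum_singleton, CharP.cast_eq_zero, zero_mul, sub_zero]
    convert! h2 using 1
    ext m
    rw [derivCoeff.eq_def (derivCoeff a)]
    push_cast
    ring
  have h3 := ((h1.mul_left 4).add ((ha.derivCoeff.hasSum s).mul_left (2 * (n : ℝ))))
  have h4 := (ha.hasSum s).mul_left (-k ^ 2)
  have h5 : (fun m : ℕ => 4 * ((m : ℝ) * derivCoeff a m * s ^ m) +
      2 * n * (derivCoeff a m * s ^ m)) = fun m => -k ^ 2 * (a m * s ^ m) := by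
    ext m
    have := waveCoeff_succ (k := k) (c := c) hn m
    rw [← mul_assoc (-k ^ 2), ← this, derivCoeff]
    ring
  rw [h5] at h3
  rw [← h3.unique h4]
  ring

end PowerSeries

/-! ### Radial waves and their identification with Im Φ -/

section RadialWave

variable {n : ℕ} {k c : ℝ}

/-- The entire radial solution of the Helmholtz equation centred at `z`. -/
def radialWave (k c : ℝ) (z x : EuclideanSpace ℝ (Fin n)) : ℝ :=
  powSeries (waveCoeff n k c) (‖x - z‖ ^ 2)

lemma contDiff_radialWave (hn : 0 < n) (z : EuclideanSpace ℝ (Fin n)) :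
    ContDiff ℝ ∞ (radialWave k c z) :=
  (isEntireCoeff_waveCoeff hn).contDiff.comp ((contDiff_id.sub contDiff_const).norm_sq ℝ)

lemma partialDeriv_radial {h h' : ℝ → ℝ} (hh : ∀ s, HasDerivAt h (h' s) s)
    (z x : EuclideanSpace ℝ (Fin n)) (i : Fin n) :
    partialDeriv i (fun x => h (‖x - z‖ ^ 2)) x = h' (‖x - z‖ ^ 2) * (2 * (x i - z i)) := by
  have h1 : HasFDerivAt (fun x : EuclideanSpace ℝ (Fin n) => ‖x - z‖ ^ 2) _ x :=
    ((hasFDerivAt_id x).sub_const z).norm_sq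
  have h2 : HasFDerivAt (fun x : EuclideanSpace ℝ (Fin n) => h (‖x - z‖ ^ 2)) _ x :=
    (hh (‖x - z‖ ^ 2)).comp_hasFDerivAt x h1
  rw [partialDeriv, h2.fderiv]
  simp [EuclideanSpace.inner_single_right]

/-- The Laplacian of a function of the square of the distance to `z`. -/
lemma sum_partialDeriv_partialDeriv_radial {h h' h'' : ℝ → ℝ} (hh : ∀ s, HasDerivAt h (h' s) s)
    (hh' : ∀ s, HasDerivAt h' (h'' s) s) (z x : EuclideanSpace ℝ (Fin n)) :
    ∑ i, partialDeriv i (partialDeriv i fun x => h (‖x - z‖ ^ 2)) x =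
      4 * ‖x - z‖ ^ 2 * h'' (‖x - z‖ ^ 2) + 2 * n * h' (‖x - z‖ ^ 2) := by
  have h1 : ∀ i, partialDeriv i (partialDeriv i fun x => h (‖x - z‖ ^ 2)) x =
      h'' (‖x - z‖ ^ 2) * (4 * (x i - z i) ^ 2) + 2 * h' (‖x - z‖ ^ 2) := by
    intro i
    have hf : partialDeriv i (fun x : EuclideanSpace ℝ (Fin n) => h (‖x - z‖ ^ 2)) = fun x =>
        h' (‖x - z‖ ^ 2) * (2 * (x i - z i)) := funext fun x => partialDeriv_radial hh z x i
    have hd1 : DifferentiableAt ℝ (fun x : EuclideanSpace ℝ (Fin n) => h' (‖x - z‖ ^ 2)) x :=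
      (hh' _).differentiableAt.comp x
        ((differentiableAt_id.sub (differentiableAt_const z)).norm_sq ℝ)
    have hd2 : HasFDerivAt (fun x : EuclideanSpace ℝ (Fin n) => 2 * (x i - z i))
        ((2 : ℝ) • (EuclideanSpace.proj i : EuclideanSpace ℝ (Fin n) →L[ℝ] ℝ)) x :=
      ((EuclideanSpace.proj i : EuclideanSpace ℝ (Fin n) →L[ℝ] ℝ).hasFDerivAt.sub_const
        (z i)).const_mul 2
    have hp := partialDeriv_radial hh' z x i
    rw [partialDeriv] at hp ⊢
    rw [hf, (hd1.hasFDerivAt.fun_mul hd2).fderiv]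
    simp only [add_apply, smul_apply, smul_eq_mul]
    rw [hp]
    simp
    ring
  simp_rw [h1]
  rw [Finset.sum_add_distrib, ← Finset.mul_sum, ← Finset.mul_sum]
  have h2 : ∑ i, (x i - z i) ^ 2 = ‖x - z‖ ^ 2 := by
    rw [EuclideanSpace.real_norm_sq_eq]
    rfl
  rw [h2]
  simp
  ring

/-- The radial wave satisfies the Helmholtz equation. -/
lemma sum_partialDeriv_partialDeriv_radialWave (hn : 0 < n) (z x : EuclideanSpace ℝ (Fin n)) :
    ∑ i, partialDeriv i (partialDeriv i (radialWave k c z)) x = -k ^ 2 * radialWave k c z x := by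
  have ha := isEntireCoeff_waveCoeff (k := k) (c := c) hn
  rw [radialWave, ← wave_ode hn]
  exact sum_partialDeriv_partialDeriv_radial ha.hasDerivAt ha.derivCoeff.hasDerivAt z x

/-- The normalization of the imaginary part of the fundamental solution at the source. -/
def greenConst (n : ℕ) (k : ℝ) : ℝ := if n = 2 then 1 / 4 else k / (4 * Real.pi)

lemma besselJ0_eq (t r : ℝ) :
    1 / 4 * besselJ0 (t * r) = powSeries (waveCoeff 2 t (1 / 4)) (r ^ 2) := by
  rw [besselJ0, powSeries, ← tsum_mul_left]
  refine tsum_congr fun m => ?_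
  have hprod : ∏ j ∈ Finset.range m, (((j : ℝ) + 1) * (4 * j + 2 * (2 : ℕ))) =
      4 ^ m * (m.factorial : ℝ) ^ 2 := by
    induction m with
    | zero => simp
    | succ m ih =>
      rw [Finset.prod_range_succ, ih, Nat.factorial_succ]
      push_cast
      ring
  rw [waveCoeff, hprod, neg_pow (t ^ 2), div_pow, mul_pow, pow_mul (2 : ℝ), pow_mul t, pow_mul r]
  norm_num
  ring

/-- For n = 3 the factor (j + 1)(4j + 6) equals (2j + 2)(2j + 3), so the denominators are (2m + 1)!,
those of the sine series divided by its argument. -/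
lemma sinc_eq (t r : ℝ) :
    t / (4 * Real.pi) * Real.sinc (t * r) =
      powSeries (waveCoeff 3 t (t / (4 * Real.pi))) (r ^ 2) := by
  have hprod : ∀ m : ℕ, ∏ j ∈ Finset.range m, (((j : ℝ) + 1) * (4 * j + 2 * (3 : ℕ))) =
      ((2 * m + 1).factorial : ℝ) := by
    intro m
    induction m with
    | zero => simp
    | succ m ih =>
      rw [Finset.prod_range_succ, ih, show 2 * (m + 1) + 1 = (2 * m + 1) + 1 + 1 by ring,
        Nat.factorial_succ (2 * m + 1 + 1), Nat.factorial_succ (2 * m + 1)]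
      push_cast
      ring
  refine ((isEntireCoeff_waveCoeff (n := 3) (by norm_num)).hasSum (r ^ 2)).unique ?_ |>.symm
  have hs : HasSum (fun m : ℕ => (-1 : ℝ) ^ m * (t * r) ^ (2 * m) / ((2 * m + 1).factorial : ℝ))
      (Real.sinc (t * r)) := by
    by_cases h0 : t * r = 0
    · rw [h0, Real.sinc_zero]
      have h1 := hasSum_single (f := fun m : ℕ =>
        (-1 : ℝ) ^ m * (0 : ℝ) ^ (2 * m) / ((2 * m + 1).factorial : ℝ)) 0 (fun m hm => by simp [hm])
      simpa using h1
    · rw [Real.sinc_of_ne_zero h0]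
      have h1 := (Real.hasSum_sin (t * r)).div_const (t * r)
      convert! h1 using 1
      ext m
      rw [eq_div_iff h0, pow_succ]
      ring
  convert! hs.mul_left (t / (4 * Real.pi)) using 1
  ext m
  rw [waveCoeff, hprod, neg_pow (t ^ 2), mul_pow, pow_mul t, pow_mul r]
  ring

lemma im_green_eq_two (h2 : n = 2) (k : ℝ) (x z : EuclideanSpace ℝ (Fin n)) :
    (green k x z).im = 1 / 4 * besselJ0 (k * ‖x - z‖) := by
  rw [green, if_pos h2, hankel0]
  simp [Complex.mul_im]

lemma im_green_eq_three (h3 : n = 3) (k : ℝ) {x z : EuclideanSpace ℝ (Fin n)} (hxz : x ≠ z)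
    (hk : 0 < k) : (green k x z).im = k / (4 * Real.pi) * Real.sinc (k * ‖x - z‖) := by
  have hr : 0 < ‖x - z‖ := norm_pos_iff.2 (sub_ne_zero.2 hxz)
  rw [green, if_neg (by omega), if_pos h3, Real.sinc_of_ne_zero (by positivity)]
  have h1 : (4 * (Real.pi : ℂ) * (‖x - z‖ : ℂ)) = ((4 * Real.pi * ‖x - z‖ : ℝ) : ℂ) := by
    push_cast; ring
  have h2 : Complex.I * (k : ℂ) * (‖x - z‖ : ℂ) = ((k * ‖x - z‖ : ℝ) : ℂ) * Complex.I := by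
    push_cast; ring
  rw [h1, h2, Complex.div_ofReal_im, Complex.exp_ofReal_mul_I_im]
  field_simp

/-- Replaces Im Φ by a function smooth through z. For n = 3 the quotient in `green` takes the
default value 0 at x = z, hence the restriction; later, single points are null for both measures
involved. -/
lemma im_green_eq_radialWave (hn : n = 2 ∨ n = 3) (hk : 0 < k) {x z : EuclideanSpace ℝ (Fin n)}
    (hxz : x ≠ z) : (green k x z).im = radialWave k (greenConst n k) z x := by
  rcases hn with rfl | rfl
  · rw [im_green_eq_two rfl, besselJ0_eq, radialWave, greenConst, if_pos rfl]
  · rw [im_green_eq_three rfl k hxz hk, sinc_eq, radialWave, greenConst, if_neg (by norm_num)]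

end RadialWave

/-! ### Interior regularity for the Poisson equation in dimension at most three -/

section Cutoff

/-- A smooth nonincreasing function with value `1` at `0`, vanishing on `[1, ∞)`. -/
def cutoff (s : ℝ) : ℝ := Real.smoothTransition (1 - s)

lemma contDiff_cutoff : ContDiff ℝ ∞ cutoff :=
  Real.smoothTransition.contDiff.comp (contDiff_const.sub contDiff_id)

lemma contDiff_deriv_cutoff : ContDiff ℝ ∞ (deriv cutoff) :=
  (contDiff_infty_iff_deriv.1 contDiff_cutoff).2

lemma contDiff_deriv_deriv_cutoff : ContDiff ℝ ∞ (deriv (deriv cutoff)) :=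
  (contDiff_infty_iff_deriv.1 contDiff_deriv_cutoff).2

lemma hasDerivAt_cutoff (s : ℝ) : HasDerivAt cutoff (deriv cutoff s) s :=
  (contDiff_cutoff.differentiable (by simp) s).hasDerivAt

lemma hasDerivAt_deriv_cutoff (s : ℝ) : HasDerivAt (deriv cutoff) (deriv (deriv cutoff) s) s :=
  (contDiff_deriv_cutoff.differentiable (by simp) s).hasDerivAt

lemma cutoff_nonneg (s : ℝ) : 0 ≤ cutoff s := Real.smoothTransition.nonneg _

lemma cutoff_le_one (s : ℝ) : cutoff s ≤ 1 := Real.smoothTransition.le_one _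

lemma cutoff_eq_zero {s : ℝ} (hs : 1 ≤ s) : cutoff s = 0 :=
  Real.smoothTransition.zero_of_nonpos (by linarith)

lemma deriv_eq_zero_of_one_lt {h : ℝ → ℝ} (hh : ∀ s, 1 < s → h s = 0) {s : ℝ} (hs : 1 < s) :
    deriv h s = 0 := by
  have : h =ᶠ[𝓝 s] fun _ => 0 := by
    filter_upwards [lt_mem_nhds hs] with t ht using hh t ht
  rw [this.deriv_eq, deriv_const]

lemma deriv_cutoff_eq_zero {s : ℝ} (hs : 1 < s) : deriv cutoff s = 0 :=
  deriv_eq_zero_of_one_lt (fun _ ht => cutoff_eq_zero ht.le) hs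

lemma deriv_deriv_cutoff_eq_zero {s : ℝ} (hs : 1 < s) : deriv (deriv cutoff) s = 0 :=
  deriv_eq_zero_of_one_lt (fun _ ht => deriv_cutoff_eq_zero ht) hs

lemma antitone_cutoff : Antitone cutoff := fun _ _ h =>
  Real.smoothTransition.monotone (by linarith)

lemma deriv_cutoff_nonpos (s : ℝ) : deriv cutoff s ≤ 0 := antitone_cutoff.deriv_nonpos

/-- Ensures that the mollification kernel, built from the derivative of `cutoff`, has nonzero mass.
-/
lemma exists_deriv_cutoff_ne_zero : ∃ s : ℝ, 0 < s ∧ deriv cutoff s ≠ 0 := by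
  obtain ⟨s, hs, h⟩ := exists_deriv_eq_slope cutoff zero_lt_one
    contDiff_cutoff.continuous.continuousOn
    (contDiff_cutoff.differentiable (by simp)).differentiableOn
  refine ⟨s, hs.1, ?_⟩
  rw [h, cutoff_eq_zero le_rfl, cutoff, sub_zero, Real.smoothTransition.one]
  norm_num

end Cutoff

/-! ### A mollification whose scale derivative sees only Δu -/

section Mollifier

variable {n : ℕ}

/-- The mollification kernel at scale `1 / l`, up to normalization. -/
def mollKernel (l : ℝ) (v : EuclideanSpace ℝ (Fin n)) : ℝ :=
  l ^ n * deriv cutoff (l ^ 2 * ‖v‖ ^ 2)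

/-- The derivative of the mollification kernel with respect to the scale. -/
def mollKernelDeriv (l : ℝ) (v : EuclideanSpace ℝ (Fin n)) : ℝ :=
  n * l ^ (n - 1) * deriv cutoff (l ^ 2 * ‖v‖ ^ 2) +
    l ^ n * (deriv (deriv cutoff) (l ^ 2 * ‖v‖ ^ 2) * (2 * l * ‖v‖ ^ 2))

lemma hasDerivAt_mollKernel (l : ℝ) (v : EuclideanSpace ℝ (Fin n)) :
    HasDerivAt (fun l => mollKernel l v) (mollKernelDeriv l v) l := by
  have h1 : HasDerivAt (fun l : ℝ => l ^ 2 * ‖v‖ ^ 2) (2 * l * ‖v‖ ^ 2) l := by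
    simpa using (hasDerivAt_pow 2 l).mul_const (‖v‖ ^ 2)
  exact (hasDerivAt_pow n l).fun_mul ((hasDerivAt_deriv_cutoff _).comp l h1)

lemma one_lt_sq_mul_sq {l a : ℝ} (hl : 0 < l) (ha : 1 / l < a) : 1 < l ^ 2 * a ^ 2 := by
  have h1 : 1 < l * a := by rwa [div_lt_iff₀' hl] at ha
  nlinarith

lemma mollKernel_eq_zero {l : ℝ} (hl : 0 < l) {v : EuclideanSpace ℝ (Fin n)}
    (hv : 1 / l < ‖v‖) : mollKernel l v = 0 := by
  rw [mollKernel, deriv_cutoff_eq_zero (one_lt_sq_mul_sq hl hv), mul_zero]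

lemma mollKernelDeriv_eq_zero {l : ℝ} (hl : 0 < l) {v : EuclideanSpace ℝ (Fin n)}
    (hv : 1 / l < ‖v‖) : mollKernelDeriv l v = 0 := by
  rw [mollKernelDeriv, deriv_cutoff_eq_zero (one_lt_sq_mul_sq hl hv),
    deriv_deriv_cutoff_eq_zero (one_lt_sq_mul_sq hl hv)]
  ring

lemma contDiff_mollKernel (l : ℝ) : ContDiff ℝ ∞ (mollKernel l : EuclideanSpace ℝ (Fin n) → ℝ) :=
  contDiff_const.mul (contDiff_deriv_cutoff.comp (contDiff_const.mul (contDiff_id.norm_sq ℝ)))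

lemma hasCompactSupport_mollKernel {l : ℝ} (hl : 0 < l) :
    HasCompactSupport (mollKernel l : EuclideanSpace ℝ (Fin n) → ℝ) :=
  HasCompactSupport.intro (isCompact_closedBall 0 (1 / l)) fun v hv =>
    mollKernel_eq_zero hl (by rwa [mem_closedBall_zero_iff, not_le] at hv)

lemma continuous_mollKernelDeriv :
    Continuous fun p : ℝ × EuclideanSpace ℝ (Fin n) => mollKernelDeriv p.1 p.2 := by
  have h1 := contDiff_deriv_cutoff.continuous
  have h2 := contDiff_deriv_deriv_cutoff.continuous
  unfold mollKernelDeriv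
  fun_prop

/-- The scale derivative of the mollification kernel is a Laplacian. -/
lemma mollKernelDeriv_eq_laplacian {l : ℝ} (hn : 0 < n) (hl : 0 < l)
    (x y : EuclideanSpace ℝ (Fin n)) :
    mollKernelDeriv l (x - y) = l ^ n / (2 * l ^ 3) *
      ∑ i, partialDeriv i (partialDeriv i fun y => cutoff (l ^ 2 * ‖y - x‖ ^ 2)) y := by
  have h1 : ∀ s : ℝ, HasDerivAt (fun s => cutoff (l ^ 2 * s)) (l ^ 2 * deriv cutoff (l ^ 2 * s)) s :=
    fun s => by
      have := (hasDerivAt_cutoff (l ^ 2 * s)).comp s ((hasDerivAt_id s).const_mul (l ^ 2))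
      simpa [mul_comm, Function.comp_def] using this
  have h2 : ∀ s : ℝ, HasDerivAt (fun s => l ^ 2 * deriv cutoff (l ^ 2 * s))
      (l ^ 2 * (l ^ 2 * deriv (deriv cutoff) (l ^ 2 * s))) s := fun s => by
    have := ((hasDerivAt_deriv_cutoff (l ^ 2 * s)).comp s
      ((hasDerivAt_id s).const_mul (l ^ 2))).const_mul (l ^ 2)
    simpa [mul_comm, Function.comp_def] using this
  -- With ρ = ‖y − x‖ and χ = `cutoff`, the Laplacian is 4l⁴ρ²χ'' + 2nl²χ'; the factor l^n/(2l³)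
  -- makes it 2l^(n+1)ρ²χ'' + nl^(n−1)χ', which is the scale derivative.
  rw [sum_partialDeriv_partialDeriv_radial h1 h2, mollKernelDeriv, norm_sub_rev x y]
  rw [← pow_sub_one_mul hn.ne' l]
  field_simp
  ring

/-- The mollification of `u` at scale `1 / l`. -/
def mollify (u : EuclideanSpace ℝ (Fin n) → ℂ) (l : ℝ) (x : EuclideanSpace ℝ (Fin n)) : ℂ :=
  ∫ y, mollKernel l (x - y) • u y

/-- `Δu = f` in the sense of distributions. -/
def IsDistribLaplacian (u f : EuclideanSpace ℝ (Fin n) → ℂ) : Prop :=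
  ∀ φ : EuclideanSpace ℝ (Fin n) → ℝ, ContDiff ℝ ∞ φ → HasCompactSupport φ →
    ∫ y, (∑ i, partialDeriv i (partialDeriv i φ) y) • u y = ∫ y, φ y • f y

variable {u f : EuclideanSpace ℝ (Fin n) → ℂ}

lemma integrable_smul_of_eq_zero (hu : LocallyIntegrable u) {ψ : EuclideanSpace ℝ (Fin n) → ℝ}
    (hψ : Continuous ψ) {R : ℝ} (h0 : ∀ v, R < ‖v‖ → ψ v = 0) (x : EuclideanSpace ℝ (Fin n)) :
    Integrable fun y => ψ (x - y) • u y := by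
  refine hu.integrable_smul_left_of_hasCompactSupport (by fun_prop) ?_
  refine HasCompactSupport.intro (isCompact_closedBall x R) fun y hy => h0 _ ?_
  rwa [Metric.mem_closedBall, dist_comm, dist_eq_norm, not_le] at hy

/-- Under the integral, the scale derivative of the kernel is a Laplacian of a test function, so the
distributional equation trades u for f. -/
lemma hasDerivAt_mollify (hn : 0 < n) (hu : LocallyIntegrable u) (huf : IsDistribLaplacian u f)
    {l : ℝ} (hl : 0 < l) (x : EuclideanSpace ℝ (Fin n)) :
    HasDerivAt (fun l => mollify u l x)
      ((l ^ n / (2 * l ^ 3)) • ∫ y, cutoff (l ^ 2 * ‖y - x‖ ^ 2) • f y) l := by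
  -- For scales in (l/2, 2l) all kernels live in the ball of radius 2/l, so one compact set provides
  -- the dominating constant.
  obtain ⟨C, hC⟩ := ((isCompact_Icc (a := l / 2) (b := 2 * l)).prod
    (isCompact_closedBall (0 : EuclideanSpace ℝ (Fin n)) (2 / l))).exists_bound_of_continuousOn
      continuous_mollKernelDeriv.continuousOn
  have hs : Set.Ioo (l / 2) (2 * l) ∈ 𝓝 l := Ioo_mem_nhds (by linarith) (by linarith)
  have hbi : Integrable (fun y => (Metric.closedBall x (2 / l)).indicator (fun y => C * ‖u y‖) y) :=
    (integrable_indicator_iff Metric.isClosed_closedBall.measurableSet).2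
      ((hu.integrableOn_isCompact (isCompact_closedBall x (2 / l))).norm.const_mul C)
  have key := hasDerivAt_integral_of_dominated_loc_of_deriv_le (μ := volume)
    (F := fun l y => mollKernel l (x - y) • u y)
    (F' := fun l y => mollKernelDeriv l (x - y) • u y) hs
    (Eventually.of_forall fun l' => by
      have : Continuous fun y => mollKernel l' (x - y) :=
        (contDiff_mollKernel l').continuous.comp (by fun_prop)
      exact this.aestronglyMeasurable.smul hu.aestronglyMeasurable)
    (integrable_smul_of_eq_zero hu (contDiff_mollKernel l).continuous
      (fun v hv => mollKernel_eq_zero hl hv) x)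
    (by
      have : Continuous fun y => mollKernelDeriv l (x - y) :=
        continuous_mollKernelDeriv.comp (by fun_prop : Continuous fun y => (l, x - y))
      exact this.aestronglyMeasurable.smul hu.aestronglyMeasurable)
    (Eventually.of_forall fun y l' hl' => by
      by_cases hy : y ∈ Metric.closedBall x (2 / l)
      · rw [Set.indicator_of_mem hy, norm_smul]
        gcongr
        refine hC (l', x - y) ⟨⟨hl'.1.le, hl'.2.le⟩, ?_⟩
        rwa [mem_closedBall_zero_iff, ← dist_eq_norm, dist_comm]
      · rw [Set.indicator_of_notMem hy, mollKernelDeriv_eq_zero (by linarith [hl'.1])]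
        · simp
        · rw [Metric.mem_closedBall, dist_comm, dist_eq_norm, not_le] at hy
          refine lt_trans ?_ hy
          rw [div_lt_div_iff₀ (by linarith [hl'.1]) hl]
          linarith [hl'.1])
    hbi
    (Eventually.of_forall fun y l' _ => (hasDerivAt_mollKernel l' (x - y)).smul_const (u y))
  convert! key.2 using 1
  have h1 := huf (fun y => cutoff (l ^ 2 * ‖y - x‖ ^ 2))
    (contDiff_cutoff.comp (contDiff_const.mul ((contDiff_id.sub contDiff_const).norm_sq ℝ)))
    (HasCompactSupport.intro (isCompact_closedBall x (1 / l)) fun y hy => by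
      rw [Metric.mem_closedBall, dist_eq_norm, not_le] at hy
      exact cutoff_eq_zero (one_lt_sq_mul_sq hl hy).le)
  rw [← h1, ← integral_smul]
  refine integral_congr_ae (Eventually.of_forall fun y => ?_)
  simp only
  rw [mollKernelDeriv_eq_laplacian hn hl, mul_smul]

/-- Mean value inequality on [4^j, 4^(j+1)], of length 3·4^j, with derivative at most B/2; 3/2 is
rounded up to 2. -/
lemma norm_sub_le_of_hasDerivAt_scale {Φ I : ℝ → ℂ}
    (hΦ : ∀ l : ℝ, 0 < l → HasDerivAt Φ ((l ^ n / (2 * l ^ 3)) • I l) l) {j : ℕ} {B : ℝ}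
    (hB : ∀ l : ℝ, (4 : ℝ) ^ j ≤ l → l ^ n / l ^ 3 * ‖I l‖ ≤ B) :
    ‖Φ (4 ^ (j + 1)) - Φ (4 ^ j)‖ ≤ 2 * B * 4 ^ j := by
  have h4 : (0 : ℝ) < 4 ^ j := by positivity
  have hder : ∀ l ∈ Set.Icc ((4 : ℝ) ^ j) (4 ^ (j + 1)), HasDerivWithinAt Φ
      ((l ^ n / (2 * l ^ 3)) • I l) (Set.Icc ((4 : ℝ) ^ j) (4 ^ (j + 1))) l := fun l hl =>
    (hΦ l (h4.trans_le hl.1)).hasDerivWithinAt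
  have hle : (4 : ℝ) ^ j ≤ 4 ^ (j + 1) := pow_le_pow_right₀ (by norm_num) (by omega)
  have := (convex_Icc ((4 : ℝ) ^ j) (4 ^ (j + 1))).norm_image_sub_le_of_norm_hasDerivWithin_le
    hder (C := B / 2) (fun l hl => ?_) (Set.left_mem_Icc.2 hle) (Set.right_mem_Icc.2 hle)
  · refine this.trans ?_
    have hB0 : 0 ≤ B := le_trans (by positivity) (hB (4 ^ j) le_rfl)
    rw [Real.norm_of_nonneg (by linarith), pow_succ]
    nlinarith
  · have hl0 : 0 < l := h4.trans_le hl.1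
    rw [norm_smul, Real.norm_of_nonneg (by positivity)]
    have := hB l hl.1
    calc l ^ n / (2 * l ^ 3) * ‖I l‖ = (l ^ n / l ^ 3 * ‖I l‖) / 2 := by field_simp
      _ ≤ B / 2 := by linarith

end Mollifier

/-! ### Convergence of the mollifications -/

section MollifierConvergence

variable {n : ℕ} {u f : EuclideanSpace ℝ (Fin n) → ℂ}

lemma contDiff_mollify (hu : LocallyIntegrable u) {l : ℝ} (hl : 0 < l) :
    ContDiff ℝ 1 (mollify u l) := by
  have h := (hasCompactSupport_mollKernel (n := n) hl).contDiff_convolution_left (𝕜 := ℝ)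
    (μ := volume) (n := 1) (ContinuousLinearMap.lsmul ℝ ℝ)
    ((contDiff_mollKernel l).of_le (mod_cast le_top)) hu
  convert! h using 1
  ext x
  rw [convolution_eq_swap]
  rfl

/-- The total mass of the mollification kernel. -/
def mollMass (n : ℕ) : ℝ := ∫ v : EuclideanSpace ℝ (Fin n), mollKernel 1 v

lemma mollMass_ne_zero (hn : 0 < n) : mollMass n ≠ 0 := by
  obtain ⟨s, hs, hs'⟩ := exists_deriv_cutoff_ne_zero
  have h := Continuous.integral_pos_of_hasCompactSupport_nonneg_nonzero (μ := volume)
    (f := fun v : EuclideanSpace ℝ (Fin n) => -mollKernel 1 v)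
    (x := EuclideanSpace.single ⟨0, hn⟩ (Real.sqrt s))
    (contDiff_mollKernel 1).continuous.neg (HasCompactSupport.neg (hasCompactSupport_mollKernel one_pos))
    (fun v => by simpa [mollKernel] using deriv_cutoff_nonpos _)
    (by simpa [mollKernel, Real.sq_sqrt hs.le] using hs')
  rw [integral_neg] at h
  rw [mollMass]
  linarith

lemma integral_mollKernel {l : ℝ} (hl : 0 < l) :
    ∫ v : EuclideanSpace ℝ (Fin n), mollKernel l v = mollMass n := by
  have h := Measure.integral_comp_smul (volume : Measure (EuclideanSpace ℝ (Fin n)))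
    (fun v => mollKernel 1 v) l
  have h2 : ∀ v : EuclideanSpace ℝ (Fin n), mollKernel l v = l ^ n * mollKernel 1 (l • v) := by
    intro v
    simp only [mollKernel, norm_smul, Real.norm_eq_abs, mul_pow, sq_abs, one_pow, one_mul]
  simp_rw [h2]
  rw [integral_const_mul, h, finrank_euclideanSpace_fin, abs_of_pos (by positivity), smul_eq_mul,
    ← mul_assoc, mul_inv_cancel₀ (by positivity), one_mul, mollMass]

lemma volumeReal_closedBall (x : EuclideanSpace ℝ (Fin n)) {l : ℝ} (hl : 0 < l) :
    volume.real (Metric.closedBall x (1 / l)) =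
      volume.real (Metric.ball (0 : EuclideanSpace ℝ (Fin n)) 1) / l ^ n := by
  rw [Measure.addHaar_real_closedBall _ _ (by positivity), finrank_euclideanSpace_fin,
    one_div_pow]
  field_simp

/-- Convergence at Lebesgue points: the kernel has size of order l^n on a ball of radius 1/l. Its
mass is constant in l but not 1 (it is negative), hence the factor (`mollMass n`)⁻¹. -/
lemma ae_tendsto_mollify (hn : 0 < n) (hu : LocallyIntegrable u) :
    ∀ᵐ x, Tendsto (fun j : ℕ => (mollMass n)⁻¹ • mollify u (4 ^ j) x) atTop (𝓝 (u x)) := by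
  filter_upwards [(Besicovitch.vitaliFamily
    (volume : Measure (EuclideanSpace ℝ (Fin n)))).ae_tendsto_average_norm_sub hu] with x hx
  have hscale : Tendsto (fun j : ℕ => 1 / (4 : ℝ) ^ j) atTop (𝓝[>] 0) := by
    refine tendsto_nhdsWithin_iff.2 ⟨?_, Eventually.of_forall fun j => ?_⟩
    · simpa using tendsto_pow_atTop_nhds_zero_of_lt_one (r := (1 / 4 : ℝ)) (by norm_num)
        (by norm_num)
    · simp only [Set.mem_Ioi]
      positivity
  have hx' := hx.comp ((Besicovitch.tendsto_filterAt volume x).comp hscale)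
  have hmass := mollMass_ne_zero hn
  obtain ⟨C, hC⟩ := (contDiff_mollKernel (n := n) 1).continuous.bounded_above_of_compact_support
    (hasCompactSupport_mollKernel one_pos)
  have hv : 0 < volume.real (Metric.ball (0 : EuclideanSpace ℝ (Fin n)) 1) :=
    ENNReal.toReal_pos (Metric.measure_ball_pos volume 0 one_pos).ne' measure_ball_lt_top.ne
  have key := tendsto_integral_smul_of_tendsto_average_norm_sub
    (g := fun (j : ℕ) y => (mollMass n)⁻¹ * mollKernel (4 ^ j) (x - y))
    (|(mollMass n)⁻¹| * C * volume.real (Metric.ball (0 : EuclideanSpace ℝ (Fin n)) 1)) hx'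
    (Eventually.of_forall fun j => hu.integrableOn_isCompact (isCompact_closedBall _ _))
    (by
      refine tendsto_const_nhds.congr fun j => ?_
      rw [integral_const_mul, integral_sub_left_eq_self (fun v => mollKernel (4 ^ j) v),
        integral_mollKernel (by positivity), inv_mul_cancel₀ hmass])
    (Eventually.of_forall fun j y hy => by
      by_contra h
      refine hy ?_
      simp only [Function.comp_apply, Metric.mem_closedBall, dist_comm y, dist_eq_norm,
        not_le] at h
      simp only
      rw [mollKernel_eq_zero (by positivity) h, mul_zero])
    (Eventually.of_forall fun j y => by
      simp only [Function.comp_apply]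
      rw [volumeReal_closedBall x (by positivity), abs_mul, mul_assoc, mul_div_assoc]
      refine mul_le_mul_of_nonneg_left ?_ (abs_nonneg _)
      have h1 := hC ((4 : ℝ) ^ j • (x - y))
      simp only [mollKernel, norm_smul, Real.norm_eq_abs, mul_pow, sq_abs, one_pow, one_mul] at h1
      rw [mollKernel, abs_mul, abs_of_pos (by positivity)]
      calc _ ≤ ((4 : ℝ) ^ j) ^ n * C := by gcongr
        _ = _ := by field_simp)
  refine key.congr fun j => ?_
  simp only [mul_smul]
  rw [integral_smul]
  rfl

/-- Geometric decay of the increments on balls gives locally uniform convergence. -/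
lemma exists_tendstoLocallyUniformly {V W : Type*} [NormedAddCommGroup V] [NormedAddCommGroup W]
    [CompleteSpace W] {h : ℕ → V → W}
    (hh : ∀ R : ℝ, ∃ C : ℝ, ∀ j x, ‖x‖ ≤ R → ‖h (j + 1) x - h j x‖ ≤ C * (1 / 2) ^ j) :
    ∃ H : V → W, TendstoLocallyUniformly h H atTop := by
  have hd : ∀ R : ℝ, ∃ C : ℝ, ∀ x, ‖x‖ ≤ R → ∀ j, dist (h j x) (h (j + 1) x) ≤ C * (1 / 2) ^ j :=
    fun R => (hh R).imp fun C hC x hx j => by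
      rw [dist_comm, dist_eq_norm]
      exact hC j x hx
  choose! C hC using hd
  have hlim : ∀ x, ∃ a, Tendsto (fun j => h j x) atTop (𝓝 a) := fun x =>
    cauchySeq_tendsto_of_complete
      (cauchySeq_of_le_geometric (1 / 2) (C ‖x‖) (by norm_num) (hC ‖x‖ x le_rfl))
  choose H hH using hlim
  refine ⟨H, Metric.tendstoLocallyUniformly_iff.2 fun ε hε x => ?_⟩
  refine ⟨Metric.ball x 1, Metric.ball_mem_nhds x one_pos, ?_⟩
  have ht : Tendsto (fun j : ℕ => C (‖x‖ + 1) * (1 / 2 : ℝ) ^ j / (1 - 1 / 2)) atTop (𝓝 0) := by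
    simpa using ((tendsto_pow_atTop_nhds_zero_of_lt_one (r := (1 / 2 : ℝ)) (by norm_num)
      (by norm_num)).const_mul (C (‖x‖ + 1))).div_const (1 - 1 / 2)
  filter_upwards [ht.eventually (gt_mem_nhds hε)] with j hj y hy
  rw [dist_comm]
  refine (dist_le_of_le_geometric_of_tendsto (1 / 2) _ (by norm_num) (hC (‖x‖ + 1) y ?_)
    (hH y) j).trans_lt hj
  have h1 : ‖y‖ ≤ ‖y - x‖ + ‖x‖ := norm_le_norm_sub_add y x
  rw [mem_ball_iff_norm] at hy
  linarith

end MollifierConvergence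

/-! ### Decay of increments between scales, and regularity -/

section Estimates

variable {n : ℕ} {u f : EuclideanSpace ℝ (Fin n) → ℂ}

lemma cutoff_eq_zero_of_notMem {l : ℝ} (hl : 0 < l) {x y : EuclideanSpace ℝ (Fin n)}
    (hy : y ∉ Metric.closedBall x (1 / l)) : cutoff (l ^ 2 * ‖y - x‖ ^ 2) = 0 := by
  rw [Metric.mem_closedBall, dist_eq_norm, not_le] at hy
  exact cutoff_eq_zero (one_lt_sq_mul_sq hl hy).le

lemma closedBall_one_div_subset {l R : ℝ} (hl : 1 ≤ l) {x : EuclideanSpace ℝ (Fin n)}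
    (hx : ‖x‖ ≤ R) : Metric.closedBall x (1 / l) ⊆ Metric.closedBall 0 (R + 1) := by
  refine Metric.closedBall_subset_closedBall' ?_
  have : 1 / l ≤ 1 := by rw [div_le_one (by linarith)]; exact hl
  rw [dist_zero_right]
  linarith

lemma pow_div_pow_three_le_one (hn : n ≤ 3) {l : ℝ} (hl : 1 ≤ l) : l ^ n / l ^ 3 ≤ 1 := by
  rw [div_le_one (by positivity)]
  exact pow_le_pow_right₀ hl hn

/-- Decay of the mollifier increments for square-integrable data. -/
lemma exists_norm_mollify_sub_le (hn : 0 < n) (hn3 : n ≤ 3) (hu : LocallyIntegrable u)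
    (hf2 : LocallyIntegrable fun y => ‖f y‖ ^ 2) (huf : IsDistribLaplacian u f)
    (R : ℝ) : ∃ C : ℝ, ∀ (j : ℕ) x, ‖x‖ ≤ R →
      ‖mollify u (4 ^ (j + 1)) x - mollify u (4 ^ j) x‖ ≤ C * (1 / 2) ^ j := by
  set A := ∫ y in Metric.closedBall (0 : EuclideanSpace ℝ (Fin n)) (R + 1), ‖f y‖ ^ 2 with hA
  set v := volume.real (Metric.ball (0 : EuclideanSpace ℝ (Fin n)) 1) with hv
  have hA0 : 0 ≤ A := integral_nonneg fun y => by positivity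
  have hv0 : 0 ≤ v := measureReal_nonneg
  refine ⟨v + A, fun j x hx => ?_⟩
  have h4 : ((4 : ℝ) ^ j) = (2 ^ j) ^ 2 := by rw [← pow_mul, mul_comm, pow_mul]; norm_num
  -- Here l ≥ 4^j = m², and m³ is the weight in Young's inequality ‖f‖ ≤ m³/2 + ‖f‖²/(2m³). The
  -- constant term contributes m³/l³ ≤ m⁻³; the L² term contributes m⁻³ because l^(n−3) ≤ 1, which
  -- is where n ≤ 3 enters. The factor 4^j = m² from the scale interval leaves 1/m = 2^(−j).
  set m : ℝ := 2 ^ j with hm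
  have hm0 : 0 < m := by positivity
  have hm1 : 1 ≤ m := one_le_pow₀ (by norm_num)
  have hB : ∀ l : ℝ, (4 : ℝ) ^ j ≤ l →
      l ^ n / l ^ 3 * ‖∫ y, cutoff (l ^ 2 * ‖y - x‖ ^ 2) • f y‖ ≤ (v + A) / 2 / m ^ 3 := by
    intro l hl
    have hl1 : 1 ≤ l := by nlinarith
    have hl0 : 0 < l := by linarith
    have hs := closedBall_one_div_subset hl1 hx
    have hi2 : IntegrableOn (fun y => ‖f y‖ ^ 2) (Metric.closedBall x (1 / l)) :=
      hf2.integrableOn_isCompact (isCompact_closedBall _ _)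
    have e1 : ‖∫ y, cutoff (l ^ 2 * ‖y - x‖ ^ 2) • f y‖ ≤
        ∫ y in Metric.closedBall x (1 / l), (m ^ 3 / 2 + ‖f y‖ ^ 2 * (1 / (2 * m ^ 3))) := by
      rw [← setIntegral_eq_integral_of_forall_compl_eq_zero (s := Metric.closedBall x (1 / l))
        (fun y hy => by rw [cutoff_eq_zero_of_notMem hl0 hy, zero_smul])]
      refine norm_integral_le_of_norm_le ?_ (Eventually.of_forall fun y => ?_)
      · exact (integrableOn_const measure_closedBall_lt_top.ne).add (hi2.mul_const _)
      · rw [norm_smul, Real.norm_of_nonneg (cutoff_nonneg _)]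
        calc cutoff (l ^ 2 * ‖y - x‖ ^ 2) * ‖f y‖ ≤ 1 * ‖f y‖ := by
              gcongr
              exact cutoff_le_one _
          _ ≤ m ^ 3 / 2 + ‖f y‖ ^ 2 * (1 / (2 * m ^ 3)) := by
              have : m ^ 3 / 2 + ‖f y‖ ^ 2 * (1 / (2 * m ^ 3)) - 1 * ‖f y‖ =
                  (m ^ 3 - ‖f y‖) ^ 2 / (2 * m ^ 3) := by
                field_simp
                ring
              have h2 : 0 ≤ (m ^ 3 - ‖f y‖) ^ 2 / (2 * m ^ 3) := by positivity
              linarith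
    have e2 : ∫ y in Metric.closedBall x (1 / l), (m ^ 3 / 2 + ‖f y‖ ^ 2 * (1 / (2 * m ^ 3))) ≤
        v / l ^ n * (m ^ 3 / 2) + A * (1 / (2 * m ^ 3)) := by
      have hi1 : IntegrableOn (fun _ : EuclideanSpace ℝ (Fin n) => m ^ 3 / 2)
        (Metric.closedBall x (1 / l)) := integrableOn_const measure_closedBall_lt_top.ne
      rw [integral_add hi1.integrable (hi2.mul_const _),
        setIntegral_const, volumeReal_closedBall x hl0, integral_mul_const, smul_eq_mul]
      gcongr
      exact setIntegral_mono_set (hf2.integrableOn_isCompact (isCompact_closedBall _ _))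
        (Eventually.of_forall fun y => by positivity) hs.eventuallyLE
    calc l ^ n / l ^ 3 * ‖∫ y, cutoff (l ^ 2 * ‖y - x‖ ^ 2) • f y‖
        ≤ l ^ n / l ^ 3 * (v / l ^ n * (m ^ 3 / 2) + A * (1 / (2 * m ^ 3))) := by
          gcongr
          exact e1.trans e2
      _ = v * m ^ 3 / 2 * (1 / l ^ 3) + l ^ n / l ^ 3 * (A * (1 / (2 * m ^ 3))) := by
          field_simp
      _ ≤ v * m ^ 3 / 2 * (1 / (m ^ 2) ^ 3) + 1 * (A * (1 / (2 * m ^ 3))) := by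
          rw [h4] at hl
          have := pow_div_pow_three_le_one hn3 hl1
          gcongr
      _ = (v + A) / 2 / m ^ 3 := by
          field_simp
  refine (norm_sub_le_of_hasDerivAt_scale (n := n)
    (fun l hl => hasDerivAt_mollify hn hu huf hl x) hB).trans_eq ?_
  rw [h4, one_div_pow, ← hm]
  field_simp

/-- Taken in the variable s = l‖y − x‖, which changes by at most l‖x − x'‖ when x moves to x'. -/
lemma exists_lipschitz_cutoff_sq : ∃ L : ℝ≥0, LipschitzWith L fun s : ℝ => cutoff (s ^ 2) :=
  ContDiff.lipschitzWith_of_hasCompactSupport (𝕂 := ℝ) (n := ∞)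
    (HasCompactSupport.intro (isCompact_closedBall 0 1) fun s hs => cutoff_eq_zero (by
      rw [mem_closedBall_zero_iff, Real.norm_eq_abs, not_le] at hs
      nlinarith [sq_abs s]))
    (contDiff_cutoff.comp (contDiff_id.pow 2)) (by simp)

/-- Lipschitz decay of the mollifier increments for locally bounded data. -/
lemma exists_norm_mollify_sub_sub_le (hn : 0 < n) (hu : LocallyIntegrable u)
    (hfm : AEStronglyMeasurable f volume) (hf : LocallyEssBounded f)
    (huf : IsDistribLaplacian u f) (R : ℝ) :
    ∃ C : ℝ, 0 ≤ C ∧ ∀ (j : ℕ) x x', ‖x‖ ≤ R → ‖x'‖ ≤ R →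
      ‖(mollify u (4 ^ (j + 1)) x - mollify u (4 ^ j) x) -
        (mollify u (4 ^ (j + 1)) x' - mollify u (4 ^ j) x')‖ ≤ C * (1 / 2) ^ j * ‖x - x'‖ := by
  obtain ⟨L, hL⟩ := exists_lipschitz_cutoff_sq
  obtain ⟨F, hF0, hF⟩ := hf (R + 1)
  set v := volume.real (Metric.ball (0 : EuclideanSpace ℝ (Fin n)) 1) with hv
  have hv0 : 0 ≤ v := measureReal_nonneg
  have hfi := hf.locallyIntegrable hfm
  refine ⟨4 * v * L * F, by positivity, fun j x x' hx hx' => ?_⟩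
  have h4 : (1 : ℝ) ≤ 4 ^ j := one_le_pow₀ (by norm_num)
  have hint : ∀ l : ℝ, 0 < l → ∀ x, Integrable fun y => cutoff (l ^ 2 * ‖y - x‖ ^ 2) • f y :=
    fun l hl x => hfi.integrable_smul_left_of_hasCompactSupport
      (contDiff_cutoff.continuous.comp (by fun_prop))
      (HasCompactSupport.intro (isCompact_closedBall x (1 / l)) fun y hy =>
        cutoff_eq_zero_of_notMem hl hy)
  -- The difference of cutoffs costs l‖x − x'‖ and lives on two balls of total volume of order
  -- l^(−n); with the prefactor l^(n−3) this gives l^(−2), and 4^(−j) after the length of the scale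
  -- interval.
  have hB : ∀ l : ℝ, (4 : ℝ) ^ j ≤ l →
      l ^ n / l ^ 3 * ‖(∫ y, cutoff (l ^ 2 * ‖y - x‖ ^ 2) • f y) -
        ∫ y, cutoff (l ^ 2 * ‖y - x'‖ ^ 2) • f y‖ ≤
      2 * v * L * F * ‖x - x'‖ / (4 ^ j) ^ 2 := by
    intro l hl
    have hl1 : 1 ≤ l := h4.trans hl
    have hl0 : 0 < l := by linarith
    set S := Metric.closedBall x (1 / l) ∪ Metric.closedBall x' (1 / l) with hS
    have hSv : volume.real S ≤ 2 * (v / l ^ n) := by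
      refine (measureReal_union_le _ _).trans_eq ?_
      rw [volumeReal_closedBall x hl0, volumeReal_closedBall x' hl0]
      ring
    have hSsub : S ⊆ Metric.closedBall 0 (R + 1) :=
      Set.union_subset (closedBall_one_div_subset hl1 hx) (closedBall_one_div_subset hl1 hx')
    have hSfin : volume S < ⊤ := (measure_mono hSsub).trans_lt measure_closedBall_lt_top
    have hSm : MeasurableSet S :=
      Metric.isClosed_closedBall.measurableSet.union Metric.isClosed_closedBall.measurableSet
    have e1 : ‖(∫ y, cutoff (l ^ 2 * ‖y - x‖ ^ 2) • f y) -
        ∫ y, cutoff (l ^ 2 * ‖y - x'‖ ^ 2) • f y‖ ≤ (L * (l * ‖x - x'‖) * F) * volume.real S := by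
      rw [← integral_sub (hint l hl0 x) (hint l hl0 x'),
        ← setIntegral_eq_integral_of_forall_compl_eq_zero (s := S) (fun y hy => by
          rw [hS, Set.mem_union, not_or] at hy
          rw [cutoff_eq_zero_of_notMem hl0 hy.1, cutoff_eq_zero_of_notMem hl0 hy.2, zero_smul,
            sub_zero])]
      refine norm_setIntegral_le_of_norm_le_const_ae' hSfin ?_
      filter_upwards [hF] with y hy hyS
      have hfy := hy (mem_closedBall_zero_iff.1 (hSsub hyS))
      rw [← sub_smul, norm_smul]
      gcongr
      have h1 := hL.dist_le_mul (l * ‖y - x‖) (l * ‖y - x'‖)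
      rw [dist_eq_norm, Real.dist_eq, ← mul_sub, abs_mul, abs_of_pos hl0, mul_pow, mul_pow] at h1
      refine h1.trans ?_
      gcongr
      refine (abs_norm_sub_norm_le _ _).trans_eq ?_
      rw [sub_sub_sub_cancel_left, norm_sub_rev]
    calc _ ≤ l ^ n / l ^ 3 * ((L * (l * ‖x - x'‖) * F) * (2 * (v / l ^ n))) := by
          gcongr
          exact e1.trans (by gcongr)
      _ = 2 * v * L * F * ‖x - x'‖ / l ^ 2 := by field_simp
      _ ≤ _ := by gcongr
  have := norm_sub_le_of_hasDerivAt_scale (n := n)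
    (Φ := fun l => mollify u l x - mollify u l x')
    (I := fun l => (∫ y, cutoff (l ^ 2 * ‖y - x‖ ^ 2) • f y) -
        ∫ y, cutoff (l ^ 2 * ‖y - x'‖ ^ 2) • f y)
    (fun l hl => by
      simpa only [smul_sub] using (hasDerivAt_mollify hn hu huf hl x).fun_sub
        (hasDerivAt_mollify hn hu huf hl x')) hB
  rw [sub_sub_sub_comm]
  refine this.trans ?_
  have h24 : (1 / 4 : ℝ) ^ j ≤ (1 / 2) ^ j := pow_le_pow_left₀ (by norm_num) (by norm_num) j
  calc _ = 4 * v * L * F * (1 / 4) ^ j * ‖x - x'‖ := by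
        rw [one_div_pow]
        field_simp
        ring
    _ ≤ _ := by gcongr

/-- If `Δu = f` with `f` locally square-integrable, then `u` has a continuous representative. -/
theorem exists_continuous_of_isDistribLaplacian (hn : 0 < n) (hn3 : n ≤ 3)
    (hu : LocallyIntegrable u) (hf2 : LocallyIntegrable fun y => ‖f y‖ ^ 2)
    (huf : IsDistribLaplacian u f) :
    ∃ v, Continuous v ∧ u =ᵐ[volume] v := by
  obtain ⟨H, hH⟩ := exists_tendstoLocallyUniformly
    (h := fun j : ℕ => mollify u (4 ^ j)) (exists_norm_mollify_sub_le hn hn3 hu hf2 huf)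
  have hHc : Continuous H := hH.continuous
    (Frequently.of_forall fun j => (contDiff_mollify hu (by positivity)).continuous)
  refine ⟨fun x => (mollMass n)⁻¹ • H x, hHc.fun_const_smul _, ?_⟩
  filter_upwards [ae_tendsto_mollify hn hu] with x hx
  exact tendsto_nhds_unique hx (((tendstoLocallyUniformlyOn_univ.2 hH).tendsto_at (Set.mem_univ x)).const_smul _)

/-- If `Δu = f` with `f` locally bounded, then `u` has a `C¹` representative. -/
theorem exists_contDiff_of_isDistribLaplacian (hn : 0 < n) (hn3 : n ≤ 3)
    (hu : LocallyIntegrable u) (hfm : AEStronglyMeasurable f volume) (hf : LocallyEssBounded f)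
    (hf2 : LocallyIntegrable fun y => ‖f y‖ ^ 2) (huf : IsDistribLaplacian u f) :
    ∃ v, ContDiff ℝ 1 v ∧ u =ᵐ[volume] v := by
  obtain ⟨H, hH⟩ := exists_tendstoLocallyUniformly
    (h := fun j : ℕ => mollify u (4 ^ j)) (exists_norm_mollify_sub_le hn hn3 hu hf2 huf)
  have hM : ∀ j : ℕ, ContDiff ℝ 1 (mollify u (4 ^ j)) := fun j =>
    contDiff_mollify hu (by positivity)
  have hMd : ∀ j : ℕ, Differentiable ℝ (mollify u (4 ^ j)) := fun j =>
    (hM j).differentiable one_ne_zero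
  obtain ⟨H', hH'⟩ := exists_tendstoLocallyUniformly
    (h := fun j : ℕ => fderiv ℝ (mollify u (4 ^ j))) (fun R => by
      -- Local Lipschitz constants of the increments bound their derivatives; R + 1 leaves room for
      -- a neighbourhood of x.
      obtain ⟨C, hC0, hC⟩ := exists_norm_mollify_sub_sub_le hn hu hfm hf huf (R + 1)
      refine ⟨C, fun j x hx => ?_⟩
      rw [← fderiv_sub (hMd (j + 1) x) (hMd j x)]
      refine norm_fderiv_le_of_lip' ℝ (by positivity) ?_
      filter_upwards [Metric.ball_mem_nhds x one_pos] with y hy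
      refine hC j y x ?_ (by linarith)
      rw [mem_ball_iff_norm] at hy
      linarith [norm_le_norm_sub_add y x])
  have hH'c : Continuous H' := hH'.continuous
    (Frequently.of_forall fun j => (hM j).continuous_fderiv one_ne_zero)
  have hder : ∀ x, HasFDerivAt H (H' x) x := fun x =>
    hasFDerivAt_of_tendstoLocallyUniformlyOn isOpen_univ
      (tendstoLocallyUniformlyOn_univ.2 hH') (fun j x _ => (hMd j x).hasFDerivAt)
      (fun x _ => (tendstoLocallyUniformlyOn_univ.2 hH).tendsto_at (Set.mem_univ x)) (Set.mem_univ x)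
  have hHC : ContDiff ℝ 1 H := by
    refine contDiff_one_iff_fderiv.2 ⟨fun x => (hder x).differentiableAt, ?_⟩
    rwa [show fderiv ℝ H = H' from funext fun x => (hder x).fderiv]
  refine ⟨fun x => (mollMass n)⁻¹ • H x, hHC.const_smul _, ?_⟩
  filter_upwards [ae_tendsto_mollify hn hu] with x hx
  exact tendsto_nhds_unique hx (((tendstoLocallyUniformlyOn_univ.2 hH).tendsto_at (Set.mem_univ x)).const_smul _)

end Estimates

/-! ### Weak Laplacians and the weak divergence of `v ∇w - w ∇v` -/

section WeakLaplacian

variable {n : ℕ}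

lemma contDiff_partialDeriv {φ : EuclideanSpace ℝ (Fin n) → ℝ} (hφ : ContDiff ℝ ∞ φ) (i : Fin n) :
    ContDiff ℝ ∞ (partialDeriv i φ) :=
  (hφ.fderiv_right (m := ∞) (by simp)).clm_apply contDiff_const

lemma hasCompactSupport_partialDeriv {φ : EuclideanSpace ℝ (Fin n) → ℝ} (hφ : HasCompactSupport φ)
    (i : Fin n) : HasCompactSupport (partialDeriv i φ) :=
  hφ.fderiv_apply ℝ _

lemma partialDeriv_mul {φ ψ : EuclideanSpace ℝ (Fin n) → ℝ} (hφ : ContDiff ℝ ∞ φ)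
    (hψ : ContDiff ℝ ∞ ψ) (i : Fin n) (x : EuclideanSpace ℝ (Fin n)) :
    partialDeriv i (fun x => φ x * ψ x) x =
      φ x * partialDeriv i ψ x + ψ x * partialDeriv i φ x := by
  rw [partialDeriv, fderiv_fun_mul (hφ.differentiable (by simp) x)
    (hψ.differentiable (by simp) x)]
  simp [partialDeriv]

/-- Integration by parts against a `C¹` function. -/
lemma integral_partialDeriv_smul {v : EuclideanSpace ℝ (Fin n) → ℂ} (hv : ContDiff ℝ 1 v)
    {ψ : EuclideanSpace ℝ (Fin n) → ℝ} (hψ : ContDiff ℝ ∞ ψ) (hψc : HasCompactSupport ψ)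
    (i : Fin n) :
    ∫ x, partialDeriv i ψ x • v x = -∫ x, ψ x • fderiv ℝ v x (EuclideanSpace.single i 1) := by
  have hdv : Continuous fun x => fderiv ℝ v x (EuclideanSpace.single i 1) :=
    (hv.continuous_fderiv one_ne_zero).clm_apply continuous_const
  rw [integral_smul_fderiv_eq_neg_fderiv_smul_of_integrable (𝕜 := ℝ), neg_neg]
  · rfl
  · exact hv.continuous.locallyIntegrable.integrable_smul_left_of_hasCompactSupport
      (contDiff_partialDeriv hψ i).continuous (hasCompactSupport_partialDeriv hψc i)
  · exact hdv.locallyIntegrable.integrable_smul_left_of_hasCompactSupport hψ.continuous hψc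
  · exact hv.continuous.locallyIntegrable.integrable_smul_left_of_hasCompactSupport
      hψ.continuous hψc
  · exact fun x _ => hψ.differentiable (by simp) x
  · exact fun x _ => hv.differentiable one_ne_zero x

lemma integral_sum_partialDeriv_smul {v : EuclideanSpace ℝ (Fin n) → ℂ} (hv : LocallyIntegrable v)
    {φ : EuclideanSpace ℝ (Fin n) → ℝ} (hφ : ContDiff ℝ ∞ φ) (hφc : HasCompactSupport φ) :
    ∫ x, (∑ i, partialDeriv i (partialDeriv i φ) x) • v x =
      ∑ i, ∫ x, partialDeriv i (partialDeriv i φ) x • v x := by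
  simp_rw [Finset.sum_smul]
  exact integral_finsetSum _ fun i _ => hv.integrable_smul_left_of_hasCompactSupport
    (contDiff_partialDeriv (contDiff_partialDeriv hφ i) i).continuous
    (hasCompactSupport_partialDeriv (hasCompactSupport_partialDeriv hφc i) i)

lemma IsDistribLaplacian.congr {u v f : EuclideanSpace ℝ (Fin n) → ℂ}
    (h : IsDistribLaplacian u f) (huv : u =ᵐ[volume] v) : IsDistribLaplacian v f := by
  intro φ hφ hφc
  rw [← h φ hφ hφc]
  refine integral_congr_ae ?_
  filter_upwards [huv] with x hx
  rw [hx]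

lemma IsDistribLaplacian.congr_right {u f g : EuclideanSpace ℝ (Fin n) → ℂ}
    (h : IsDistribLaplacian u f) (hfg : f =ᵐ[volume] g) : IsDistribLaplacian u g := by
  intro φ hφ hφc
  rw [h φ hφ hφc]
  refine integral_congr_ae ?_
  filter_upwards [hfg] with x hx
  rw [hx]

lemma IsDistribLaplacian.sub {u v f g : EuclideanSpace ℝ (Fin n) → ℂ}
    (h : IsDistribLaplacian u f) (h' : IsDistribLaplacian v g) (hu : LocallyIntegrable u)
    (hv : LocallyIntegrable v) (hf : LocallyIntegrable f) (hg : LocallyIntegrable g) :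
    IsDistribLaplacian (fun x => u x - v x) (fun x => f x - g x) := by
  intro φ hφ hφc
  have hΔ : Continuous fun x => ∑ i, partialDeriv i (partialDeriv i φ) x :=
    continuous_finsetSum _ fun i _ =>
      (contDiff_partialDeriv (contDiff_partialDeriv hφ i) i).continuous
  have hΔc : HasCompactSupport fun x => ∑ i, partialDeriv i (partialDeriv i φ) x := by
    refine HasCompactSupport.intro hφc fun x hx => Finset.sum_eq_zero fun i _ => ?_
    have h0 : ∀ {ψ : EuclideanSpace ℝ (Fin n) → ℝ} {y}, y ∉ tsupport ψ → y ∉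
        tsupport (partialDeriv i ψ) := fun {ψ y} hy hy' =>
      hy (tsupport_fderiv_apply_subset ℝ (EuclideanSpace.single i 1) hy')
    exact image_eq_zero_of_notMem_tsupport (h0 (h0 hx))
  simp_rw [smul_sub]
  rw [integral_sub (hu.integrable_smul_left_of_hasCompactSupport hΔ hΔc)
    (hv.integrable_smul_left_of_hasCompactSupport hΔ hΔc),
    integral_sub (hf.integrable_smul_left_of_hasCompactSupport hφ.continuous hφc)
    (hg.integrable_smul_left_of_hasCompactSupport hφ.continuous hφc), h φ hφ hφc, h' φ hφ hφc]

/-- The weak divergence of `v ∇w - w ∇v` is `v Δw - w Δv`. -/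
lemma integral_sum_mul_partialDeriv_eq {v F : EuclideanSpace ℝ (Fin n) → ℂ} (hv : ContDiff ℝ 1 v)
    (hF : LocallyIntegrable F) (hvF : IsDistribLaplacian v F) {w : EuclideanSpace ℝ (Fin n) → ℝ}
    (hw : ContDiff ℝ ∞ w) {φ : EuclideanSpace ℝ (Fin n) → ℝ} (hφ : ContDiff ℝ ∞ φ)
    (hφc : HasCompactSupport φ) :
    ∫ x, ∑ i, ((partialDeriv i w x : ℂ) * v x -
        (w x : ℂ) * fderiv ℝ v x (EuclideanSpace.single i 1)) * (partialDeriv i φ x : ℂ) =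
      -∫ x, (((∑ i, partialDeriv i (partialDeriv i w) x : ℝ) : ℂ) * v x - (w x : ℂ) * F x) *
        (φ x : ℂ) := by
  have hdv : ∀ i : Fin n, Continuous fun x => fderiv ℝ v x (EuclideanSpace.single i 1) := fun i =>
    (hv.continuous_fderiv one_ne_zero).clm_apply continuous_const
  have hvc := hv.continuous
  have hwc := hw.continuous
  have hφc' := hφ.continuous
  have hdw := fun i => (contDiff_partialDeriv hw i).continuous
  have hdφ := fun i => (contDiff_partialDeriv hφ i).continuous
  have hddw := fun i => (contDiff_partialDeriv (contDiff_partialDeriv hw i) i).continuous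
  have hdφc := fun i => hasCompactSupport_partialDeriv hφc i
  have hint : ∀ {ψ : EuclideanSpace ℝ (Fin n) → ℝ} {a : EuclideanSpace ℝ (Fin n) → ℂ},
      Continuous ψ → HasCompactSupport ψ → Continuous a → Integrable fun x => ψ x • a x :=
    fun hψ hψc ha => ha.locallyIntegrable.integrable_smul_left_of_hasCompactSupport hψ hψc
  have iA : ∀ i, Integrable fun x => partialDeriv i φ x • ((partialDeriv i w x : ℂ) * v x) :=
    fun i => hint (hdφ i) (hdφc i) (by have := hdw i; fun_prop)
  have iB : ∀ i, Integrable fun x => partialDeriv i φ x •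
      ((w x : ℂ) * fderiv ℝ v x (EuclideanSpace.single i 1)) :=
    fun i => hint (hdφ i) (hdφc i) (by have := hdv i; fun_prop)
  have iC : ∀ i, Integrable fun x => φ x •
      ((partialDeriv i w x : ℂ) * fderiv ℝ v x (EuclideanSpace.single i 1)) :=
    fun i => hint hφc' hφc (by have := hdv i; have := hdw i; fun_prop)
  have iE : ∀ i, Integrable fun x => φ x • ((partialDeriv i (partialDeriv i w) x : ℂ) * v x) :=
    fun i => hint hφc' hφc (by have := hddw i; fun_prop)
  have iF : Integrable fun x => (w x * φ x) • F x :=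
    hF.integrable_smul_left_of_hasCompactSupport (hwc.mul hφc') hφc.mul_left
  -- Test function φ ∂ᵢw against v. The cross term φ ∂ᵢw ∂ᵢv appears here and again in `h2`, and
  -- cancels in the difference.
  have h1 : ∀ i, (∫ x, partialDeriv i φ x • ((partialDeriv i w x : ℂ) * v x)) +
      (∫ x, φ x • ((partialDeriv i (partialDeriv i w) x : ℂ) * v x)) =
      -∫ x, φ x • ((partialDeriv i w x : ℂ) * fderiv ℝ v x (EuclideanSpace.single i 1)) := by
    intro i
    have := integral_partialDeriv_smul hv (hφ.mul (contDiff_partialDeriv hw i)) hφc.mul_right i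
    rw [← integral_add (iA i) (iE i)]
    convert! this using 2
    · ext x
      rw [partialDeriv_mul hφ (contDiff_partialDeriv hw i)]
      simp only [Complex.real_smul]
      push_cast
      ring
    · refine integral_congr_ae (Eventually.of_forall fun x => ?_)
      simp only [Complex.real_smul]
      push_cast
      ring
  -- The distributional equation for v is tested with wφ, admissible because w is smooth; one
  -- integration by parts leaves only first derivatives of v.
  have h2 : ∑ i, ((∫ x, partialDeriv i φ x •
        ((w x : ℂ) * fderiv ℝ v x (EuclideanSpace.single i 1))) +
      ∫ x, φ x • ((partialDeriv i w x : ℂ) * fderiv ℝ v x (EuclideanSpace.single i 1))) =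
      -∫ x, (w x * φ x) • F x := by
    have hwφ : ContDiff ℝ ∞ fun x => w x * φ x := hw.mul hφ
    have hwφc : HasCompactSupport fun x => w x * φ x := hφc.mul_left
    rw [← hvF _ hwφ hwφc, integral_sum_partialDeriv_smul hvc.locallyIntegrable hwφ hwφc,
      ← Finset.sum_neg_distrib]
    refine Finset.sum_congr rfl fun i _ => ?_
    rw [integral_partialDeriv_smul hv (contDiff_partialDeriv hwφ i)
      (hasCompactSupport_partialDeriv hwφc i), neg_neg, ← integral_add (iB i) (iC i)]
    refine integral_congr_ae (Eventually.of_forall fun x => ?_)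
    simp only
    rw [partialDeriv_mul hw hφ]
    simp only [Complex.real_smul]
    push_cast
    ring
  calc _ = ∑ i, ((∫ x, partialDeriv i φ x • ((partialDeriv i w x : ℂ) * v x)) -
        ∫ x, partialDeriv i φ x • ((w x : ℂ) * fderiv ℝ v x (EuclideanSpace.single i 1))) := by
        simp_rw [← fun i => integral_sub (iA i) (iB i)]
        rw [← integral_finsetSum _ fun i _ => by exact (iA i).sub (iB i)]
        refine integral_congr_ae (Eventually.of_forall fun x => Finset.sum_congr rfl fun i _ => ?_)
        simp only [Complex.real_smul]
        ring
    _ = -((∑ i, ∫ x, φ x • ((partialDeriv i (partialDeriv i w) x : ℂ) * v x)) -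
        ∫ x, (w x * φ x) • F x) := by
        have h3 := Finset.sum_congr (rfl : (Finset.univ : Finset (Fin n)) = _) fun i _ => h1 i
        rw [Finset.sum_add_distrib, Finset.sum_neg_distrib] at h3
        rw [Finset.sum_add_distrib] at h2
        rw [Finset.sum_sub_distrib]
        linear_combination h3 - h2
    _ = _ := by
        rw [← integral_finsetSum _ fun i _ => iE i, ← integral_sub
          (integrable_finsetSum _ fun i _ => iE i) iF]
        congr 1
        refine integral_congr_ae (Eventually.of_forall fun x => ?_)
        simp only [Complex.real_smul]
        push_cast
        rw [sub_mul, Finset.sum_mul, Finset.sum_mul]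
        congr 1
        · exact Finset.sum_congr rfl fun i _ => by ring
        · ring

end WeakLaplacian

/-! ### Fields in `L²_loc`, plane waves, and representatives -/

section Fields

variable {n : ℕ}

lemma MemL2Loc.locallyIntegrable {u : EuclideanSpace ℝ (Fin n) → ℂ} (hu : MemL2Loc u) :
    LocallyIntegrable u :=
  locallyIntegrable_iff.2 fun K hK => by
    have : IsFiniteMeasure (volume.restrict K) := isFiniteMeasure_restrict.2 hK.measure_ne_top
    exact (hu K hK).integrable one_le_two

lemma exists_ae_norm_le_of_memLp_top {η : EuclideanSpace ℝ (Fin n) → ℂ} (hη : MemLp η ⊤ volume) :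
    ∃ C : ℝ, 0 ≤ C ∧ ∀ᵐ x, ‖η x‖ ≤ C := by
  have hlt : eLpNormEssSup η volume < ⊤ := by simpa [eLpNorm_exponent_top] using hη.2
  refine ⟨(eLpNormEssSup η volume).toReal, ENNReal.toReal_nonneg, ?_⟩
  filter_upwards [ae_le_eLpNormEssSup (f := η) (μ := volume)] with x hx
  rw [← toReal_enorm]
  exact ENNReal.toReal_mono hlt.ne hx

lemma locallyEssBounded_of_memLp_top {η : EuclideanSpace ℝ (Fin n) → ℂ} (hη : MemLp η ⊤ volume) :
    LocallyEssBounded η := fun _ =>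
  (exists_ae_norm_le_of_memLp_top hη).imp fun _ h => ⟨h.1, h.2.mono fun _ hx _ => hx⟩

lemma LocallyEssBounded.mul {f g : EuclideanSpace ℝ (Fin n) → ℂ} (hf : LocallyEssBounded f)
    (hg : LocallyEssBounded g) : LocallyEssBounded fun x => f x * g x := fun R => by
  obtain ⟨C, hC0, hC⟩ := hf R
  obtain ⟨C', hC'0, hC'⟩ := hg R
  refine ⟨C * C', by positivity, ?_⟩
  filter_upwards [hC, hC'] with x h1 h2 hx
  rw [norm_mul]
  exact mul_le_mul (h1 hx) (h2 hx) (norm_nonneg _) hC0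

lemma LocallyEssBounded.add {f g : EuclideanSpace ℝ (Fin n) → ℂ} (hf : LocallyEssBounded f)
    (hg : LocallyEssBounded g) : LocallyEssBounded fun x => f x + g x := fun R => by
  obtain ⟨C, hC0, hC⟩ := hf R
  obtain ⟨C', hC'0, hC'⟩ := hg R
  refine ⟨C + C', by positivity, ?_⟩
  filter_upwards [hC, hC'] with x h1 h2 hx
  exact (norm_add_le _ _).trans (add_le_add (h1 hx) (h2 hx))

lemma contDiff_planeWave (k : ℝ) (d : EuclideanSpace ℝ (Fin n)) : ContDiff ℝ ∞ (planeWave k d) :=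
  (contDiff_const.mul (Complex.ofRealCLM.contDiff.comp
    (contDiff_id.inner ℝ contDiff_const))).cexp

lemma fderiv_planeWave (k : ℝ) (d x h : EuclideanSpace ℝ (Fin n)) :
    fderiv ℝ (planeWave k d) x h = Complex.I * k * (inner ℝ h d : ℝ) * planeWave k d x := by
  have h1 : HasFDerivAt (fun x : EuclideanSpace ℝ (Fin n) => ((inner ℝ x d : ℝ) : ℂ))
      (Complex.ofRealCLM.comp (innerSL ℝ d)) x := by
    refine (Complex.ofRealCLM.comp (innerSL ℝ d)).hasFDerivAt.congr_of_eventuallyEq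
      (Eventually.of_forall fun y => ?_)
    simp [real_inner_comm]
  have h2 := (h1.const_mul (Complex.I * (k : ℂ))).cexp
  unfold planeWave
  rw [h2.fderiv]
  simp [real_inner_comm]
  ring

lemma isDistribLaplacian_planeWave (k : ℝ) {d : EuclideanSpace ℝ (Fin n)} (hd : ‖d‖ = 1) :
    IsDistribLaplacian (planeWave k d) fun x => -(k : ℂ) ^ 2 * planeWave k d x := by
  have hp : ContDiff ℝ 1 (planeWave k d) := (contDiff_planeWave k d).of_le (mod_cast le_top)
  intro φ hφ hφc
  rw [integral_sum_partialDeriv_smul hp.continuous.locallyIntegrable hφ hφc]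
  have h1 : ∀ i, ∫ x, partialDeriv i (partialDeriv i φ) x • planeWave k d x =
      (-(k : ℂ) ^ 2 * (d i : ℂ) ^ 2) * ∫ x, φ x • planeWave k d x := by
    intro i
    have h2 : ∀ x, fderiv ℝ (planeWave k d) x (EuclideanSpace.single i 1) =
        (Complex.I * k * d i) * planeWave k d x := fun x => by
      rw [fderiv_planeWave, EuclideanSpace.inner_single_left]
      simp
    rw [integral_partialDeriv_smul hp (contDiff_partialDeriv hφ i)
      (hasCompactSupport_partialDeriv hφc i)]
    simp_rw [h2, ← mul_smul_comm]
    rw [integral_const_mul, integral_partialDeriv_smul hp hφ hφc]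
    simp_rw [h2, ← mul_smul_comm]
    rw [integral_const_mul]
    linear_combination (k : ℂ) ^ 2 * (d i : ℂ) ^ 2 * (∫ x, φ x • planeWave k d x) * Complex.I_sq
  have h3 : ∑ i, (d i : ℂ) ^ 2 = 1 := by
    have := EuclideanSpace.real_norm_sq_eq d
    rw [hd, one_pow] at this
    exact_mod_cast this.symm
  simp_rw [h1, ← mul_smul_comm]
  rw [integral_const_mul, ← Finset.sum_mul, ← Finset.mul_sum, h3, mul_one]

/-- A weak solution of the Helmholtz equation satisfies it in the sense of distributions. -/
lemma IsWeakHelmholtzSolution.isDistribLaplacian {k : ℝ} {η u : EuclideanSpace ℝ (Fin n) → ℂ}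
    (hu : IsWeakHelmholtzSolution k η u) :
    IsDistribLaplacian u fun x => -(k : ℂ) ^ 2 * (1 + η x) * u x := by
  obtain ⟨hu2, G, hG, hGu, hw⟩ := hu
  intro φ hφ hφc
  rw [integral_sum_partialDeriv_smul hu2.locallyIntegrable hφ hφc]
  have h1 : ∀ i, ∫ x, partialDeriv i (partialDeriv i φ) x • u x =
      -∫ x, G i x * (partialDeriv i φ x : ℂ) := fun i => by
    simp_rw [Complex.real_smul]
    rw [hGu i _ (contDiff_partialDeriv hφ i) (hasCompactSupport_partialDeriv hφc i)]
    simp_rw [mul_comm]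
  simp_rw [h1]
  rw [Finset.sum_neg_distrib, ← integral_finsetSum, hw φ hφ hφc, ← integral_neg]
  · refine integral_congr_ae (Eventually.of_forall fun x => ?_)
    simp only [Complex.real_smul]
    ring
  · intro i _
    have := (hG i).locallyIntegrable.integrable_smul_left_of_hasCompactSupport
      (contDiff_partialDeriv hφ i).continuous (hasCompactSupport_partialDeriv hφc i)
    simpa only [Complex.real_smul, mul_comm] using this

/-- Weak solutions of the Helmholtz equation have `C¹` representatives. -/
theorem IsWeakHelmholtzSolution.exists_contDiff {k : ℝ} {η u : EuclideanSpace ℝ (Fin n) → ℂ}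
    (hn : 0 < n) (hn3 : n ≤ 3) (hη : MemLp η ⊤ volume) (hu : IsWeakHelmholtzSolution k η u) :
    ∃ v, ContDiff ℝ 1 v ∧ u =ᵐ[volume] v := by
  have hui := hu.1.locallyIntegrable
  have hlap := hu.isDistribLaplacian
  have hm : AEStronglyMeasurable (fun x => -(k : ℂ) ^ 2 * (1 + η x) * u x) volume :=
    ((aestronglyMeasurable_const.add hη.1).const_mul _).mul hui.aestronglyMeasurable
  obtain ⟨C, hC0, hC⟩ := exists_ae_norm_le_of_memLp_top hη
  have hf2 : LocallyIntegrable fun x => ‖-(k : ℂ) ^ 2 * (1 + η x) * u x‖ ^ 2 := by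
    refine locallyIntegrable_iff.2 fun K hK => ?_
    refine (memLp_two_iff_integrable_sq_norm hm.restrict).1 ?_
    refine (hu.1 K hK).of_le_mul hm.restrict (c := k ^ 2 * (1 + C)) (ae_restrict_of_ae ?_)
    filter_upwards [hC] with x hx
    rw [norm_mul, norm_mul, norm_neg, norm_pow, Complex.norm_real, Real.norm_eq_abs, sq_abs]
    gcongr
    refine (norm_add_le _ _).trans ?_
    rw [norm_one]
    gcongr
  -- Bootstrap: the L² estimate makes u continuous, so the right-hand side, a bounded function times
  -- u, is locally bounded and the C¹ result applies.
  obtain ⟨u₀, hu₀, hu₀'⟩ := exists_continuous_of_isDistribLaplacian hn hn3 hui hf2 hlap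
  refine exists_contDiff_of_isDistribLaplacian hn hn3 hui hm ?_ hf2 hlap
  have hb : LocallyEssBounded fun x => -(k : ℂ) ^ 2 * (1 + η x) * u₀ x :=
    ((continuous_const.locallyEssBounded).mul ((continuous_const.locallyEssBounded).add
      (locallyEssBounded_of_memLp_top hη))).mul hu₀.locallyEssBounded
  intro R
  obtain ⟨B, hB0, hB⟩ := hb R
  refine ⟨B, hB0, ?_⟩
  filter_upwards [hB, hu₀'] with x hx hx'
  rwa [hx']

lemma tendsto_average_ball {f : EuclideanSpace ℝ (Fin n) → ℂ} (hf : Continuous f)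
    (x : EuclideanSpace ℝ (Fin n)) :
    Tendsto (fun r => ⨍ y in Metric.ball x r, f y) (𝓝[>] (0 : ℝ)) (𝓝 (f x)) := by
  rw [Metric.nhds_basis_closedBall.tendsto_right_iff]
  intro ε hε
  obtain ⟨δ, hδ, h⟩ := Metric.continuous_iff.1 hf x ε hε
  filter_upwards [Ioo_mem_nhdsGT hδ] with r hr
  refine (convex_closedBall _ _).set_average_mem Metric.isClosed_closedBall
    (Metric.measure_ball_pos volume x hr.1).ne' measure_ball_lt_top.ne ?_ ?_
  · refine (ae_restrict_iff' Metric.isOpen_ball.measurableSet).2 (Eventually.of_forall fun y hy => ?_)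
    exact (h y (lt_trans hy hr.2)).le
  · exact (hf.locallyIntegrable.integrableOn_isCompact (isCompact_closedBall x r)).mono_set
      Metric.ball_subset_closedBall

/-- `rep` depends only on ball averages, hence only on the almost everywhere class of f. -/
lemma rep_eq_of_ae_eq {f g : EuclideanSpace ℝ (Fin n) → ℂ} (hg : Continuous g)
    (hfg : f =ᵐ[volume] g) : rep f = g := by
  ext x
  refine Tendsto.limUnder_eq ((tendsto_average_ball hg x).congr fun r => ?_)
  exact (average_congr (ae_restrict_of_ae hfg)).symm

/-- The scattered field has a `C¹` representative, which satisfies an inhomogeneous Helmholtz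
equation. -/
lemma IsScatteredField.regularity {k : ℝ} {η usc : EuclideanSpace ℝ (Fin n) → ℂ}
    {d : EuclideanSpace ℝ (Fin n)} (hn : 0 < n) (hn3 : n ≤ 3) (hη : MemLp η ⊤ volume)
    (hd : ‖d‖ = 1) (h : IsScatteredField k η d usc) :
    usc =ᵐ[volume] rep usc ∧ ContDiff ℝ 1 (rep usc) ∧ IsDistribLaplacian (rep usc) fun x =>
      -(k : ℂ) ^ 2 * rep usc x - (k : ℂ) ^ 2 * (η x * totalField k d (rep usc) x) := by
  obtain ⟨v, hv, huv⟩ := h.weakSolution.exists_contDiff hn hn3 hη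
  have hp : ContDiff ℝ 1 (planeWave k d) := (contDiff_planeWave k d).of_le (mod_cast le_top)
  have hvp : ContDiff ℝ 1 fun x => v x - planeWave k d x := hv.sub hp
  have hae : usc =ᵐ[volume] fun x => v x - planeWave k d x := by
    filter_upwards [huv] with x hx
    rw [← hx, totalField, add_sub_cancel_right]
  have hrep := rep_eq_of_ae_eq hvp.continuous hae
  rw [hrep]
  refine ⟨hae, hvp, ?_⟩
  have h1 := (h.weakSolution.isDistribLaplacian.congr huv).congr_right
    (g := fun x => -(k : ℂ) ^ 2 * (1 + η x) * v x) (by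
      filter_upwards [huv] with x hx
      rw [hx])
  have hηb := locallyEssBounded_of_memLp_top hη
  have hf : LocallyIntegrable fun x => -(k : ℂ) ^ 2 * (1 + η x) * v x :=
    LocallyEssBounded.locallyIntegrable
      (((continuous_const.locallyEssBounded).mul ((continuous_const.locallyEssBounded).add
        hηb)).mul hv.continuous.locallyEssBounded)
      (((aestronglyMeasurable_const.add hη.1).const_mul _).mul hv.continuous.aestronglyMeasurable)
  -- With v the total field and p the plane wave, −k²(1 + η)v + k²p = −k²(v − p) − k²ηv.
  have h2 := h1.sub (isDistribLaplacian_planeWave k hd) hv.continuous.locallyIntegrable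
    hp.continuous.locallyIntegrable hf (hp.continuous.const_mul _).locallyIntegrable
  convert! h2 using 2 with x
  simp only [totalField]
  ring

end Fields

/-! ### The boundary integral of the imaging functional -/

section BoundaryIntegral

variable {n : ℕ} {Ω D : Set (EuclideanSpace ℝ (Fin n))}

/-- Points are null because the Hausdorff dimension n − 1 is positive. This matters when z lies on
∂Ω. -/
lemma surfaceMeasure_singleton (hn : 2 ≤ n) (z : EuclideanSpace ℝ (Fin n)) :
    surfaceMeasure Ω {z} = 0 := by
  have hd : (0 : ℝ) < ((n - 1 : ℕ) : ℝ) := by exact_mod_cast (by omega : 0 < n - 1)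
  have := Measure.nullSingletonClass_hausdorff (EuclideanSpace ℝ (Fin n)) hd
  refine Measure.absolutelyContinuous_of_le Measure.restrict_le_self ?_
  rw [Measure.euclideanHausdorffMeasure, Measure.smul_apply, measure_singleton, smul_zero]

lemma ae_surfaceMeasure_ne (hn : 2 ≤ n) (z : EuclideanSpace ℝ (Fin n)) :
    ∀ᵐ x ∂surfaceMeasure Ω, x ≠ z := by
  rw [ae_iff]
  simpa using surfaceMeasure_singleton (Ω := Ω) hn z

lemma ae_volume_ne (hn : 0 < n) (z : EuclideanSpace ℝ (Fin n)) :
    ∀ᵐ x : EuclideanSpace ℝ (Fin n), x ≠ z := by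
  have : Nontrivial (EuclideanSpace ℝ (Fin n)) :=
    Module.nontrivial_of_finrank_pos (R := ℝ) (by simpa using hn)
  rw [ae_iff]
  simp

lemma apply_eq_sum_single {W : Type*} [NormedAddCommGroup W] [NormedSpace ℝ W]
    (L : EuclideanSpace ℝ (Fin n) →L[ℝ] W) (h : EuclideanSpace ℝ (Fin n)) :
    L h = ∑ i, h i • L (EuclideanSpace.single i 1) := by
  conv_lhs => rw [← (EuclideanSpace.basisFun (Fin n) ℝ).sum_repr h]
  simp [map_sum]

variable {k : ℝ} {z : EuclideanSpace ℝ (Fin n)} {v : EuclideanSpace ℝ (Fin n) → ℂ}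

lemma boundaryIntegrand_eq (hn : n = 2 ∨ n = 3) (hk : 0 < k) {x : EuclideanSpace ℝ (Fin n)}
    (hxz : x ≠ z) :
    boundaryIntegrand k Ω v z x = ∑ i,
      ((partialDeriv i (radialWave k (greenConst n k) z) x : ℂ) * v x -
        (radialWave k (greenConst n k) z x : ℂ) * fderiv ℝ v x (EuclideanSpace.single i 1)) *
        (outwardNormal Ω x i : ℂ) := by
  -- Agreement near x, not only at x, is what identifies derivatives. The coercion to ℂ sits inside:
  -- `normalDeriv` acts on a complex-valued function.
  have hloc : (fun x' => ((green k x' z).im : ℂ)) =ᶠ[𝓝 x]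
      fun x' => (radialWave k (greenConst n k) z x' : ℂ) := by
    filter_upwards [isOpen_ne.mem_nhds hxz] with y hy
    rw [im_green_eq_radialWave hn hk hy]
  have hw : HasFDerivAt (radialWave k (greenConst n k) z)
      (fderiv ℝ (radialWave k (greenConst n k) z) x) x :=
    ((contDiff_radialWave (by omega) z).differentiable (by simp) x).hasFDerivAt
  have hwc : HasFDerivAt (fun x' => (radialWave k (greenConst n k) z x' : ℂ))
      (Complex.ofRealCLM.comp (fderiv ℝ (radialWave k (greenConst n k) z) x)) x :=
    Complex.ofRealCLM.hasFDerivAt.comp x hw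
  rw [boundaryIntegrand, normalDeriv, normalDeriv, hloc.fderiv_eq, hwc.fderiv,
    im_green_eq_radialWave hn hk hxz, ContinuousLinearMap.comp_apply, Complex.ofRealCLM_apply,
    apply_eq_sum_single (fderiv ℝ (radialWave k (greenConst n k) z) x),
    apply_eq_sum_single (fderiv ℝ v x)]
  push_cast
  rw [Finset.sum_mul, Finset.mul_sum, ← Finset.sum_sub_distrib]
  refine Finset.sum_congr rfl fun i _ => ?_
  rw [partialDeriv, smul_eq_mul, Complex.real_smul]
  push_cast
  ring

lemma continuous_waveField (hn : 0 < n) {c : ℝ} (hv : ContDiff ℝ 1 v) (i : Fin n) :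
    Continuous fun x => (partialDeriv i (radialWave k c z) x : ℂ) * v x -
      (radialWave k c z x : ℂ) * fderiv ℝ v x (EuclideanSpace.single i 1) := by
  have h1 := (contDiff_radialWave (k := k) (c := c) hn z).continuous
  have h2 := (contDiff_partialDeriv (contDiff_radialWave (k := k) (c := c) hn z) i).continuous
  have h3 : Continuous fun x => fderiv ℝ v x (EuclideanSpace.single i 1) :=
    (hv.continuous_fderiv one_ne_zero).clm_apply continuous_const
  have h4 := hv.continuous
  fun_prop

lemma integrable_boundaryIntegrand (hn : n = 2 ∨ n = 3) (hk : 0 < k) (hΩ : IsBoundedLipschitz Ω)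
    (hv : ContDiff ℝ 1 v) : Integrable (boundaryIntegrand k Ω v z) (surfaceMeasure Ω) := by
  have h : Integrable (fun x => ∑ i,
      ((partialDeriv i (radialWave k (greenConst n k) z) x : ℂ) * v x -
        (radialWave k (greenConst n k) z x : ℂ) * fderiv ℝ v x (EuclideanSpace.single i 1)) *
        (outwardNormal Ω x i : ℂ)) (surfaceMeasure Ω) := by
    refine integrable_finsetSum _ fun i _ => ?_
    have := hΩ.integrable_mul_inner_complex (continuous_waveField (k := k) (z := z)
      (c := greenConst n k) (by omega) hv i) (EuclideanSpace.single i 1)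
    simpa [EuclideanSpace.inner_single_right] using this
  refine h.congr ?_
  filter_upwards [ae_surfaceMeasure_ne (by omega) z] with x hx
  rw [boundaryIntegrand_eq hn hk hx]

variable {η : EuclideanSpace ℝ (Fin n) → ℂ} {p : EuclideanSpace ℝ (Fin n) → ℂ}

lemma locallyEssBounded_radialWave_mul (hn : 0 < n) {c : ℝ} (hη : MemLp η ⊤ volume)
    (hp : Continuous p) : LocallyEssBounded fun x => (radialWave k c z x : ℂ) * η x * p x :=
  ((Complex.continuous_ofReal.comp (contDiff_radialWave hn z).continuous).locallyEssBounded.mul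
    (locallyEssBounded_of_memLp_top hη)).mul hp.locallyEssBounded

lemma aestronglyMeasurable_radialWave_mul (hn : 0 < n) {c : ℝ} (hη : MemLp η ⊤ volume)
    (hp : Continuous p) :
    AEStronglyMeasurable (fun x => (radialWave k c z x : ℂ) * η x * p x) volume :=
  ((Complex.continuous_ofReal.comp
    (contDiff_radialWave hn z).continuous).aestronglyMeasurable.mul hη.1).mul
    hp.aestronglyMeasurable

lemma ae_green_mul_eq (hn : n = 2 ∨ n = 3) (hk : 0 < k) {u : EuclideanSpace ℝ (Fin n) → ℂ}
    (hup : u =ᵐ[volume] p) :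
    (fun y => ((green k y z).im : ℂ) * η y * u y) =ᵐ[volume]
      fun y => (radialWave k (greenConst n k) z y : ℂ) * η y * p y := by
  filter_upwards [hup, ae_volume_ne (by omega) z] with y hy hyz
  rw [hy, im_green_eq_radialWave hn hk hyz]

lemma integrableOn_green_mul (hn : n = 2 ∨ n = 3) (hk : 0 < k) (hD : IsBoundedLipschitz D)
    (hη : MemLp η ⊤ volume) {u : EuclideanSpace ℝ (Fin n) → ℂ} (hp : Continuous p)
    (hup : u =ᵐ[volume] p) :
    IntegrableOn (fun y => ((green k y z).im : ℂ) * η y * u y) D := by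
  have h := (locallyEssBounded_radialWave_mul (k := k) (c := greenConst n k) (z := z)
    (by omega) hη hp).locallyIntegrable (aestronglyMeasurable_radialWave_mul (by omega) hη hp)
  have h2 := (h.integrableOn_isCompact hD.isBounded.isCompact_closure).mono_set
    (subset_closure (s := D))
  exact h2.congr (ae_restrict_of_ae (ae_green_mul_eq hn hk hup).symm)

/-- Green's representation of the boundary integral as a volume integral over the scatterer. -/
theorem integral_boundaryIntegrand (hn : n = 2 ∨ n = 3) (hk : 0 < k) (hD : IsBoundedLipschitz D)
    (hΩ : IsBoundedLipschitz Ω) (hDΩ : D ⊆ Ω) (hη : MemLp η ⊤ volume)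
    (hηD : ∀ᵐ x, x ∉ closure D → η x = 0) (hv : ContDiff ℝ 1 v) (hp : Continuous p)
    (hvp : IsDistribLaplacian v fun x => -(k : ℂ) ^ 2 * v x - (k : ℂ) ^ 2 * (η x * p x))
    {u : EuclideanSpace ℝ (Fin n) → ℂ} (hup : u =ᵐ[volume] p) :
    ∫ x, boundaryIntegrand k Ω v z x ∂surfaceMeasure Ω =
      (k : ℂ) ^ 2 * ∫ y in D, ((green k y z).im : ℂ) * η y * u y := by
  have hn0 : 0 < n := by omega
  set w := radialWave k (greenConst n k) z with hw
  have hwC : ContDiff ℝ ∞ w := contDiff_radialWave hn0 z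
  have hηp : LocallyIntegrable fun x => (k : ℂ) ^ 2 * (η x * p x) :=
    LocallyEssBounded.locallyIntegrable ((continuous_const.locallyEssBounded).mul
      ((locallyEssBounded_of_memLp_top hη).mul hp.locallyEssBounded))
      ((hη.1.mul hp.aestronglyMeasurable).const_mul _)
  have hF : LocallyIntegrable fun x => -(k : ℂ) ^ 2 * v x - (k : ℂ) ^ 2 * (η x * p x) :=
    (hv.continuous.const_mul _).locallyIntegrable.sub hηp
  have key := integral_boundary_eq_of_weakDivergence hΩ
    (fun i => continuous_waveField (k := k) (z := z) (c := greenConst n k) hn0 hv i)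
    (g := fun x => (k : ℂ) ^ 2 * ((w x : ℂ) * η x * p x))
    ((aestronglyMeasurable_radialWave_mul hn0 hη hp).const_mul _)
    ((continuous_const.locallyEssBounded).mul (locallyEssBounded_radialWave_mul hn0 hη hp))
    (fun φ hφ hφc => by
      -- In v Δw − w Δv the two terms −k²wv cancel, leaving k²wηp.
      rw [integral_sum_mul_partialDeriv_eq hv hF hvp hwC hφ hφc]
      congr 1
      refine integral_congr_ae (Eventually.of_forall fun x => ?_)
      simp only
      rw [hw, sum_partialDeriv_partialDeriv_radialWave hn0]
      push_cast
      ring)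
  calc _ = ∫ x, ∑ i, ((partialDeriv i w x : ℂ) * v x -
        (w x : ℂ) * fderiv ℝ v x (EuclideanSpace.single i 1)) *
        (outwardNormal Ω x i : ℂ) ∂surfaceMeasure Ω := by
        refine integral_congr_ae ?_
        filter_upwards [ae_surfaceMeasure_ne (by omega) z] with x hx
        rw [boundaryIntegrand_eq hn hk hx]
    _ = ∫ x in Ω, (k : ℂ) ^ 2 * ((w x : ℂ) * η x * p x) := key
    _ = ∫ x in D, (k : ℂ) ^ 2 * ((w x : ℂ) * η x * p x) := by
        refine setIntegral_eq_of_subset_of_ae_sdiff_eq_zero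
          hΩ.isOpen.measurableSet.nullMeasurableSet hDΩ ?_
        -- η is known to vanish only off closure D; the remaining set ∂D is null.
        have hfr : ∀ᵐ x, x ∉ frontier D := measure_eq_zero_iff_ae_notMem.1 hD.volume_frontier
        filter_upwards [hηD, hfr] with x h1 h2 hx
        have h3 : x ∉ closure D := fun hc => h2 (by
          rw [hD.isOpen.frontier_eq]
          exact ⟨hc, hx.2⟩)
        rw [h1 h3, mul_zero, zero_mul, mul_zero]
    _ = _ := by
        rw [integral_const_mul]
        congr 1
        exact integral_congr_ae (ae_restrict_of_ae (ae_green_mul_eq hn hk hup).symm)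

end BoundaryIntegral

end Scattering

end

theorem mainTheorem3 {n : ℕ} (hn : n = 2 ∨ n = 3) (k : ℝ) (hk : 0 < k)
    (D Ω : Set (EuclideanSpace ℝ (Fin n)))
    (hD : IsBoundedLipschitz D) (hΩ : IsBoundedLipschitz Ω) (hDΩ : D ⊆ Ω)
    (η : EuclideanSpace ℝ (Fin n) → ℂ) (hη : MemLp η ⊤ volume)
    (hηD : ∀ᵐ x ∂volume, x ∉ closure D → η x = 0)
    (usc : Metric.sphere (0 : EuclideanSpace ℝ (Fin n)) 1 → EuclideanSpace ℝ (Fin n) → ℂ)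
    (husc : ∀ d : Metric.sphere (0 : EuclideanSpace ℝ (Fin n)) 1, IsScatteredField k η d (usc d)) :
    -- the scattered fields are `C¹` functions, so that the Cauchy data make sense pointwise
    (∀ d, usc d =ᵐ[volume] rep (usc d) ∧ ContDiff ℝ 1 (rep (usc d))) ∧
    -- the inner integrals exist
    (∀ z d, Integrable (boundaryIntegrand k Ω (rep (usc d)) z) (surfaceMeasure Ω) ∧
      IntegrableOn (fun y => ((green k y z).im : ℂ) * η y * totalField k d (usc d) y) D volume) ∧
    -- the representation of the imaging functional
    (∀ z, imagingI2 k Ω usc z =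
      ∫⁻ d, ‖(k : ℂ) ^ 2 *
          ∫ y in D, ((green k y z).im : ℂ) * η y * totalField k d (usc d) y‖ₑ ^ 2
        ∂(volume : Measure (EuclideanSpace ℝ (Fin n))).toSphere) ∧
    -- the imaginary part of the fundamental solution
    (∀ y z : EuclideanSpace ℝ (Fin n), y ≠ z →
      (n = 2 → (green k y z).im = 1 / 4 * besselJ0 (k * ‖z - y‖)) ∧
      (n = 3 → (green k y z).im = k / (4 * Real.pi) * Real.sinc (k * ‖z - y‖))) := by
  have hn0 : 0 < n := by omega
  have hd : ∀ d : Metric.sphere (0 : EuclideanSpace ℝ (Fin n)) 1,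
      ‖(d : EuclideanSpace ℝ (Fin n))‖ = 1 := fun d => by simp
  have hreg := fun d => (husc d).regularity hn0 (by omega) hη (hd d)
  have hp : ∀ d : Metric.sphere (0 : EuclideanSpace ℝ (Fin n)) 1,
      Continuous (totalField k d (rep (usc d))) := fun d =>
    (hreg d).2.1.continuous.add (contDiff_planeWave k _).continuous
  have hup : ∀ d : Metric.sphere (0 : EuclideanSpace ℝ (Fin n)) 1,
      totalField k d (usc d) =ᵐ[volume] totalField k d (rep (usc d)) := fun d => by
    filter_upwards [(hreg d).1] with x hx
    rw [totalField, totalField, hx]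
  refine ⟨fun d => ⟨(hreg d).1, (hreg d).2.1⟩, fun z d =>
    ⟨integrable_boundaryIntegrand hn hk hΩ (hreg d).2.1,
      integrableOn_green_mul hn hk hD hη (hp d) (hup d)⟩, fun z => ?_, fun y z hyz => ⟨?_, ?_⟩⟩
  · rw [imagingI2]
    -- The integrands agree for every d, so no measurability in d is required.
    refine lintegral_congr fun d => ?_
    rw [integral_boundaryIntegrand hn hk hD hΩ hDΩ hη hηD (hreg d).2.1 (hp d) (hreg d).2.2 (hup d)]
  · intro h2
    rw [im_green_eq_two h2, norm_sub_rev]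
  · intro h3
    rw [im_green_eq_three h3 k hyz hk, norm_sub_rev]
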